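/- Let $K$ be a field (of any characteristic), $V$ a finite-dimensional $K$-vector space and $q$ a regular quadratic form on $V$, with polar form $B_q(x,y)=q(x+y)-q(x)-q(y)$; regular means that the radical of $B_q$ has dimension at most $1$ and contains no $x\neq 0$ with $q(x)=0$. An element $\gamma\in \mathrm O(V,q)$ is absolutely semisimple if the commutative $K$-algebra $K[\gamma]\subset \mathrm{End}_K(V)$ is étale. (0) Let $\gamma\in\mathrm O(V,q)$ be absolutely semisimple. Let $I$ be the set of monic divisors $P_i\in K[X]$ of the minimal polynomial of $\gamma$ such that, writing $A_i=K[X]/(P_i)$ and $\gamma_i\in A_i$ for the class of $X$, there is a $K$-automorphism $\tau_i$ of $A_i$ with $\tau_i(\gamma_i)=\gamma_i^{-1}$ and $F_i=\{x\in A_i\mid\tau_i(x)=x\}$ is a field. Let $V_i=\ker P_i(\gamma)$, an $A_i$-module on which $\gamma_i$ acts as $\gamma$. Then $(K[\gamma],\gamma)\simeq\prod_{i\in I}(A_i,\gamma_i)$, and $V=\bigoplus_{i\in I}V_i$ is an orthogonal direct sum. Each $i\in I$ is of one of the following types: - $i\in I_{\mathrm{triv}}$: $\gamma_i^2=1$ and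 $A_i=K$; - $i\in I_{\mathrm{field}}$: $\gamma_i^2\ne1$ and $A_i$ is a field of degree $2$ over $F_i$; - $i\in I_{\mathrm{split}}$: $\gamma_i^2\neq1$ and there is an isomorphism of $F_i$-algebras $A_i\simeq F_i\times F_i$ under which $\tau_i$ swaps the two factors. For every $i$ there is a unique $\tau_i$-hermitian form $h_i:V_i\to F_i$ with $q(v)=\mathrm{Tr}_{F_i/K}(h_i(v))$ for all $v\in V_i$. Here a $\tau_i$-hermitian form is a quadratic form if $\tau_i$ is trivial, and otherwise a map of the form $h_i(v)=B_i(v,v)$ for a $\tau_i$-sesquilinear $B_i:V_i\times V_i\to A_i$ with $B_i(w,v)=\tau_i(B_i(v,w))$; the statement includes the uniqueness of $B_i$. (1) Let $\gamma,\gamma'\in\mathrm O(V,q)$ be absolutely semisimple, with data $(A_i,\gamma_i,V_i,h_i)_{i\in I}$ and $(A'_j,\gamma'_j,V'_j,h'_j)_{j\in I'}$ as in (0). Then $\gamma$ and $\gamma'$ are conjugate in $\mathrm O(V,q)$ if and only if there are a bijection $\sigma:I\to I'$ and, for every $i\in I$, an isomorphism of $K$-algebras $\varphi_i:A_i\simeq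 A'_{\sigma(i)}$ with $\varphi_i(\gamma_i)=\gamma'_{\sigma(i)}$ and a $\varphi_i$-semilinear isomorphism $f_i:V_i\simeq V'_{\sigma(i)}$ with $h'_{\sigma(i)}(f_i(v))=\varphi_i(h_i(v))$ for all $v\in V_i$. (2) Let $\gamma\in\mathrm O(V,q)$ be absolutely semisimple. For each $i\in I_{\mathrm{split}}$ fix an isomorphism $A_i\simeq F_i\times F_i$ as in (0), and let $W_i$ be the first component of the $F_i\times F_i$-module $V_i$. Then restriction to the $V_i$ (for $i\in I_{\mathrm{triv}}\cup I_{\mathrm{field}}$) and to the $W_i$ (for $i\in I_{\mathrm{split}}$) defines an isomorphism of group functors on commutative $K$-algebras $$\mathrm{Cent}(\gamma,\mathbf O(V,q))\;\simeq\;\prod_{i\in I_{\mathrm{triv}}}\mathbf O(V_i,h_i)\times\prod_{i\in I_{\mathrm{field}}}\mathrm{Res}_{F_i/K}\mathbf U(V_i,h_i)\times\prod_{i\in I_{\mathrm{split}}}\mathrm{Res}_{F_i/K}\mathbf{GL}(W_i).$$ -/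

import Mathlib

open CategoryTheory TensorProduct Polynomial

universe u

noncomputable section

/-! ### Group functors on commutative algebras

An algebraic group over `F` is described by its functor of points on commutative `F`-algebras. -/

/-- Group-valued functors on commutative `F`-algebras. -/
abbrev GroupFunctor (F : Type u) [CommRing F] := CommAlgCat.{u} F ⥤ GrpCat.{u}

namespace GroupFunctor

/-- The subfunctor of `G` given by a family of subgroups stable under the transition maps. -/
def sub {F : Type u} [CommRing F] (G : GroupFunctor F) (H : ∀ S, Subgroup (G.obj S))
    (stable : ∀ (S T : CommAlgCat.{u} F) (f : S ⟶ T) (g : G.obj S), g ∈ H S →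
      (G.map f).hom g ∈ H T) : GroupFunctor F where
  obj S := GrpCat.of (H S)
  map {S T} f := GrpCat.ofHom
    (((G.map f).hom.comp (H S).subtype).codRestrict (H T) fun g => stable S T f g.1 g.2)
  map_id S := by
    refine GrpCat.hom_ext (MonoidHom.ext fun g => Subtype.ext ?_)
    change (G.map (𝟙 S)).hom g.1 = g.1
    rw [G.map_id]
    rfl
  map_comp {S T U} f f' := by
    refine GrpCat.hom_ext (MonoidHom.ext fun g => Subtype.ext ?_)
    change (G.map (f ≫ f')).hom g.1 = (G.map f').hom ((G.map f).hom g.1)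
    rw [G.map_comp]
    rfl

/-- The product of a family of group functors. -/
def pi {F : Type u} [CommRing F] {ι : Type u} (G : ι → GroupFunctor F) : GroupFunctor F where
  obj S := GrpCat.of (∀ i, (G i).obj S)
  map f := GrpCat.ofHom (MonoidHom.pi fun i => ((G i).map f).hom.comp (Pi.evalMonoidHom _ i))
  map_id S := by
    refine GrpCat.hom_ext (MonoidHom.ext fun g => funext fun i => ?_)
    change ((G i).map (𝟙 S)).hom (g i) = g i
    rw [(G i).map_id]
    rfl
  map_comp {S T U} f f' := by
    refine GrpCat.hom_ext (MonoidHom.ext fun g => funext fun i => ?_)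
    change ((G i).map (f ≫ f')).hom (g i) = ((G i).map f').hom (((G i).map f).hom (g i))
    rw [(G i).map_comp]
    rfl

/-- The product of two group functors. -/
def prod {F : Type u} [CommRing F] (G H : GroupFunctor F) : GroupFunctor F where
  obj S := GrpCat.of (G.obj S × H.obj S)
  map f := GrpCat.ofHom ((G.map f).hom.prodMap (H.map f).hom)
  map_id S := by
    refine GrpCat.hom_ext (MonoidHom.ext fun g => ?_)
    change ((G.map (𝟙 S)).hom g.1, (H.map (𝟙 S)).hom g.2) = g
    rw [G.map_id, H.map_id]
    rfl
  map_comp {S T U} f f' := by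
    refine GrpCat.hom_ext (MonoidHom.ext fun g => ?_)
    change ((G.map (f ≫ f')).hom g.1, (H.map (f ≫ f')).hom g.2) =
      ((G.map f').hom ((G.map f).hom g.1), (H.map f').hom ((H.map f).hom g.2))
    rw [G.map_comp, H.map_comp]
    rfl

/-- Extension of scalars `R ↦ F ⊗[K] R` from `K`-algebras to `F`-algebras. -/
def extendScalars (K F : Type u) [CommRing K] [CommRing F] [Algebra K F] :
    CommAlgCat.{u} K ⥤ CommAlgCat.{u} F where
  obj R := CommAlgCat.of F (F ⊗[K] R)
  map f := CommAlgCat.ofHom (Algebra.TensorProduct.map (AlgHom.id F F) f.hom)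
  map_id R := by
    apply CommAlgCat.hom_ext
    ext x
    simp
  map_comp f g := by
    apply CommAlgCat.hom_ext
    ext x
    simp

/-- The Weil restriction `Res_{F/K} G`, with `(Res_{F/K} G)(R) = G(F ⊗[K] R)`. -/
def weilRes (K : Type u) {F : Type u} [CommRing K] [CommRing F] [Algebra K F]
    (G : GroupFunctor F) : GroupFunctor K :=
  extendScalars K F ⋙ G

end GroupFunctor

/-! ### The group functors `GL`, `O`, `U` and centralisers -/

section Subgroups

variable {R N P : Type u} [CommRing R] [AddCommGroup N] [Module R N] [AddCommGroup P] [Module R P]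

/-- The group `O(N, Q)` of automorphisms preserving a quadratic form. -/
def orthogonalGroup (Q : QuadraticForm R N) : Subgroup (LinearMap.GeneralLinearGroup R N) where
  carrier := {g | ∀ x, Q (g.val x) = Q x}
  one_mem' := fun _ => rfl
  mul_mem' := fun {g h} hg hh x => (hg (h.val x)).trans (hh x)
  inv_mem' := fun {g} hg x => by
    have h1 := hg (g⁻¹.val x)
    rw [← Module.End.mul_apply, ← Units.val_mul, mul_inv_cancel] at h1
    exact h1.symm

/-- The group of automorphisms preserving a bilinear map. -/
def isometryGroup (B : LinearMap.BilinMap R N P) :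
    Subgroup (LinearMap.GeneralLinearGroup R N) where
  carrier := {g | ∀ x y, B (g.val x) (g.val y) = B x y}
  one_mem' := fun _ _ => rfl
  mul_mem' := fun {g h} hg hh x y => (hg (h.val x) (h.val y)).trans (hh x y)
  inv_mem' := fun {g} hg x y => by
    have h1 := hg (g⁻¹.val x) (g⁻¹.val y)
    rw [← Module.End.mul_apply, ← Module.End.mul_apply, ← Units.val_mul, mul_inv_cancel] at h1
    exact h1.symm

/-- The group of automorphisms commuting with a given endomorphism. -/
def commutingGroup (φ : Module.End R N) : Subgroup (LinearMap.GeneralLinearGroup R N) where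
  carrier := {g | g.val * φ = φ * g.val}
  one_mem' := by simp
  mul_mem' := fun {g h} hg hh => Commute.mul_left (a := g.val) hg hh
  inv_mem' := fun {g} hg => Commute.units_inv_left (u := g) hg

end Subgroups

section LinearGroups

variable {F : Type u} [CommRing F] {M : Type u} [AddCommGroup M] [Module F M]

section

variable {S T U : Type u} [CommRing S] [Algebra F S] [CommRing T] [Algebra F T]
  [CommRing U] [Algebra F U]

/-- Given `f : S → T`, the `T`-linear extension to `T ⊗ M` of an `S`-linear endomorphism of
`S ⊗ M`. -/
def extendEnd (f : S →ₐ[F] T) (g : Module.End S (S ⊗[F] M)) : Module.End T (T ⊗[F] M) :=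
  LinearMap.liftBaseChange T
    ((f.toLinearMap.rTensor M) ∘ₗ (g.restrictScalars F) ∘ₗ TensorProduct.mk F S M 1)

theorem extendEnd_one_tmul (f : S →ₐ[F] T) (g : Module.End S (S ⊗[F] M)) (m : M) :
    extendEnd f g (1 ⊗ₜ m) = f.toLinearMap.rTensor M (g (1 ⊗ₜ m)) := by
  simp [extendEnd]

theorem rTensor_smul (f : S →ₐ[F] T) (s : S) (x : S ⊗[F] M) :
    f.toLinearMap.rTensor M (s • x) = f s • f.toLinearMap.rTensor M x := by
  induction x with
  | zero => simp
  | tmul t m => simp [TensorProduct.smul_tmul']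
  | add x y hx hy => simp only [smul_add, map_add, hx, hy]

theorem extendEnd_rTensor (f : S →ₐ[F] T) (g : Module.End S (S ⊗[F] M)) (x : S ⊗[F] M) :
    extendEnd f g (f.toLinearMap.rTensor M x) = f.toLinearMap.rTensor M (g x) := by
  induction x with
  | zero => simp
  | tmul s m =>
    have h1 : (s ⊗ₜ[F] m : S ⊗[F] M) = s • (1 ⊗ₜ m) := by simp [TensorProduct.smul_tmul']
    have h2 : f.toLinearMap.rTensor M (1 ⊗ₜ[F] m) = 1 ⊗ₜ m := by simp
    rw [h1, rTensor_smul, map_smul, map_smul, rTensor_smul, h2, extendEnd_one_tmul]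
  | add x y hx hy => simp only [map_add, hx, hy]

theorem end_ext {g h : T ⊗[F] M →ₗ[T] T ⊗[F] M} (H : ∀ m : M, g (1 ⊗ₜ m) = h (1 ⊗ₜ m)) :
    g = h := by
  ext m
  exact H m

/-- `extendEnd` as a monoid homomorphism. -/
def extendEndHom (f : S →ₐ[F] T) : Module.End S (S ⊗[F] M) →* Module.End T (T ⊗[F] M) where
  toFun := extendEnd f
  map_one' := end_ext fun m => by rw [extendEnd_one_tmul]; simp
  map_mul' g h := end_ext fun m => by
    rw [extendEnd_one_tmul, Module.End.mul_apply, Module.End.mul_apply, extendEnd_one_tmul,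
      extendEnd_rTensor]

theorem extendEnd_id (g : Module.End S (S ⊗[F] M)) : extendEnd (AlgHom.id F S) g = g :=
  end_ext fun m => by
    rw [extendEnd_one_tmul]
    have : (AlgHom.id F S).toLinearMap = LinearMap.id := rfl
    rw [this]
    simp

theorem extendEnd_comp (f : S →ₐ[F] T) (f' : T →ₐ[F] U) (g : Module.End S (S ⊗[F] M)) :
    extendEnd (f'.comp f) g = extendEnd f' (extendEnd f g) :=
  end_ext fun m => by
    rw [extendEnd_one_tmul, extendEnd_one_tmul, extendEnd_one_tmul]
    have : (f'.comp f).toLinearMap = f'.toLinearMap ∘ₗ f.toLinearMap := rfl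
    rw [this, LinearMap.rTensor_comp]
    rfl

end

variable (F M) in
/-- The group functor `GL(M)` over `F`: its `S`-points are the `S`-linear automorphisms of
`S ⊗[F] M`. -/
def glFunctor : GroupFunctor F where
  obj S := GrpCat.of (LinearMap.GeneralLinearGroup S (S ⊗[F] M))
  map f := GrpCat.ofHom (Units.map (extendEndHom f.hom))
  map_id S := by
    refine GrpCat.hom_ext (MonoidHom.ext fun g => Units.ext ?_)
    exact extendEnd_id _
  map_comp {S T U} f f' := by
    refine GrpCat.hom_ext (MonoidHom.ext fun g => Units.ext ?_)
    exact extendEnd_comp f.hom f'.hom _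

/-- Two quadratic forms on `T ⊗ M` which agree on `M` are equal. -/
theorem quadraticForm_ext {T : Type u} [CommRing T] [Algebra F T]
    {P Q : QuadraticForm T (T ⊗[F] M)} (H : ∀ m : M, P (1 ⊗ₜ m) = Q (1 ⊗ₜ m)) : P = Q := by
  have key : P.polarBilin = Q.polarBilin := by
    ext m n
    simp only [AlgebraTensorModule.curry_apply, TensorProduct.curry_apply,
      LinearMap.coe_restrictScalars, QuadraticMap.polarBilin_apply_apply,
      QuadraticMap.polar, ← TensorProduct.tmul_add, H]
  refine QuadraticMap.ext fun x => ?_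
  induction x with
  | zero => simp
  | tmul t m =>
    have h1 : (t ⊗ₜ[F] m : T ⊗[F] M) = t • (1 ⊗ₜ m) := by simp [TensorProduct.smul_tmul']
    rw [h1, QuadraticMap.map_smul, QuadraticMap.map_smul, H]
  | add x y hx hy =>
    have h1 := LinearMap.congr_fun₂ key x y
    simp only [QuadraticMap.polarBilin_apply_apply] at h1
    rw [QuadraticMap.map_add P, QuadraticMap.map_add Q, hx, hy, h1]

/-- A (non-symmetric) bilinear form `B` with `B(v, v) = Q(v)`. -/
def quadraticLift [Module.Free F M] (Q : QuadraticForm F M) : LinearMap.BilinMap F M F :=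
  (LinearMap.BilinMap.toQuadraticMap_surjective Q).choose

/-- The base change of a quadratic form on a free module to an `F`-algebra `S`. Mathlib's
`QuadraticForm.baseChange` requires `2` to be invertible; here no assumption on `2` is made.
It is the unique quadratic form on `S ⊗ M` which extends `Q`. -/
def quadraticBaseChange [Module.Free F M] (Q : QuadraticForm F M) (S : Type u) [CommRing S]
    [Algebra F S] : QuadraticForm S (S ⊗[F] M) :=
  (LinearMap.BilinForm.baseChange S (quadraticLift Q)).toQuadraticMap

theorem quadraticBaseChange_one_tmul [Module.Free F M] (Q : QuadraticForm F M) (S : Type u)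
    [CommRing S] [Algebra F S] (m : M) :
    quadraticBaseChange Q S (1 ⊗ₜ m) = algebraMap F S (Q m) := by
  have h : (quadraticLift Q).toQuadraticMap = Q :=
    (LinearMap.BilinMap.toQuadraticMap_surjective Q).choose_spec
  have h' : quadraticLift Q m m = Q m := by
    conv_rhs => rw [← h]
    rfl
  simp [quadraticBaseChange, LinearMap.BilinMap.toQuadraticMap_apply, h', Algebra.smul_def]

theorem quadraticBaseChange_rTensor [Module.Free F M] (Q : QuadraticForm F M) {S T : Type u}
    [CommRing S] [Algebra F S] [CommRing T] [Algebra F T] (f : S →ₐ[F] T) (x : S ⊗[F] M) :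
    quadraticBaseChange Q T (f.toLinearMap.rTensor M x) = f (quadraticBaseChange Q S x) := by
  suffices h : ∀ x y : S ⊗[F] M,
      LinearMap.BilinForm.baseChange T (quadraticLift Q) (f.toLinearMap.rTensor M x)
        (f.toLinearMap.rTensor M y) =
      f (LinearMap.BilinForm.baseChange S (quadraticLift Q) x y) from h x x
  intro x y
  induction x with
  | zero => simp
  | tmul s m =>
    induction y with
    | zero => simp
    | tmul t n => simp
    | add x y hx hy => simp only [map_add, hx, hy]
  | add x x' hx hx' => simp only [map_add, LinearMap.add_apply, hx, hx']

/-- The orthogonal group functor `O(M, Q)`: its `S`-points are the `S`-linear automorphisms of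
`S ⊗ M` which preserve the base change of `Q`. -/
def orthogonalFunctor [Module.Free F M] (Q : QuadraticForm F M) : GroupFunctor F :=
  (glFunctor F M).sub (fun S => orthogonalGroup (quadraticBaseChange Q S))
    (fun S T f g hg => by
      have h : (quadraticBaseChange Q T).comp (extendEnd f.hom g.val) =
          quadraticBaseChange Q T := by
        apply quadraticForm_ext
        intro m
        rw [QuadraticMap.comp_apply, extendEnd_one_tmul, quadraticBaseChange_rTensor,
          hg, quadraticBaseChange_one_tmul, quadraticBaseChange_one_tmul, AlgHom.commutes]
      intro x
      exact congrArg (fun P => P x) h)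

theorem extendEnd_commute (φ : Module.End F M) {S T : Type u} [CommRing S] [Algebra F S]
    [CommRing T] [Algebra F T] (f : S →ₐ[F] T) (g : Module.End S (S ⊗[F] M))
    (hg : g * φ.baseChange S = φ.baseChange S * g) :
    extendEnd f g * φ.baseChange T = φ.baseChange T * extendEnd f g := by
  have h3 : ∀ x : S ⊗[F] M, f.toLinearMap.rTensor M (φ.baseChange S x) =
      φ.baseChange T (f.toLinearMap.rTensor M x) := fun x => by
    induction x with
    | zero => simp
    | tmul s m => simp
    | add x y hx hy => simp only [map_add, hx, hy]
  apply end_ext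
  intro m
  have h4 := LinearMap.congr_fun hg (1 ⊗ₜ m)
  rw [Module.End.mul_apply, Module.End.mul_apply] at h4
  rw [Module.End.mul_apply, Module.End.mul_apply, LinearMap.baseChange_tmul,
    extendEnd_one_tmul, extendEnd_one_tmul, ← h3, ← h4, LinearMap.baseChange_tmul]

/-- The centraliser of `γ : M → M` in `O(M, Q)`: its `S`-points are the elements of
`O(M, Q)(S)` commuting with `γ`. -/
def centralizerFunctor [Module.Free F M] (Q : QuadraticForm F M) (γ : Module.End F M) :
    GroupFunctor F :=
  (orthogonalFunctor Q).sub
    (fun S => (commutingGroup (γ.baseChange S)).comap (Subgroup.subtype _))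
    (fun _ _ f g hg => extendEnd_commute γ f.hom g.1.val hg)

variable {A : Type u} [CommRing A] [Algebra F A] [Module A M] [IsScalarTower F A M]

/-- The unitary group functor of a form `B : M × M → A` on an `A`-module `M`, where `A` is an
`F`-algebra: its `S`-points are the `S ⊗ A`-linear (that is, `S`-linear and commuting with `A`)
automorphisms of `S ⊗ M` that preserve the base change of `B`. -/
def unitaryFunctor (B : LinearMap.BilinMap F M A) : GroupFunctor F :=
  (glFunctor F M).sub
    (fun S => (⨅ a : A, commutingGroup ((Algebra.lsmul F F M a).baseChange S)) ⊓
      isometryGroup (B.baseChange S))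
    (fun S T f g hg => by
      have h4 : ∀ x y : S ⊗[F] M,
          B.baseChange T (f.hom.toLinearMap.rTensor M x) (f.hom.toLinearMap.rTensor M y) =
          f.hom.toLinearMap.rTensor A (B.baseChange S x y) := fun x y => by
        induction x with
        | zero => simp
        | tmul s m =>
          induction y with
          | zero => simp
          | tmul t n => simp
          | add x y hx hy => simp only [map_add, hx, hy]
        | add x x' hx hx' => simp only [map_add, LinearMap.add_apply, hx, hx']
      obtain ⟨hg1, hg2⟩ := Subgroup.mem_inf.1 hg
      refine Subgroup.mem_inf.2 ⟨Subgroup.mem_iInf.2 fun a => ?_, fun x y => ?_⟩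
      · exact extendEnd_commute _ f.hom g.val (Subgroup.mem_iInf.1 hg1 a)
      · have h : (B.baseChange T).compl₁₂ (extendEnd f.hom g.val) (extendEnd f.hom g.val) =
            B.baseChange T := by
          ext m n
          have h5 := hg2 (1 ⊗ₜ m) (1 ⊗ₜ n)
          have h6 := h4 (1 ⊗ₜ m) (1 ⊗ₜ n)
          simp only [LinearMap.rTensor_tmul, AlgHom.toLinearMap_apply, map_one] at h6
          change B.baseChange T (extendEnd f.hom g.val (1 ⊗ₜ m))
            (extendEnd f.hom g.val (1 ⊗ₜ n)) = B.baseChange T (1 ⊗ₜ m) (1 ⊗ₜ n)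
          rw [extendEnd_one_tmul, extendEnd_one_tmul, h4, h5, h6]
        exact LinearMap.congr_fun₂ h x y)

/-- A `τ`-hermitian form `h : M → F` on an `A`-module `M`, together with its sesquilinear form
`B : M × M → A`. If `τ` is trivial this is a quadratic form with its polar bilinear form; if
`τ` is non-trivial, `B` is `τ`-sesquilinear and hermitian, and `h(v) = B(v, v)`. -/
structure HermitianForm (F : Type u) [CommRing F] (A : Type u) [CommRing A] [Algebra F A]
    (τ : A → A) (M : Type u) [AddCommGroup M] [Module F M] [Module A M] where
  /-- The form `h`, which is in all cases a quadratic form over `F`. -/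
  form : QuadraticForm F M
  /-- The associated sesquilinear form `B`. -/
  sesq : LinearMap.BilinMap F M A
  smul_left : ∀ (a : A) (v w : M), sesq (a • v) w = a * sesq v w
  smul_right : ∀ (a : A) (v w : M), sesq v (a • w) = τ a * sesq v w
  symm : ∀ v w : M, τ (sesq v w) = sesq w v
  quadratic : τ = id → ∀ v w : M, sesq v w = algebraMap F A (QuadraticMap.polar form v w)
  hermitian : τ ≠ id → ∀ v : M, algebraMap F A (form v) = sesq v v

end LinearGroups

/-! ### Orthogonal groups and absolutely semisimple elements -/

section Orthogonal

variable {K V : Type u} [Field K] [AddCommGroup V] [Module K V]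

/-- The endomorphism of `V` underlying an element of `O(V, q)`. -/
def toEnd {q : QuadraticForm K V} (γ : orthogonalGroup q) : Module.End K V := γ.1.val

open scoped IsMulCommutative in
/-- The commutative `K`-algebra `K[γ]` is étale. -/
def AbsolutelySemisimple (γ : Module.End K V) : Prop :=
  Algebra.Etale K (Algebra.adjoin K {γ})

/-! ### The decomposition attached to an element -/

/-- The set `I` of indices attached to `γ`: the factors `A = K[X] / (P)` of
`K[γ] = K[X] / (minpoly γ)` for which `X ↦ X⁻¹` is a well-defined `K`-automorphism `τ` of `A`
with the property that `{x ∈ A | τ x = x}` is a field. -/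
def FactorIndex (γ : Module.End K V) : Type u :=
  {P : K[X] // P.Monic ∧ P ∣ minpoly K γ ∧
    ∃ τ : AdjoinRoot P ≃ₐ[K] AdjoinRoot P, τ (AdjoinRoot.root P) * AdjoinRoot.root P = 1 ∧
      IsField (AlgHom.equalizer (τ : AdjoinRoot P →ₐ[K] AdjoinRoot P) (AlgHom.id K _))}

namespace FactorIndex

variable {γ : Module.End K V}

/-- The minimal polynomial `P_i` of `γ_i`. -/
def poly (i : FactorIndex γ) : K[X] := i.1

/-- The algebra `A_i`. -/
abbrev A (i : FactorIndex γ) : Type u := AdjoinRoot i.poly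

/-- The generator `γ_i` of `A_i`. -/
def gen (i : FactorIndex γ) : i.A := AdjoinRoot.root i.poly

/-- The involution `τ_i` of `A_i`, determined by `γ_i ↦ γ_i⁻¹`. -/
def tau (i : FactorIndex γ) : i.A ≃ₐ[K] i.A := i.2.2.2.choose

theorem tau_gen (i : FactorIndex γ) : i.tau i.gen * i.gen = 1 := i.2.2.2.choose_spec.1

/-- The subalgebra `F_i` of `A_i` fixed by `τ_i`. -/
def F (i : FactorIndex γ) : Subalgebra K i.A :=
  AlgHom.equalizer (i.tau : i.A →ₐ[K] i.A) (AlgHom.id K i.A)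

theorem isField_F (i : FactorIndex γ) : IsField i.F := i.2.2.2.choose_spec.2

/-- The subspace `V_i = ker P_i(γ)` of `V`. -/
def space (i : FactorIndex γ) : Submodule K V := LinearMap.ker (aeval γ i.poly)

theorem mapsTo_space (i : FactorIndex γ) (v : V) (hv : v ∈ i.space) : γ v ∈ i.space := by
  have hv' : aeval γ i.poly v = 0 := hv
  change aeval γ i.poly (γ v) = 0
  have h : aeval γ i.poly * γ = γ * aeval γ i.poly := by
    have h1 : aeval γ (i.poly * X) = aeval γ (X * i.poly) := by rw [mul_comm]
    simpa using h1
  rw [← Module.End.mul_apply, h, Module.End.mul_apply, hv', map_zero]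

/-- The restriction of `γ` to `V_i`. -/
def restr (i : FactorIndex γ) : Module.End K i.space := γ.restrict i.mapsTo_space

theorem coe_aeval_restr (i : FactorIndex γ) (P : K[X]) (v : i.space) :
    ((aeval i.restr P v : i.space) : V) = aeval γ P v := by
  induction P using Polynomial.induction_on' generalizing v with
  | add P Q hP hQ => simp [hP, hQ]
  | monomial n a =>
    have h : ∀ n : ℕ, (((i.restr ^ n) v : i.space) : V) = (γ ^ n) v := by
      intro n
      induction n with
      | zero => rfl
      | succ n ih =>
        rw [pow_succ', pow_succ', Module.End.mul_apply, Module.End.mul_apply, ← ih]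
        rfl
    simp [aeval_monomial, h, Module.algebraMap_end_apply]

/-- The action of `A_i` on `V_i`, for which `γ_i` acts as `γ`. -/
def action (i : FactorIndex γ) : i.A →ₐ[K] Module.End K i.space :=
  Ideal.Quotient.liftₐ (Ideal.span {i.poly}) (aeval i.restr) fun P hP => by
    have h : aeval i.restr i.poly = 0 := by
      apply LinearMap.ext
      intro v
      apply Subtype.ext
      exact (i.coe_aeval_restr i.poly v).trans v.2
    obtain ⟨Q, rfl⟩ := Ideal.mem_span_singleton'.1 hP
    rw [map_mul, h, mul_zero]

theorem action_gen (i : FactorIndex γ) : i.action i.gen = i.restr :=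
  aeval_X i.restr

instance (i : FactorIndex γ) : Module i.A i.space := Module.compHom _ i.action.toRingHom

theorem smul_eq (i : FactorIndex γ) (a : i.A) (v : i.space) : a • v = i.action a v := rfl

theorem gen_smul (i : FactorIndex γ) (v : i.space) : ((i.gen • v : i.space) : V) = γ v := by
  rw [smul_eq, action_gen]
  rfl

instance (i : FactorIndex γ) : IsScalarTower K i.A i.space where
  smul_assoc k a v := by simp [smul_eq]

instance (i : FactorIndex γ) : IsScalarTower i.F i.A i.space where
  smul_assoc f a v := by
    change ((f : i.A) * a) • v = (f : i.A) • (a • v)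
    rw [mul_smul]

instance (i : FactorIndex γ) : IsScalarTower K i.F i.space where
  smul_assoc k f v := by
    change (k • (f : i.A)) • v = k • ((f : i.A) • v)
    rw [smul_assoc]

instance (i : FactorIndex γ) : Module.Free i.F i.space :=
  letI := i.isField_F.toField
  Module.Free.of_divisionRing i.F i.space

/-- `i ∈ I_triv`: `γ_i² = 1` and `A_i = K`. -/
def IsTriv (i : FactorIndex γ) : Prop :=
  i.gen ^ 2 = 1 ∧ Function.Bijective (algebraMap K i.A)

/-- `i ∈ I_field`: `γ_i² ≠ 1` and `A_i` is a field, of degree two over `F_i`. -/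
def IsFieldType (i : FactorIndex γ) : Prop :=
  i.gen ^ 2 ≠ 1 ∧ IsField i.A ∧ Module.finrank i.F i.A = 2

/-- The isomorphisms `A_i ≃ F_i × F_i` for which `τ_i` swaps the two factors. -/
def Splitting (i : FactorIndex γ) : Type u :=
  {φ : i.A ≃ₐ[i.F] i.F × i.F // ∀ a, φ (i.tau a) = (φ a).swap}

/-- `i ∈ I_split`: `γ_i² ≠ 1`, and `A_i ≃ F_i × F_i` with `τ_i` swapping the two factors. -/
def IsSplit (i : FactorIndex γ) : Prop := i.gen ^ 2 ≠ 1 ∧ Nonempty i.Splitting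

/-- The first component `W_i` of the `F_i × F_i`-module `V_i`, for a split index `i`. -/
def W (i : FactorIndex γ) (φ : i.Splitting) : Submodule i.F i.space :=
  LinearMap.ker (Algebra.lsmul i.F i.F i.space (φ.1.symm (0, 1)))

/-- The `τ_i`-hermitian forms `V_i → F_i`. -/
abbrev Herm (i : FactorIndex γ) := HermitianForm i.F i.A i.tau i.space

/-- `h` satisfies `q(v) = Tr_{F_i/K}(h(v))` for all `v ∈ V_i`. -/
def IsTraceForm (q : QuadraticForm K V) (i : FactorIndex γ) (h : i.Herm) : Prop :=
  ∀ v : i.space, q v = Algebra.trace K i.F (h.form v)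

/-- The inclusion of `V_i` in `V`, extended to a `K`-algebra `R`:
`(F_i ⊗[K] R) ⊗[F_i] V_i → R ⊗[K] V`, `(f ⊗ r) ⊗ v ↦ r ⊗ f v`. -/
def incl (i : FactorIndex γ) (R : Type u) [CommRing R] [Algebra K R]
    (x : (i.F ⊗[K] R) ⊗[i.F] i.space) : R ⊗[K] V :=
  i.space.subtype.lTensor R (TensorProduct.comm K i.space R
    (AlgebraTensorModule.cancelBaseChange K i.F i.F i.space R
      (TensorProduct.comm i.F (i.F ⊗[K] R) i.space x)))

theorem incl_tmul (i : FactorIndex γ) (R : Type u) [CommRing R] [Algebra K R] (f : i.F) (r : R)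
    (v : i.space) : i.incl R ((f ⊗ₜ r) ⊗ₜ v) = r ⊗ₜ ((f • v : i.space) : V) := by
  simp [incl]

end FactorIndex

open FactorIndex GroupFunctor

/-- The product of the groups `O(V_i, h_i)` over `I_triv` (where `F_i = K`), of
`Res_{F_i/K} U(V_i, h_i)` over `I_field` and of `Res_{F_i/K} GL(W_i)` over `I_split`. -/
def productFunctor {γ : Module.End K V} (h : ∀ i : FactorIndex γ, i.Herm)
    (φ : ∀ i : {i : FactorIndex γ // i.IsSplit}, i.1.Splitting) : GroupFunctor K :=
  GroupFunctor.prod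
    (GroupFunctor.pi fun i : {i : FactorIndex γ // i.IsTriv} =>
      weilRes K (orthogonalFunctor (h i.1).form))
    (GroupFunctor.prod
      (GroupFunctor.pi fun i : {i : FactorIndex γ // i.IsFieldType} =>
        weilRes K (unitaryFunctor (h i.1).sesq))
      (GroupFunctor.pi fun i : {i : FactorIndex γ // i.IsSplit} =>
        weilRes K (glFunctor i.1.F (i.1.W (φ i)))))

/-- `p` is the family of restrictions of `g` to the `V_i` (for `i` trivial or of field type) and
to the `W_i` (for `i` split). -/
def IsRestriction {q : QuadraticForm K V} {γ : Module.End K V}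
    (h : ∀ i : FactorIndex γ, i.Herm)
    (φ : ∀ i : {i : FactorIndex γ // i.IsSplit}, i.1.Splitting) (R : CommAlgCat.{u} K)
    (g : (centralizerFunctor q γ).obj R) (p : (productFunctor h φ).obj R) : Prop :=
  (∀ (i : {i : FactorIndex γ // i.IsTriv}) (x : (i.1.F ⊗[K] R) ⊗[i.1.F] i.1.space),
    i.1.incl R ((p.1 i).1.val x) = g.1.1.val (i.1.incl R x)) ∧
  (∀ (i : {i : FactorIndex γ // i.IsFieldType}) (x : (i.1.F ⊗[K] R) ⊗[i.1.F] i.1.space),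
    i.1.incl R ((p.2.1 i).1.val x) = g.1.1.val (i.1.incl R x)) ∧
  (∀ (i : {i : FactorIndex γ // i.IsSplit}) (x : (i.1.F ⊗[K] R) ⊗[i.1.F] i.1.W (φ i)),
    i.1.incl R ((i.1.W (φ i)).subtype.lTensor (i.1.F ⊗[K] R) ((p.2.2 i).val x)) =
      g.1.1.val (i.1.incl R ((i.1.W (φ i)).subtype.lTensor (i.1.F ⊗[K] R) x)))

end Orthogonal

end

/-! Everything rests on one fact: the adjoint of `γ` for the polar form is `γ⁻¹`. Call `G`
self-reciprocal if `G ∣ G.reverse`. The indices in `I` turn out to be the minimal self-reciprocal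
factors of the minimal polynomial `μ`.

Decomposition. If `μ` is evaluated at `γ⁻¹`, the result is adjoint to `μ(γ) = 0`, so its image lies
in the radical of the polar form. Regularity makes `γ` the identity there, so `μ(γ⁻¹)` squares to
zero. Since `K[γ]` is étale, hence reduced, `μ(γ⁻¹) = 0` and `μ` is self-reciprocal
(`minpoly_dvd_reverse`). Norms `x τ(x)` lie in the field `F_i`, so a self-reciprocal polynomial
evaluated at `γ_i` is zero or a unit. Hence distinct `P_i` are coprime, and squarefreeness of `μ`
makes their product equal to `μ` (`prod_poly_eq_minpoly`). The Chinese remainder theorem splits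
`K[γ]`. The projectors onto the `V_i` are fixed by the adjunction, which gives orthogonality
(`polar_component`).

Hermitian forms. If `γ_i² ≠ 1`, the element `δ = γ_i - γ_i⁻¹` is a unit with `τ(δ) = -δ`. Therefore
`tr(a) = Tr_{F_i/K}(a + τ a)` induces a perfect pairing on `A_i`, and `B_i(v, w)` is the unique
element with `tr(c B_i(v, w)) = B_q(c v, w)`. The element `α = γ_i / δ` satisfies `α + τ(α) = 1` and
plays the role of `1/2` in every characteristic. That `q` itself, and not only its polar form, is
the trace of `h_i` follows from invertibility of `γ_i - 1` (`existsUnique_herm_of_gen_sq_ne`).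

Conjugacy. A conjugating isometry restricts to the `V_i`. Conversely, isometries of the summands add
up to one of `V`. Trace duality translates between preserving `q` and preserving `h_i`.

Centraliser. On `R`-points the centraliser is the product over `i` of the groups of `A_i`-linear
isometries of `R ⊗ V_i` (`exists_restriction`, `exists_glue`). For trivial and field types, `(F_i ⊗
R) ⊗ V_i ≃ R ⊗ V_i` and trace duality identify the factor with `O` or `U`
(`descend_mem_iff_orthogonal`, `descend_mem_iff_unitary`). For split types, `V_i` is the sum of two
isotropic submodules in duality, so an isometry is an automorphism of `W_i` together with its
contragredient (`IsotropicSplitting.exists_extension`). -/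

section Reverse

/-! ### Self-reciprocal polynomials -/

variable {K A : Type*} [Field K] [CommRing A] [Algebra K A]

/-- The identity behind this section is `G.reverse(x) * y ^ deg G = G(y)` for `x * y = 1`. For `G ≠
0` the condition `G ∣ G.reverse` forces `G(0) ≠ 0` by degrees, and then `G` and its reverse differ
by a unit. -/
theorem aeval_eq_zero_of_dvd_reverse {G : K[X]} (hG : G ∣ G.reverse) {x y : A} (hxy : x * y = 1)
    (hx : aeval x G = 0) : aeval y G = 0 := by
  let : Invertible y := ⟨x, hxy, by rw [mul_comm, hxy]⟩
  have h1 := eval₂_reverse_mul_pow (algebraMap K A) y G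
  obtain ⟨H, hH⟩ := hG
  have h2 : eval₂ (algebraMap K A) (⅟y) G.reverse = 0 := by
    rw [hH, ← aeval_def, map_mul]
    change aeval x G * _ = 0
    rw [hx, zero_mul]
  rw [h2, zero_mul] at h1
  exact h1.symm

theorem exists_aeval_eq_mul_of_dvd_reverse {G : K[X]} (hG : G ∣ G.reverse) {x y : A}
    (hxy : x * y = 1) : ∃ u, aeval y G = aeval x G * u := by
  let : Invertible y := ⟨x, hxy, by rw [mul_comm, hxy]⟩
  have h1 := eval₂_reverse_mul_pow (algebraMap K A) y G
  obtain ⟨H, hH⟩ := hG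
  refine ⟨aeval x H * y ^ G.natDegree, ?_⟩
  rw [aeval_def y, ← h1, hH, ← aeval_def, map_mul, mul_assoc]
  rfl

theorem aeval_reverse_mul_pow {x y : A} (hxy : x * y = 1) (G : K[X]) :
    aeval x G.reverse * y ^ G.natDegree = aeval y G := by
  let : Invertible y := ⟨x, hxy, by rw [mul_comm, hxy]⟩
  exact eval₂_reverse_mul_pow (algebraMap K A) y G

theorem dvd_reverse_of_aeval {G : K[X]} {x : AdjoinRoot G} (hx : x * AdjoinRoot.root G = 1)
    (h : aeval x G = 0) : G ∣ G.reverse := by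
  have hx' : AdjoinRoot.root G * x = 1 := by rw [mul_comm, hx]
  have h1 := aeval_reverse_mul_pow hx' G
  have h2 : aeval (AdjoinRoot.root G) G.reverse = 0 := by
    have h3 : (x ^ G.natDegree) * AdjoinRoot.root G ^ G.natDegree = 1 := by
      rw [← mul_pow, hx, one_pow]
    calc aeval (AdjoinRoot.root G) G.reverse
        = aeval (AdjoinRoot.root G) G.reverse * x ^ G.natDegree *
          AdjoinRoot.root G ^ G.natDegree := by
          rw [mul_assoc, h3, mul_one]
      _ = 0 := by rw [h1, h, zero_mul]
  rwa [AdjoinRoot.aeval_eq, AdjoinRoot.mk_eq_zero] at h2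

/-- Modulo `G` one has `X * divX G = -G(0)`, a nonzero constant. -/
theorem exists_mul_root_eq_one {G : K[X]} (hG : G.coeff 0 ≠ 0) :
    ∃ x : AdjoinRoot G, x * AdjoinRoot.root G = 1 := by
  refine ⟨AdjoinRoot.mk G (-(C (G.coeff 0)⁻¹ * divX G)), ?_⟩
  rw [← AdjoinRoot.mk_X, ← map_mul, ← map_one (AdjoinRoot.mk G), AdjoinRoot.mk_eq_mk]
  refine ⟨-C (G.coeff 0)⁻¹, ?_⟩
  have h1 := divX_mul_X_add G
  have h2 : C (G.coeff 0)⁻¹ * C (G.coeff 0) = (1 : K[X]) := by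
    rw [← C_mul, inv_mul_cancel₀ hG, C_1]
  linear_combination (-C (G.coeff 0)⁻¹) * h1 + h2

/-- By degrees `D` is associated to its reverse. Reversal is multiplicative over a domain, so `D`
can be cancelled. -/
theorem dvd_reverse_of_mul {D E : K[X]} (h0 : (D * E).coeff 0 ≠ 0) (hD : D ∣ D.reverse)
    (hDE : D * E ∣ (D * E).reverse) : E ∣ E.reverse := by
  rw [mul_coeff_zero] at h0
  have hD0 : D.coeff 0 ≠ 0 := left_ne_zero_of_mul h0
  have hD1 : D ≠ 0 := by rintro rfl; simp at hD0
  have h1 : Associated D D.reverse := by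
    refine associated_of_dvd_of_natDegree_le hD ?_ ?_
    · simpa using hD1
    · rw [reverse_natDegree]; omega
  rw [reverse_mul_of_domain] at hDE
  have h2 : D * E ∣ D * E.reverse := hDE.trans ((h1.symm.mul_right _).dvd)
  exact (mul_dvd_mul_iff_left hD1).1 h2

end Reverse

/-! ### The algebras `A_i` and their involutions -/

namespace FactorIndex

variable {K V : Type u} [Field K] [AddCommGroup V] [Module K V] {γ : Module.End K V}

theorem monic_poly (i : FactorIndex γ) : i.poly.Monic := i.2.1

theorem poly_dvd (i : FactorIndex γ) : i.poly ∣ minpoly K γ := i.2.2.1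

theorem poly_injective : Function.Injective (poly : FactorIndex γ → K[X]) := Subtype.val_injective

theorem gen_mul_tau_gen (i : FactorIndex γ) : i.gen * i.tau i.gen = 1 := by
  rw [mul_comm, i.tau_gen]

theorem algHom_ext {B : Type*} [Semiring B] [Algebra K B] (i : FactorIndex γ) {f g : i.A →ₐ[K] B}
    (h : f i.gen = g i.gen) : f = g := AdjoinRoot.algHom_ext h

@[simp]
theorem tau_tau (i : FactorIndex γ) (a : i.A) : i.tau (i.tau a) = a := by
  have h : (i.tau : i.A →ₐ[K] i.A).comp (i.tau : i.A →ₐ[K] i.A) = AlgHom.id K i.A := by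
    refine i.algHom_ext ?_
    change i.tau (i.tau i.gen) = i.gen
    have h1 : i.tau (i.tau i.gen) * i.tau i.gen = 1 := by
      rw [← map_mul, i.tau_gen, map_one]
    calc i.tau (i.tau i.gen) = i.tau (i.tau i.gen) * (i.tau i.gen * i.gen) := by
          rw [i.tau_gen, mul_one]
      _ = i.gen := by rw [← mul_assoc, h1, one_mul]
  exact DFunLike.congr_fun h a

theorem mem_F {i : FactorIndex γ} {a : i.A} : a ∈ i.F ↔ i.tau a = a := Iff.rfl

theorem tau_coe {i : FactorIndex γ} (f : i.F) : i.tau (f : i.A) = f := f.2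

theorem exists_aeval (i : FactorIndex γ) (a : i.A) : ∃ p : K[X], aeval i.gen p = a := by
  obtain ⟨p, rfl⟩ := AdjoinRoot.mk_surjective a
  exact ⟨p, AdjoinRoot.aeval_eq p⟩

theorem aeval_gen_eq_zero_iff (i : FactorIndex γ) (p : K[X]) :
    aeval i.gen p = 0 ↔ i.poly ∣ p := by
  rw [gen, AdjoinRoot.aeval_eq, AdjoinRoot.mk_eq_zero]

theorem aeval_gen_poly (i : FactorIndex γ) : aeval i.gen i.poly = 0 :=
  (i.aeval_gen_eq_zero_iff _).2 dvd_rfl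

instance nontrivial_A (i : FactorIndex γ) : Nontrivial i.A := by
  obtain ⟨x, y, hxy⟩ := i.isField_F.exists_pair_ne
  exact ⟨⟨x, y, fun h => hxy (Subtype.ext h)⟩⟩

/-- `A_i` itself need not be a field. The dichotomies below come from applying this to `x τ(x)`, `x
+ τ(x)` and `δ²`, all of which are fixed by `τ`. -/
theorem isUnit_or_eq_zero_of_mem_F {i : FactorIndex γ} {a : i.A} (ha : a ∈ i.F) :
    IsUnit a ∨ a = 0 := by
  by_cases h : a = 0
  · exact Or.inr h
  · obtain ⟨b, hb⟩ := i.isField_F.mul_inv_cancel (a := ⟨a, ha⟩)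
      fun h' => h (congrArg Subtype.val h')
    exact Or.inl (IsUnit.of_mul_eq_one (b : i.A) (congrArg Subtype.val hb))

theorem poly_dvd_reverse (i : FactorIndex γ) : i.poly ∣ i.poly.reverse := by
  refine dvd_reverse_of_aeval (x := i.tau i.gen) i.tau_gen ?_
  have h : aeval (i.tau i.gen) i.poly = i.tau (aeval i.gen i.poly) :=
    aeval_algHom_apply (i.tau : i.A →ₐ[K] i.A) i.gen i.poly
  rw [h, i.aeval_gen_poly, map_zero]

end FactorIndex

/-! ### Factorisation of the minimal polynomial and of `K[γ]` -/

section Semisimple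

variable {K V : Type u} [Field K] [AddCommGroup V] [Module K V] {γ : Module.End K V}

/-- Evaluation of polynomials at `γ`, as a map onto `K[γ]`. -/
noncomputable def aevalAdjoin (γ : Module.End K V) : K[X] →ₐ[K] Algebra.adjoin K {γ} :=
  aeval ⟨γ, Algebra.self_mem_adjoin_singleton K γ⟩

theorem coe_aevalAdjoin (p : K[X]) : (aevalAdjoin γ p : Module.End K V) = aeval γ p :=
  (aeval_algHom_apply (Algebra.adjoin K {γ}).val
    (⟨γ, Algebra.self_mem_adjoin_singleton K γ⟩ : Algebra.adjoin K {γ}) p).symm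

theorem aevalAdjoin_surjective : Function.Surjective (aevalAdjoin γ) := by
  rintro ⟨x, hx⟩
  have hx' := hx
  rw [Algebra.adjoin_singleton_eq_range_aeval] at hx'
  obtain ⟨p, rfl⟩ := hx'
  exact ⟨p, Subtype.ext (coe_aevalAdjoin p)⟩

theorem aevalAdjoin_eq_zero_iff (p : K[X]) : aevalAdjoin γ p = 0 ↔ minpoly K γ ∣ p := by
  rw [minpoly.dvd_iff, ← coe_aevalAdjoin]
  exact ⟨fun h => congrArg Subtype.val h, fun h => Subtype.ext h⟩

open scoped IsMulCommutative in
theorem AbsolutelySemisimple.isRadical_minpoly (hγ : AbsolutelySemisimple γ) :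
    IsRadical (minpoly K γ) := by
  have : Algebra.Etale K (Algebra.adjoin K {γ}) := hγ
  have : IsReduced (Algebra.adjoin K {γ}) :=
    Algebra.FormallyUnramified.isReduced_of_field K _
  intro n p hp
  rw [← aevalAdjoin_eq_zero_iff, map_pow] at hp
  rw [← aevalAdjoin_eq_zero_iff]
  exact IsReduced.eq_zero _ ⟨n, hp⟩

open scoped IsMulCommutative in
theorem FactorIndex.formallyUnramified (hγ : AbsolutelySemisimple γ) (i : FactorIndex γ) :
    Algebra.FormallyUnramified K i.A := by
  have : Algebra.Etale K (Algebra.adjoin K {γ}) := hγ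
  have H : ∀ p : K[X], aevalAdjoin γ p = 0 → aeval i.gen p = 0 := fun p hp =>
    (i.aeval_gen_eq_zero_iff p).2 (i.poly_dvd.trans ((aevalAdjoin_eq_zero_iff p).1 hp))
  refine Algebra.FormallyUnramified.of_surjective
    (AlgHom.liftOfSurjective (aevalAdjoin γ) aevalAdjoin_surjective (aeval i.gen)
      fun p hp => H p hp) ?_
  intro a
  obtain ⟨p, rfl⟩ := i.exists_aeval a
  exact ⟨aevalAdjoin γ p, AlgHom.liftOfSurjective_apply ..⟩

theorem FactorIndex.isReduced_A (hγ : AbsolutelySemisimple γ) (i : FactorIndex γ) :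
    IsReduced i.A := by
  have := i.formallyUnramified hγ
  have : Algebra.FiniteType K i.A := inferInstanceAs (Algebra.FiniteType K (AdjoinRoot i.poly))
  exact Algebra.FormallyUnramified.isReduced_of_field K _

namespace FactorIndex

/-- Put `x = G(γ_i)`. Self-reciprocity gives `τ(x) = x w`. The norm `x τ(x)` lies in the field
`F_i`: if it is a unit, so is `x`; if it vanishes, then `τ(x)² = w x τ(x) = 0` and reducedness gives
`x = 0`. -/
theorem aeval_gen_eq_zero_or_isUnit (hγ : AbsolutelySemisimple γ) (i : FactorIndex γ) {G : K[X]}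
    (hG : G ∣ G.reverse) : aeval i.gen G = 0 ∨ IsUnit (aeval i.gen G) := by
  have := i.isReduced_A hγ
  set x := aeval i.gen G with hx
  obtain ⟨w, hw⟩ := exists_aeval_eq_mul_of_dvd_reverse hG i.gen_mul_tau_gen
  have h1 : i.tau x = x * w := by
    rw [← hw]
    exact (aeval_algHom_apply (i.tau : i.A →ₐ[K] i.A) i.gen G).symm
  have h2 : x * i.tau x ∈ i.F := by rw [mem_F, map_mul, tau_tau, mul_comm]
  rcases isUnit_or_eq_zero_of_mem_F h2 with h | h
  · exact Or.inr (isUnit_of_mul_isUnit_left h)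
  · left
    have h3 : i.tau x = 0 := by
      refine IsReduced.eq_zero _ ⟨2, ?_⟩
      calc i.tau x ^ 2 = w * (x * i.tau x) := by rw [pow_two]; nth_rw 1 [h1]; ring
        _ = 0 := by rw [h, mul_zero]
    simpa using congrArg i.tau h3

theorem isCoprime_of_isUnit {i : FactorIndex γ} {G : K[X]} (h : IsUnit (aeval i.gen G)) :
    IsCoprime i.poly G := by
  obtain ⟨b, hb⟩ := h.exists_left_inv
  obtain ⟨p, rfl⟩ := i.exists_aeval b
  rw [← map_mul, ← sub_eq_zero, ← map_one (aeval (R := K) i.gen), ← map_sub,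
    aeval_gen_eq_zero_iff] at hb
  obtain ⟨r, hr⟩ := hb
  exact ⟨-r, p, by linear_combination hr⟩

theorem not_isUnit_poly (i : FactorIndex γ) : ¬ IsUnit i.poly := by
  intro h
  have : aeval i.gen (1 : K[X]) = 0 := (i.aeval_gen_eq_zero_iff _).2 h.dvd
  simp at this

/-- The dichotomy is applied in both directions. Two zeros mean that `P_i` and `P_j` divide each
other; a unit is a Bézout relation. -/
theorem isCoprime_poly (hγ : AbsolutelySemisimple γ) {i j : FactorIndex γ} (hij : i ≠ j) :
    IsCoprime i.poly j.poly := by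
  rcases i.aeval_gen_eq_zero_or_isUnit hγ j.poly_dvd_reverse with h | h
  · rcases j.aeval_gen_eq_zero_or_isUnit hγ i.poly_dvd_reverse with h' | h'
    · refine absurd ?_ hij
      refine poly_injective (eq_of_monic_of_associated i.monic_poly j.monic_poly
        (associated_of_dvd_dvd ?_ ?_))
      · exact (i.aeval_gen_eq_zero_iff _).1 h
      · exact (j.aeval_gen_eq_zero_iff _).1 h'
    · exact (isCoprime_of_isUnit h').symm
  · exact isCoprime_of_isUnit h

/-- A monic self-reciprocal divisor `D ≠ 1` of the minimal polynomial, all of whose proper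
self-reciprocal divisors are trivial, is an index. -/
theorem exists_poly_dvd (D : K[X]) (hD : D.Monic) (hD1 : D ≠ 1) (hdvd : D ∣ minpoly K γ)
    (h0 : D.coeff 0 ≠ 0) (hrev : D ∣ D.reverse) : ∃ i : FactorIndex γ, i.poly ∣ D := by
  induction hn : D.natDegree using Nat.strong_induction_on generalizing D with
  | _ n ih =>
  by_cases hmin : ∃ G : K[X], G.Monic ∧ G ≠ 1 ∧ G ≠ D ∧ G ∣ D ∧ G ∣ G.reverse
  · obtain ⟨G, hG, hG1, hGD, hdiv, hGrev⟩ := hmin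
    have hlt : G.natDegree < n := by
      by_contra hle
      exact hGD (eq_of_monic_of_associated hG hD (associated_of_dvd_of_natDegree_le hdiv hD.ne_zero
        (by omega)))
    obtain ⟨i, hi⟩ := ih _ hlt G hG hG1 (hdiv.trans hdvd) (fun h => h0 (by
      obtain ⟨E, rfl⟩ := hdiv
      rw [mul_coeff_zero, h, zero_mul])) hGrev rfl
    exact ⟨i, hi.trans hdiv⟩
  -- Here `D` is minimal. Self-reciprocity makes `X ↦ X⁻¹` a well-defined involution `t` of
  -- `K[X]/(D)`. It remains to show that its fixed ring is a field.
  · obtain ⟨x, hx⟩ := exists_mul_root_eq_one h0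
    have hx' : AdjoinRoot.root D * x = 1 := by rw [mul_comm, hx]
    have hxD : aeval x D = 0 := aeval_eq_zero_of_dvd_reverse hrev hx'
      (by rw [AdjoinRoot.aeval_eq, AdjoinRoot.mk_self])
    let t : AdjoinRoot D →ₐ[K] AdjoinRoot D := AdjoinRoot.liftAlgHom D (Algebra.ofId K _) x hxD
    have ht : t (AdjoinRoot.root D) = x := AdjoinRoot.liftAlgHom_root ..
    have htx : t x = AdjoinRoot.root D := by
      have h1 : t x * x = 1 := by rw [← ht, ← map_mul, ht, hx, map_one]
      calc t x = t x * (x * AdjoinRoot.root D) := by rw [hx, mul_one]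
        _ = AdjoinRoot.root D := by rw [← mul_assoc, h1, one_mul]
    have htt : t.comp t = AlgHom.id K _ := AdjoinRoot.algHom_ext (by
      change t (t (AdjoinRoot.root D)) = AdjoinRoot.root D
      rw [ht, htx])
    let τ : AdjoinRoot D ≃ₐ[K] AdjoinRoot D := AlgEquiv.ofAlgHom t t htt htt
    have hτ : (τ : AdjoinRoot D →ₐ[K] AdjoinRoot D) = t := rfl
    have : Nontrivial (AdjoinRoot D) := by
      refine ⟨⟨0, 1, fun h => hD1 ?_⟩⟩
      rw [eq_comm, ← map_one (AdjoinRoot.mk D), AdjoinRoot.mk_eq_zero] at h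
      exact hD.eq_one_of_isUnit (isUnit_of_dvd_one h)
    refine ⟨⟨D, hD, hdvd, τ, ?_, ?_⟩, dvd_rfl⟩
    · change t (AdjoinRoot.root D) * AdjoinRoot.root D = 1
      rw [ht, hx]
    · refine ⟨⟨0, 1, zero_ne_one⟩, mul_comm, ?_⟩
      rintro ⟨f, hf⟩ hf0
      rw [Ne, ← Subtype.val_inj] at hf0
      have hf' : t f = f := hf
      obtain ⟨g, rfl⟩ := AdjoinRoot.mk_surjective f
      rw [ZeroMemClass.coe_zero, AdjoinRoot.mk_eq_zero] at hf0
      suffices hu : IsUnit (AdjoinRoot.mk D g) by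
        obtain ⟨b, hb⟩ := hu.exists_right_inv
        have htb : t b = b := by
          have h1 : AdjoinRoot.mk D g * t b = 1 := by rw [← hf', ← map_mul, hb, map_one]
          calc t b = (AdjoinRoot.mk D g * b) * t b := by rw [hb, one_mul]
            _ = (AdjoinRoot.mk D g * t b) * b := by ring
            _ = b := by rw [h1, one_mul]
        exact ⟨⟨b, htb⟩, Subtype.ext hb⟩
      classical
      -- The ideal generated by a fixed element is stable under `t`, so its monic generator `G` is
      -- self-reciprocal. As `g` is nonzero modulo `D`, `G ≠ D`. Minimality of `D` leaves only `G =
      -- 1`, which makes the class of `g` a unit.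
      set G := normalize (EuclideanDomain.gcd D g) with hGdef
      have hGass : Associated G (EuclideanDomain.gcd D g) := normalize_associated _
      have hG0 : EuclideanDomain.gcd D g ≠ 0 := fun h =>
        hD.ne_zero (EuclideanDomain.gcd_eq_zero_iff.1 h).1
      have hGm : G.Monic := monic_normalize hG0
      have hGD : G ∣ D := hGass.dvd.trans (EuclideanDomain.gcd_dvd_left _ _)
      have hGg : G ∣ g := hGass.dvd.trans (EuclideanDomain.gcd_dvd_right _ _)
      obtain ⟨a, ha⟩ : ∃ a, D ∣ G - g * a := by
        have h1 := EuclideanDomain.gcd_eq_gcd_ab D g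
        obtain ⟨w, hw⟩ := hGass.symm
        refine ⟨EuclideanDomain.gcdB D g * w, -(-EuclideanDomain.gcdA D g * w), ?_⟩
        rw [← hw, h1]
        ring
      have hG1 : G = 1 := by
        by_contra hG1
        refine hmin ⟨G, hGm, hG1, ?_, hGD, ?_⟩
        · intro h
          exact hf0 (h ▸ hGg)
        · have h1 : AdjoinRoot.mk D G = AdjoinRoot.mk D g * AdjoinRoot.mk D a := by
            rw [← map_mul, AdjoinRoot.mk_eq_mk]; exact ha
          have h2 : aeval x G = AdjoinRoot.mk D g * t (AdjoinRoot.mk D a) := by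
            rw [← hf', ← map_mul, ← h1, ← AdjoinRoot.aeval_eq, ← ht]
            exact aeval_algHom_apply t (AdjoinRoot.root D) G
          have h3 := aeval_reverse_mul_pow hx' G
          obtain ⟨c, hc⟩ := AdjoinRoot.mk_surjective
            (t (AdjoinRoot.mk D a) * AdjoinRoot.root D ^ G.natDegree)
          have h4 : AdjoinRoot.mk D G.reverse = AdjoinRoot.mk D (g * c) := by
            rw [map_mul, hc, ← mul_assoc, ← h2, ← h3, mul_assoc, ← mul_pow, hx, one_pow, mul_one,
              AdjoinRoot.aeval_eq]
          rw [AdjoinRoot.mk_eq_mk] at h4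
          have h5 := hGD.trans h4
          have h6 : G ∣ g * c := hGg.mul_right c
          simpa using dvd_add h5 h6
      rw [hG1] at ha
      refine IsUnit.of_mul_eq_one (AdjoinRoot.mk D a) ?_
      rw [← map_mul, ← map_one (AdjoinRoot.mk D), eq_comm, AdjoinRoot.mk_eq_mk]
      exact ha

variable [FiniteDimensional K V]

instance : Finite (FactorIndex γ) := by
  have := fintypeSubtypeMonicDvd (minpoly K γ) (minpoly.ne_zero (Algebra.IsIntegral.isIntegral γ))
  refine Finite.of_injective
    (fun i : FactorIndex γ => (⟨i.poly, i.monic_poly, i.poly_dvd⟩ :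
      {g : K[X] // g.Monic ∧ g ∣ minpoly K γ})) fun i j h => poly_injective ?_
  exact Subtype.mk.inj h

/-- If `X` divided the minimal polynomial, cancelling the invertible `γ` would leave an annihilating
polynomial of smaller degree. -/
theorem minpoly_coeff_zero_ne_zero (hu : IsUnit γ) : (minpoly K γ).coeff 0 ≠ 0 := by
  intro h
  obtain ⟨ν, hν⟩ := X_dvd_iff.2 h
  have h1 : aeval γ ν = 0 := by
    have h2 : γ * aeval γ ν = 0 := by
      have := minpoly.aeval K γ
      rw [hν, map_mul, aeval_X] at this
      exact this
    exact (hu.mul_right_eq_zero).1 h2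
  have hm := minpoly.ne_zero (Algebra.IsIntegral.isIntegral (R := K) γ)
  have h3 := minpoly.dvd K γ h1
  have hν0 : ν ≠ 0 := by rintro rfl; exact hm (by rw [hν, mul_zero])
  have h4 := natDegree_le_of_dvd h3 hν0
  rw [hν, natDegree_X_mul hν0] at h4
  omega

/-- By coprimality the product divides `minpoly K γ`, and the cofactor `E` is again self-reciprocal.
Were `E ≠ 1`, it would contain some `P_i`, whose square would then divide the squarefree minimal
polynomial. -/
theorem prod_poly_eq_minpoly (hγ : AbsolutelySemisimple γ) (hu : IsUnit γ)
    (hrev : minpoly K γ ∣ (minpoly K γ).reverse) [Fintype (FactorIndex γ)] :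
    ∏ i : FactorIndex γ, i.poly = minpoly K γ := by
  have hm : (minpoly K γ).Monic := minpoly.monic (Algebra.IsIntegral.isIntegral γ)
  have hprod : (∏ i : FactorIndex γ, i.poly).Monic :=
    monic_prod_of_monic _ _ fun i _ => i.monic_poly
  have hdvd : ∏ i : FactorIndex γ, i.poly ∣ minpoly K γ :=
    Finset.prod_dvd_of_coprime (fun i _ j _ hij => isCoprime_poly hγ hij) fun i _ => i.poly_dvd
  obtain ⟨E, hE⟩ := hdvd
  have hEm : E.Monic := hprod.of_mul_monic_left (hE ▸ hm)
  by_cases hE1 : E = 1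
  · rw [hE, hE1, mul_one]
  exfalso
  have h0 := minpoly_coeff_zero_ne_zero hu
  have hErev : E ∣ E.reverse := by
    refine dvd_reverse_of_mul (D := ∏ i : FactorIndex γ, i.poly) (hE ▸ h0) ?_ (hE ▸ hrev)
    have h : ∀ s : Finset (FactorIndex γ), (∏ i ∈ s, i.poly) ∣ (∏ i ∈ s, i.poly).reverse := by
      intro s
      classical
      induction s using Finset.induction_on with
      | empty => simp
      | insert a s ha ih =>
        rw [Finset.prod_insert ha, reverse_mul_of_domain]
        exact mul_dvd_mul a.poly_dvd_reverse ih
    exact h _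
  obtain ⟨i, hi⟩ := exists_poly_dvd (γ := γ) E hEm hE1 (hE ▸ dvd_mul_left _ _)
    (right_ne_zero_of_mul (by rw [← mul_coeff_zero, ← hE]; exact h0)) hErev
  have hsq : Squarefree (minpoly K γ) := hγ.isRadical_minpoly.squarefree hm.ne_zero
  refine i.not_isUnit_poly (hsq i.poly ?_)
  rw [hE]
  exact mul_dvd_mul (Finset.dvd_prod_of_mem _ (Finset.mem_univ i)) hi

theorem exists_algEquiv (hγ : AbsolutelySemisimple γ) (hu : IsUnit γ)
    (hrev : minpoly K γ ∣ (minpoly K γ).reverse) :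
    ∃ e : Algebra.adjoin K {γ} ≃ₐ[K] ∀ i : FactorIndex γ, i.A,
      ∀ p : K[X], e (aevalAdjoin γ p) = fun i => aeval i.gen p := by
  let := Fintype.ofFinite (FactorIndex γ)
  let g : K[X] →ₐ[K] ∀ i : FactorIndex γ, i.A := AlgHom.pi fun i => aeval i.gen
  have hg : ∀ p, g p = fun i => aeval i.gen p := fun p => rfl
  have hg0 : ∀ p, g p = 0 ↔ minpoly K γ ∣ p := by
    intro p
    rw [hg, funext_iff, ← prod_poly_eq_minpoly hγ hu hrev]
    simp only [Pi.zero_apply, aeval_gen_eq_zero_iff]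
    constructor
    · intro h
      exact Finset.prod_dvd_of_coprime (fun i _ j _ hij => isCoprime_poly hγ hij) fun i _ => h i
    · intro h i
      exact (Finset.dvd_prod_of_mem _ (Finset.mem_univ i)).trans h
  have hgs : Function.Surjective g := by
    intro x
    obtain ⟨r, hr⟩ := Ideal.pi_quotient_surjective
      (I := fun i : FactorIndex γ => Ideal.span {i.poly})
      (fun i j hij => (Ideal.isCoprime_span_singleton_iff _ _).2 (isCoprime_poly hγ hij)) x
    refine ⟨r, funext fun i => ?_⟩
    rw [hg, ← hr i]
    exact AdjoinRoot.aeval_eq r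
  let e₀ : Algebra.adjoin K {γ} →ₐ[K] ∀ i : FactorIndex γ, i.A :=
    AlgHom.liftOfSurjective (aevalAdjoin γ) aevalAdjoin_surjective g
      fun p hp => (hg0 p).2 ((aevalAdjoin_eq_zero_iff p).1 hp)
  have he₀ : ∀ p, e₀ (aevalAdjoin γ p) = g p := fun p => AlgHom.liftOfSurjective_apply ..
  refine ⟨AlgEquiv.ofBijective e₀ ⟨?_, ?_⟩, fun p => (he₀ p).trans (hg p)⟩
  · rw [injective_iff_map_eq_zero]
    intro x hx
    obtain ⟨p, rfl⟩ := aevalAdjoin_surjective x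
    rw [he₀, hg0, ← aevalAdjoin_eq_zero_iff] at hx
    exact hx
  · intro x
    obtain ⟨p, rfl⟩ := hgs x
    exact ⟨_, he₀ p⟩

end FactorIndex

end Semisimple

/-! ### Adjunction with the inverse, and the orthogonal decomposition of `V` -/

section Adjoint

variable {K V : Type u} [Field K] [AddCommGroup V] [Module K V] {q : QuadraticForm K V}
  {γ : Module.End K V}

theorem aeval_apply_of_apply_eq_self {z : V} (hz : γ z = z) (p : K[X]) :
    aeval γ p z = p.eval 1 • z := by
  have h : ∀ n : ℕ, (γ ^ n) z = z := by
    intro n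
    induction n with
    | zero => rfl
    | succ n ih => rw [pow_succ, Module.End.mul_apply, hz, ih]
  induction p using Polynomial.induction_on' with
  | add P Q hP hQ => rw [map_add, LinearMap.add_apply, hP, hQ, eval_add, add_smul]
  | monomial n a => simp [aeval_monomial, h, Module.algebraMap_end_apply]

theorem polar_aeval {φ ψ : Module.End K V}
    (h : ∀ x y, QuadraticMap.polar q (φ x) y = QuadraticMap.polar q x (ψ y)) (p : K[X]) (x y : V) :
    QuadraticMap.polar q (aeval φ p x) y = QuadraticMap.polar q x (aeval ψ p y) := by
  have hn : ∀ (n : ℕ) (x y : V),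
      QuadraticMap.polar q ((φ ^ n) x) y = QuadraticMap.polar q x ((ψ ^ n) y) := by
    intro n
    induction n with
    | zero => intro x y; rfl
    | succ n ih =>
      intro x y
      rw [pow_succ, pow_succ', Module.End.mul_apply, Module.End.mul_apply, ih, h]
  induction p using Polynomial.induction_on' with
  | add P Q hP hQ =>
    simp only [map_add, LinearMap.add_apply, QuadraticMap.polar_add_left,
      QuadraticMap.polar_add_right, hP, hQ]
  | monomial n a =>
    simp only [aeval_monomial, Module.End.mul_apply, Module.algebraMap_end_apply,
      QuadraticMap.polar_smul_left, QuadraticMap.polar_smul_right, hn]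

/-- `γ` is an absolutely semisimple isometry of the regular quadratic form `q`. -/
structure SemisimpleIsometry (q : QuadraticForm K V) (γ : Module.End K V) : Prop where
  nondegenerate : q.Nondegenerate
  map_apply : ∀ x, q (γ x) = q x
  isUnit : IsUnit γ
  semisimple : AbsolutelySemisimple γ

theorem semisimpleIsometry_toEnd (hq : q.Nondegenerate) (γ : orthogonalGroup q)
    (hγ : AbsolutelySemisimple (toEnd γ)) : SemisimpleIsometry q (toEnd γ) :=
  ⟨hq, γ.2, γ.1.isUnit, hγ⟩

namespace SemisimpleIsometry

theorem polar_map (h : SemisimpleIsometry q γ) (x y : V) :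
    QuadraticMap.polar q (γ x) (γ y) = QuadraticMap.polar q x y := by
  simp only [QuadraticMap.polar, ← map_add, h.map_apply]

/-- Both `v` and `γ v` lie in the radical of the polar form, so `q(γ v - v) = 2 q(v) = B_q(v, v) =
0`. Regularity then gives `γ v - v = 0`. This handles the degenerate polar forms of characteristic
two. -/
theorem apply_eq_self_of_polar_eq_zero (h : SemisimpleIsometry q γ) {v : V}
    (hv : ∀ w, QuadraticMap.polar q v w = 0) : γ v = v := by
  have hγv : ∀ w, QuadraticMap.polar q (γ v) w = 0 := by
    intro w
    obtain ⟨w, rfl⟩ := ((Module.End.isUnit_iff γ).1 h.isUnit).2 w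
    rw [h.polar_map, hv]
  have h2 : q v + q v = 0 := by
    have := hv v
    rw [QuadraticMap.polar_self] at this
    linear_combination this
  have h1 : γ v - v ∈ q.radical := by
    refine ⟨?_, ?_⟩
    · have h3 := QuadraticMap.map_add q (γ v) (-v)
      rw [hγv, QuadraticMap.map_neg, h.map_apply, h2, add_zero, ← sub_eq_add_neg] at h3
      exact h3
    · ext w
      simp [hv, hγv]
  rw [h.nondegenerate.radical_eq_bot, Submodule.mem_bot, sub_eq_zero] at h1
  exact h1

theorem polar_aeval_inverse (h : SemisimpleIsometry q γ) {γ' : Module.End K V} (h1 : γ * γ' = 1)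
    (x y : V) : QuadraticMap.polar q (γ x) y = QuadraticMap.polar q x (γ' y) := by
  rw [← h.polar_map x, ← Module.End.mul_apply, h1]
  rfl

variable [FiniteDimensional K V]

theorem exists_inverse (h : SemisimpleIsometry q γ) : ∃ g : K[X],
    aeval γ g * γ = 1 ∧ γ * aeval γ g = 1 ∧
    AdjoinRoot.mk (minpoly K γ) g * AdjoinRoot.root (minpoly K γ) = 1 := by
  obtain ⟨x, hx⟩ := exists_mul_root_eq_one (FactorIndex.minpoly_coeff_zero_ne_zero h.isUnit)
  obtain ⟨g, rfl⟩ := AdjoinRoot.mk_surjective x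
  have h1 : aeval γ g * γ = 1 := by
    have h2 := hx
    rw [← AdjoinRoot.mk_X, ← map_mul, ← map_one (AdjoinRoot.mk _), AdjoinRoot.mk_eq_mk,
      minpoly.dvd_iff, map_sub, map_mul, aeval_X, map_one, sub_eq_zero] at h2
    exact h2
  refine ⟨g, h1, ?_, hx⟩
  rw [← h1]
  have h2 : aeval γ (X * g) = aeval γ (g * X) := by rw [mul_comm]
  simpa using h2

/-- Let `μ` be the minimal polynomial. The operator `μ(γ⁻¹)` is adjoint to `μ(γ) = 0`, so its values
lie in the radical of the polar form, where `γ` and `γ⁻¹` are the identity. There `μ(γ⁻¹)` acts as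
`μ(1)`, that is, as `μ(γ) = 0`. -/
theorem minpoly_dvd_reverse (h : SemisimpleIsometry q γ) :
    minpoly K γ ∣ (minpoly K γ).reverse := by
  obtain ⟨g, h1, h1', hx⟩ := h.exists_inverse
  refine dvd_reverse_of_aeval hx ?_
  have hadj := polar_aeval (h.polar_aeval_inverse h1') (minpoly K γ)
  rw [← AdjoinRoot.aeval_eq, ← aeval_comp, AdjoinRoot.aeval_eq, AdjoinRoot.mk_eq_zero]
  -- Because `μ` is radical, it is enough that the square of `μ(γ⁻¹)` vanishes.
  refine h.semisimple.isRadical_minpoly 2 _ ((minpoly.dvd_iff).2 ?_)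
  rw [map_pow, aeval_comp]
  ext y
  set z := aeval (aeval γ g) (minpoly K γ) y with hz
  have hz' : γ z = z := by
    refine h.apply_eq_self_of_polar_eq_zero fun w => ?_
    rw [QuadraticMap.polar_comm, ← hadj, minpoly.aeval]
    simp
  have hz'' : aeval γ g z = z := by
    conv_lhs => rw [← hz']
    rw [← Module.End.mul_apply, h1]
    rfl
  rw [pow_two, Module.End.mul_apply, ← hz, aeval_apply_of_apply_eq_self hz'',
    ← aeval_apply_of_apply_eq_self hz', minpoly.aeval, LinearMap.zero_apply, LinearMap.zero_apply]

/-- An isomorphism of `K[γ]` with the product of the algebras `A_i`. -/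
noncomputable def decomp (h : SemisimpleIsometry q γ) :
    Algebra.adjoin K {γ} ≃ₐ[K] ∀ i : FactorIndex γ, i.A :=
  (FactorIndex.exists_algEquiv h.semisimple h.isUnit h.minpoly_dvd_reverse).choose

theorem decomp_aeval (h : SemisimpleIsometry q γ) (p : K[X]) :
    h.decomp (aevalAdjoin γ p) = fun i => aeval i.gen p :=
  (FactorIndex.exists_algEquiv h.semisimple h.isUnit h.minpoly_dvd_reverse).choose_spec p

open Classical in
/-- The action of `A_i` on `V`, trivial on the `V_j` for `j ≠ i`. -/
noncomputable def component (h : SemisimpleIsometry q γ) (i : FactorIndex γ) :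
    i.A →ₗ[K] Module.End K V :=
  (Algebra.adjoin K {γ}).val.toLinearMap ∘ₗ h.decomp.symm.toLinearMap ∘ₗ
    LinearMap.single K (fun i : FactorIndex γ => i.A) i

open Classical in
theorem component_apply (h : SemisimpleIsometry q γ) (i : FactorIndex γ) (a : i.A) :
    h.component i a = (h.decomp.symm (Pi.single i a) : Module.End K V) := rfl

theorem component_mem (h : SemisimpleIsometry q γ) (i : FactorIndex γ) (a : i.A) :
    h.component i a ∈ Algebra.adjoin K {γ} := Subtype.property _

theorem sum_component_one (h : SemisimpleIsometry q γ) [Fintype (FactorIndex γ)] :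
    ∑ i, h.component i 1 = 1 := by
  classical
  simp only [component_apply]
  rw [← AddSubmonoidClass.coe_finsetSum, ← map_sum, Finset.univ_sum_single]
  exact congrArg Subtype.val (map_one h.decomp.symm)

theorem aeval_mul_component (h : SemisimpleIsometry q γ) (i : FactorIndex γ) (p : K[X])
    (a : i.A) : aeval γ p * h.component i a = h.component i (aeval i.gen p * a) := by
  classical
  rw [component_apply, component_apply, ← coe_aevalAdjoin, ← MulMemClass.coe_mul]
  congr 1
  rw [AlgEquiv.eq_symm_apply, map_mul, decomp_aeval, AlgEquiv.apply_symm_apply]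
  funext k
  rcases eq_or_ne k i with rfl | hk
  · rw [Pi.mul_apply, Pi.single_eq_same, Pi.single_eq_same]
  · rw [Pi.mul_apply, Pi.single_eq_of_ne hk, Pi.single_eq_of_ne hk, mul_zero]

theorem component_gen (h : SemisimpleIsometry q γ) (i : FactorIndex γ) :
    h.component i i.gen = γ * h.component i 1 := by
  have := h.aeval_mul_component i X 1
  rw [aeval_X, aeval_X, mul_one] at this
  exact this.symm

theorem component_apply_mem (h : SemisimpleIsometry q γ) (i : FactorIndex γ) (a : i.A) (v : V) :
    h.component i a v ∈ i.space := by
  change aeval γ i.poly _ = 0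
  rw [← Module.End.mul_apply, h.aeval_mul_component, i.aeval_gen_poly, zero_mul, map_zero,
    LinearMap.zero_apply]

/-- `P_i(γ_j)` is a unit of `A_j`, so the action of any `a ∈ A_j` on `V` factors through `P_i(γ)`,
which kills `V_i`. -/
theorem component_eq_zero_of_mem (h : SemisimpleIsometry q γ) {i j : FactorIndex γ} (hij : i ≠ j)
    (a : j.A) {v : V} (hv : v ∈ i.space) : h.component j a v = 0 := by
  have hu : IsUnit (aeval j.gen i.poly) := by
    rcases j.aeval_gen_eq_zero_or_isUnit h.semisimple i.poly_dvd_reverse with h0 | h0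
    · rw [j.aeval_gen_eq_zero_iff] at h0
      exact absurd ((FactorIndex.isCoprime_poly h.semisimple hij).symm.isUnit_of_dvd' dvd_rfl h0)
        j.not_isUnit_poly
    · exact h0
  obtain ⟨b, hb⟩ := hu.exists_right_inv
  have h1 : h.component j a = h.component j (a * b) * aeval γ i.poly := by
    have h2 : Commute (aeval γ i.poly) (h.component j (a * b)) := by
      obtain ⟨p, hp⟩ := aevalAdjoin_surjective ⟨_, h.component_mem j (a * b)⟩
      have h3 : h.component j (a * b) = aeval γ p := by
        rw [← coe_aevalAdjoin, hp]
      rw [h3]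
      exact (Commute.all i.poly p).map (aeval γ)
    rw [← h2.eq, h.aeval_mul_component]
    congr 1
    linear_combination (-a) * hb
  have hv' : aeval γ i.poly v = 0 := hv
  rw [h1, Module.End.mul_apply, hv', map_zero]

theorem component_one_apply (h : SemisimpleIsometry q γ) {i : FactorIndex γ} {v : V}
    (hv : v ∈ i.space) : h.component i 1 v = v := by
  classical
  let := Fintype.ofFinite (FactorIndex γ)
  have h1 := LinearMap.congr_fun h.sum_component_one v
  rw [LinearMap.sum_apply, Finset.sum_eq_single i] at h1
  · exact h1
  · intro j _ hj
    exact h.component_eq_zero_of_mem hj.symm 1 hv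
  · simp

theorem component_coe (h : SemisimpleIsometry q γ) {i : FactorIndex γ} (a : i.A) (v : i.space) :
    h.component i a v = ((a • v : i.space) : V) := by
  obtain ⟨p, rfl⟩ := i.exists_aeval a
  have h1 : aeval i.gen p • v = aeval i.restr p v := by
    rw [i.smul_eq, ← i.action_gen, aeval_algHom_apply]
  rw [h1, i.coe_aeval_restr, ← mul_one (aeval i.gen p), ← h.aeval_mul_component,
    Module.End.mul_apply, h.component_one_apply v.2]

/-- Write the component as `p(γ)`. Its adjoint is `p(γ⁻¹)`, and `γ⁻¹` corresponds to `τ_j(γ_j)` in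
every factor `A_j`. For `a = 1` the projectors are self-adjoint, whence the orthogonality of the
`V_i`. -/
theorem polar_component (h : SemisimpleIsometry q γ) (i : FactorIndex γ) (a : i.A) (v w : V) :
    QuadraticMap.polar q (h.component i a v) w =
      QuadraticMap.polar q v (h.component i (i.tau a) w) := by
  classical
  obtain ⟨g, h1, h1', -⟩ := h.exists_inverse
  obtain ⟨p, hp⟩ := aevalAdjoin_surjective (h.decomp.symm (Pi.single i a))
  have h2 : h.component i a = aeval γ p := by rw [component_apply, ← hp, coe_aevalAdjoin]
  have h3 : h.component i (i.tau a) = aeval (aeval γ g) p := by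
    rw [← aeval_comp, ← coe_aevalAdjoin, component_apply]
    congr 1
    rw [AlgEquiv.symm_apply_eq, decomp_aeval]
    funext j
    have h4 : aeval j.gen g = j.tau j.gen := by
      have h5 : aevalAdjoin γ (g * X) = 1 := Subtype.ext (by
        rw [coe_aevalAdjoin, map_mul, aeval_X, h1]; rfl)
      have h6 := congrFun (congrArg h.decomp h5) j
      rw [decomp_aeval, map_one] at h6
      simp only [map_mul, aeval_X, Pi.one_apply] at h6
      calc aeval j.gen g = aeval j.gen g * (j.gen * j.tau j.gen) := by
            rw [j.gen_mul_tau_gen, mul_one]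
        _ = j.tau j.gen := by rw [← mul_assoc, h6, one_mul]
    have h7 : aeval j.gen p = Pi.single (M := fun i : FactorIndex γ => i.A) i a j := by
      have h8 := congrFun (congrArg h.decomp hp) j
      rw [decomp_aeval, AlgEquiv.apply_symm_apply] at h8
      exact h8
    have h9 : aeval (j.tau j.gen) p = j.tau (aeval j.gen p) :=
      aeval_algHom_apply (j.tau : j.A →ₐ[K] j.A) j.gen p
    rw [aeval_comp, h4, h9, h7]
    rcases eq_or_ne j i with rfl | hj
    · rw [Pi.single_eq_same, Pi.single_eq_same]
    · rw [Pi.single_eq_of_ne hj, Pi.single_eq_of_ne hj, map_zero]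
  rw [h2, h3]
  exact polar_aeval (h.polar_aeval_inverse h1') p v w

theorem polar_eq_zero (h : SemisimpleIsometry q γ) {i j : FactorIndex γ} (hij : i ≠ j) {v w : V}
    (hv : v ∈ i.space) (hw : w ∈ j.space) : QuadraticMap.polar q v w = 0 := by
  rw [← h.component_one_apply hv, h.polar_component, map_one,
    h.component_eq_zero_of_mem hij.symm 1 hw]
  simp

theorem polar_smul (h : SemisimpleIsometry q γ) {i : FactorIndex γ} (a : i.A) (v w : i.space) :
    QuadraticMap.polar q ((a • v : i.space) : V) w =
      QuadraticMap.polar q (v : V) ((i.tau a • w : i.space) : V) := by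
  rw [← h.component_coe, ← h.component_coe, h.polar_component]

theorem iSup_space (h : SemisimpleIsometry q γ) : ⨆ i : FactorIndex γ, i.space = ⊤ := by
  let := Fintype.ofFinite (FactorIndex γ)
  rw [eq_top_iff]
  intro v _
  have h1 := LinearMap.congr_fun h.sum_component_one v
  rw [LinearMap.sum_apply, Module.End.one_apply] at h1
  rw [← h1]
  exact Submodule.sum_mem _ fun i _ =>
    Submodule.mem_iSup_of_mem i (h.component_apply_mem i 1 v)

theorem iSupIndep_space (h : SemisimpleIsometry q γ) :
    iSupIndep fun i : FactorIndex γ => i.space := by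
  intro i
  rw [Submodule.disjoint_def]
  intro v hv hv'
  have h1 : (⨆ j : FactorIndex γ, ⨆ _ : j ≠ i, j.space) ≤ LinearMap.ker (h.component i 1) :=
    iSup₂_le fun j hj w hw => h.component_eq_zero_of_mem hj 1 hw
  rw [← h.component_one_apply hv]
  exact h1 hv'

end SemisimpleIsometry

end Adjoint

/-! ### The three types of indices -/

section Types

variable {K V : Type u} [Field K] [AddCommGroup V] [Module K V] {γ : Module.End K V}

namespace FactorIndex

theorem tau_eq_id_of_gen_sq {i : FactorIndex γ} (h : i.gen ^ 2 = 1) : ⇑i.tau = id := by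
  have h1 : i.tau i.gen = i.gen := by
    calc i.tau i.gen = i.tau i.gen * i.gen ^ 2 := by rw [h, mul_one]
      _ = i.gen := by rw [pow_two, ← mul_assoc, i.tau_gen, one_mul]
  have h2 : (i.tau : i.A →ₐ[K] i.A) = AlgHom.id K i.A := i.algHom_ext h1
  funext a
  exact DFunLike.congr_fun h2 a

theorem gen_sq_of_tau_eq_id {i : FactorIndex γ} (h : ⇑i.tau = id) : i.gen ^ 2 = 1 := by
  have h1 := i.tau_gen
  rw [h, id] at h1
  rw [pow_two, h1]

/-- Now `τ` is trivial, so `A_i = F_i` is a field. There `(γ_i - 1)(γ_i + 1) = 0` forces `γ_i = ±1`,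
a scalar that generates `A_i`. -/
theorem isTriv_of_gen_sq {i : FactorIndex γ} (h : i.gen ^ 2 = 1) : i.IsTriv := by
  refine ⟨h, (algebraMap K i.A).injective, ?_⟩
  have hF : ∀ a : i.A, a ∈ i.F := fun a => by rw [mem_F, tau_eq_id_of_gen_sq h]; rfl
  obtain ⟨c, hc⟩ : ∃ c : K, i.gen = algebraMap K i.A c := by
    have h1 : (i.gen - 1) * (i.gen + 1) = 0 := by linear_combination h
    rcases isUnit_or_eq_zero_of_mem_F (hF (i.gen - 1)) with h2 | h2
    · refine ⟨-1, ?_⟩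
      rw [map_neg, map_one]
      exact eq_neg_of_add_eq_zero_left ((h2.mul_right_eq_zero).1 h1)
    · exact ⟨1, by rw [map_one]; exact sub_eq_zero.1 h2⟩
  intro a
  obtain ⟨p, rfl⟩ := i.exists_aeval a
  exact ⟨p.eval c, by rw [hc, aeval_algebraMap_apply, coe_aeval_eq_eval]⟩

/-- The difference `γ_i - γ_i⁻¹`. -/
noncomputable def delta (i : FactorIndex γ) : i.A := i.gen - i.tau i.gen

theorem tau_delta (i : FactorIndex γ) : i.tau i.delta = -i.delta := by
  rw [delta, map_sub, tau_tau, neg_sub]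

/-- `δ²` is fixed by `τ`, hence zero or a unit. If it were zero, reducedness would give `δ = 0`,
that is `γ_i = γ_i⁻¹`. -/
theorem isUnit_delta (hγ : AbsolutelySemisimple γ) {i : FactorIndex γ} (h : i.gen ^ 2 ≠ 1) :
    IsUnit i.delta := by
  have := i.isReduced_A hγ
  have h1 : i.delta ^ 2 ∈ i.F := by rw [mem_F, map_pow, tau_delta, neg_sq]
  rcases isUnit_or_eq_zero_of_mem_F h1 with h2 | h2
  · exact (isUnit_pow_iff two_ne_zero).1 h2
  · refine absurd ?_ h
    have h3 : i.delta = 0 := IsReduced.eq_zero _ ⟨2, h2⟩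
    rw [delta, sub_eq_zero] at h3
    rw [pow_two]
    nth_rw 1 [h3]
    exact i.tau_gen

theorem isUnit_gen_sub_one (hγ : AbsolutelySemisimple γ) {i : FactorIndex γ} (h : i.gen ^ 2 ≠ 1) :
    IsUnit (i.gen - 1) := by
  have h1 : i.delta = (i.gen - 1) * (1 + i.tau i.gen) := by
    rw [delta]; linear_combination (-1 : i.A) * i.gen_mul_tau_gen
  exact isUnit_of_mul_isUnit_left (h1 ▸ isUnit_delta hγ h)

/-- The map `a ↦ a + τ a` from `A_i` to `F_i`. -/
noncomputable def relTrace (i : FactorIndex γ) : i.A →ₗ[i.F] i.F where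
  toFun a := ⟨a + i.tau a, by rw [mem_F, map_add, tau_tau, add_comm]⟩
  map_add' a b := Subtype.ext (by
    change a + b + i.tau (a + b) = (a + i.tau a) + (b + i.tau b)
    rw [map_add]; ring)
  map_smul' f a := Subtype.ext (by
    change (f : i.A) * a + i.tau ((f : i.A) * a) = (f : i.A) * (a + i.tau a)
    rw [map_mul, tau_coe]; ring)

theorem coe_relTrace (i : FactorIndex γ) (a : i.A) : (i.relTrace a : i.A) = a + i.tau a := rfl

theorem relTrace_tau (i : FactorIndex γ) (a : i.A) : i.relTrace (i.tau a) = i.relTrace a :=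
  Subtype.ext (by rw [coe_relTrace, coe_relTrace, tau_tau, add_comm])

instance nontrivial_F (i : FactorIndex γ) : Nontrivial i.F := by
  obtain ⟨x, y, hxy⟩ := i.isField_F.exists_pair_ne
  exact ⟨x, y, hxy⟩

/-- The witness is `α = γ_i / δ`. It replaces `1/2` wherever a quadratic form is to be recovered
from a hermitian one in arbitrary characteristic. -/
theorem exists_half (hγ : AbsolutelySemisimple γ) {i : FactorIndex γ} (h : i.gen ^ 2 ≠ 1) :
    ∃ α : i.A, α + i.tau α = 1 := by
  obtain ⟨d, hd⟩ := (isUnit_delta hγ h).exists_right_inv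
  have hτd : i.tau d = -d := by
    have h1 := congrArg i.tau hd
    rw [map_mul, tau_delta, map_one] at h1
    calc i.tau d = (i.delta * d) * i.tau d := by rw [hd, one_mul]
      _ = -d := by linear_combination (-d) * h1
  refine ⟨i.gen * d, ?_⟩
  rw [map_mul, hτd, ← hd, delta]
  ring

/-- The elements `1` and `γ_i` form a basis over `F_i`: the coefficient of `γ_i` in `a` is `(a - τ
a) / δ`. -/
theorem finrank_eq_two (hγ : AbsolutelySemisimple γ) {i : FactorIndex γ} (h : i.gen ^ 2 ≠ 1) :
    Module.finrank i.F i.A = 2 := by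
  let f : (i.F × i.F) →ₗ[i.F] i.A :=
    (Algebra.linearMap i.F i.A).coprod ((LinearMap.toSpanSingleton i.F i.A i.gen))
  have hf : ∀ x y : i.F, f (x, y) = x + y * i.gen := fun x y => rfl
  obtain ⟨d, hd⟩ := (isUnit_delta hγ h).exists_right_inv
  have hτd : i.tau d = -d := by
    have h1 := congrArg i.tau hd
    rw [map_mul, tau_delta, map_one] at h1
    calc i.tau d = (i.delta * d) * i.tau d := by rw [hd, one_mul]
      _ = -d := by linear_combination (-d) * h1
  have hbij : Function.Bijective f := by
    constructor
    · rw [← LinearMap.ker_eq_bot, LinearMap.ker_eq_bot']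
      rintro ⟨x, y⟩ hxy
      rw [hf] at hxy
      have h1 := congrArg i.tau hxy
      rw [map_add, map_mul, tau_coe, tau_coe, map_zero] at h1
      have h2 : (y : i.A) = 0 := by
        have h3 : (y : i.A) * i.delta = 0 := by rw [delta]; linear_combination hxy - h1
        calc (y : i.A) = y * (i.delta * d) := by rw [hd, mul_one]
          _ = 0 := by rw [← mul_assoc, h3, zero_mul]
      have h4 : (x : i.A) = 0 := by rwa [h2, zero_mul, add_zero] at hxy
      exact Prod.ext (Subtype.ext h4) (Subtype.ext h2)
    · intro a
      have hy : (a - i.tau a) * d ∈ i.F := by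
        rw [mem_F, map_mul, map_sub, tau_tau, hτd]; ring
      have hx : a - (a - i.tau a) * d * i.gen ∈ i.F := by
        rw [mem_F, map_sub, map_mul, mem_F.1 hy]
        rw [delta] at hd
        linear_combination (a - i.tau a) * hd
      refine ⟨(⟨_, hx⟩, ⟨_, hy⟩), ?_⟩
      rw [hf]
      ring
  rw [← (LinearEquiv.ofBijective f hbij).finrank_eq, Module.finrank_prod, Module.finrank_self]

/-- A nonzero nonunit `x` has norm `0` in `F_i`. Its trace cannot vanish too, since then `x² = 0`.
Dividing `x` by its trace gives an idempotent `e` with `e + τ(e) = 1`, which splits the algebra. -/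
theorem nonempty_splitting_of_not_isField (hγ : AbsolutelySemisimple γ) {i : FactorIndex γ}
    (hA : ¬ IsField i.A) : Nonempty i.Splitting := by
  have := i.isReduced_A hγ
  obtain ⟨x, hx0, hx⟩ : ∃ x : i.A, x ≠ 0 ∧ ¬ IsUnit x := by
    by_contra hcon
    push Not at hcon
    refine hA ⟨⟨0, 1, zero_ne_one⟩, mul_comm, fun {a} ha => (hcon a ha).exists_right_inv⟩
  have h1 : x * i.tau x ∈ i.F := by rw [mem_F, map_mul, tau_tau, mul_comm]
  have h2 : x * i.tau x = 0 := (isUnit_or_eq_zero_of_mem_F h1).resolve_left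
    fun h => hx (isUnit_of_mul_isUnit_left h)
  have h3 : x + i.tau x ∈ i.F := by rw [mem_F, map_add, tau_tau, add_comm]
  have h4 : IsUnit (x + i.tau x) := (isUnit_or_eq_zero_of_mem_F h3).resolve_right fun h => hx0 (by
    refine IsReduced.eq_zero _ ⟨2, ?_⟩
    linear_combination x * h - h2)
  obtain ⟨s, hs⟩ := h4.exists_right_inv
  have hτs : i.tau s = s := by
    have h5 := congrArg i.tau hs
    rw [map_mul, mem_F.1 h3, map_one] at h5
    calc i.tau s = ((x + i.tau x) * s) * i.tau s := by rw [hs, one_mul]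
      _ = s := by linear_combination s * h5
  obtain ⟨e, he⟩ : ∃ e : i.A, e = x * s := ⟨_, rfl⟩
  have hτe : i.tau e = i.tau x * s := by rw [he, map_mul, hτs]
  have he1 : e + i.tau e = 1 := by rw [he, map_mul, hτs, ← hs]; ring
  have he2 : e * i.tau e = 0 := by rw [hτe, he]; linear_combination s ^ 2 * h2
  have he3 : e * e = e := by linear_combination e * he1 - he2
  have he4 : i.tau e * i.tau e = i.tau e := by linear_combination i.tau e * he1 - he2
  have he0 : e ≠ 0 := by
    rintro h
    rw [h] at he1
    simp at he1
  -- This is the inverse of `(x, y) ↦ x e + y τ(e)`: the coordinates of `a` are the relative traces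
  -- of `a e` and `a τ(e)`.
  let f : i.A →ₐ[i.F] i.F × i.F := AlgHom.ofLinearMap
    ((i.relTrace ∘ₗ LinearMap.mulRight i.F e).prod
      (i.relTrace ∘ₗ LinearMap.mulRight i.F (i.tau e)))
    (by
      refine Prod.ext (Subtype.ext ?_) (Subtype.ext ?_)
      · change (1 * e) + i.tau (1 * e) = 1
        rw [one_mul, he1]
      · change (1 * i.tau e) + i.tau (1 * i.tau e) = 1
        rw [one_mul, tau_tau, add_comm, he1])
    (by
      intro a b
      refine Prod.ext (Subtype.ext ?_) (Subtype.ext ?_)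
      · change (a * b * e) + i.tau (a * b * e) =
          (a * e + i.tau (a * e)) * (b * e + i.tau (b * e))
        simp only [map_mul]
        linear_combination (-a * b) * he3 - (a * i.tau b + i.tau a * b) * he2 -
          i.tau a * i.tau b * he4
      · change (a * b * i.tau e) + i.tau (a * b * i.tau e) =
          (a * i.tau e + i.tau (a * i.tau e)) * (b * i.tau e + i.tau (b * i.tau e))
        simp only [map_mul, tau_tau]
        linear_combination (-a * b) * he4 - (a * i.tau b + i.tau a * b) * he2 -
          i.tau a * i.tau b * he3)
  have hf1 : ∀ a, ((f a).1 : i.A) = a * e + i.tau (a * e) := fun a => rfl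
  have hf2 : ∀ a, ((f a).2 : i.A) = a * i.tau e + i.tau (a * i.tau e) := fun a => rfl
  have hbij : Function.Bijective f := by
    constructor
    · rw [injective_iff_map_eq_zero]
      intro a ha
      have h5 := congrArg (fun z => (z.1 : i.A)) ha
      have h6 := congrArg (fun z => (z.2 : i.A)) ha
      simp only [hf1, hf2, map_mul, tau_tau, Prod.fst_zero, Prod.snd_zero, ZeroMemClass.coe_zero]
        at h5 h6
      linear_combination e * h5 + i.tau e * h6 - a * he1 - a * he3 - a * he4 -
        2 * i.tau a * he2
    · rintro ⟨x, y⟩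
      refine ⟨x * e + y * i.tau e, Prod.ext (Subtype.ext ?_) (Subtype.ext ?_)⟩
      · rw [hf1]
        simp only [map_mul, map_add, tau_tau, tau_coe]
        linear_combination (x : i.A) * he3 + (x : i.A) * he4 + 2 * (y : i.A) * he2 +
          (x : i.A) * he1
      · rw [hf2]
        simp only [map_mul, map_add, tau_tau, tau_coe]
        linear_combination (y : i.A) * he3 + (y : i.A) * he4 + 2 * (x : i.A) * he2 +
          (y : i.A) * he1
  refine ⟨AlgEquiv.ofBijective f hbij, fun a => Prod.ext (Subtype.ext ?_) (Subtype.ext ?_)⟩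
  · change ((f (i.tau a)).1 : i.A) = (f a).2
    rw [hf1, hf2]
    simp only [map_mul, tau_tau]
    ring
  · change ((f (i.tau a)).2 : i.A) = (f a).1
    rw [hf1, hf2]
    simp only [map_mul, tau_tau]
    ring

theorem type_trichotomy (hγ : AbsolutelySemisimple γ) (i : FactorIndex γ) :
    i.IsTriv ∨ i.IsFieldType ∨ i.IsSplit := by
  by_cases h : i.gen ^ 2 = 1
  · exact Or.inl (isTriv_of_gen_sq h)
  · by_cases hA : IsField i.A
    · exact Or.inr (Or.inl ⟨h, hA, finrank_eq_two hγ h⟩)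
    · exact Or.inr (Or.inr ⟨h, nonempty_splitting_of_not_isField hγ hA⟩)

end FactorIndex

end Types

/-! ### Trace duality on `F_i` and `A_i` -/

section Trace

theorem trace_nondegenerate_of_isField {K F L : Type*} [Field K] [CommRing F] [Algebra K F]
    (hF : IsField F) [Module.Finite K F] [Field L] [Algebra K L] [Algebra.IsSeparable K L]
    (g : F →ₐ[K] L) {f : F} (hf : ∀ f', Algebra.trace K F (f * f') = 0) : f = 0 := by
  let := hF.toField
  have : Algebra.IsSeparable K F := Algebra.IsSeparable.of_algHom K L g
  have h := traceForm_nondegenerate K F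
  exact h.1 f hf

variable {K V : Type u} [Field K] [AddCommGroup V] [Module K V] {γ : Module.End K V}

namespace FactorIndex

theorem poly_ne_zero (i : FactorIndex γ) : i.poly ≠ 0 := i.monic_poly.ne_zero

instance (i : FactorIndex γ) : Module.Finite K i.A :=
  Module.Finite.of_basis (AdjoinRoot.powerBasis i.poly_ne_zero).basis

instance (i : FactorIndex γ) : Module.Finite K i.F :=
  Module.Finite.of_injective i.F.val.toLinearMap Subtype.val_injective

/-- `F_i` embeds in a residue field of `A_i`. That field is finite and unramified over `K`, hence
separable, so `F_i` is separable and its trace form nondegenerate. -/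
theorem trace_nondegenerate (hγ : AbsolutelySemisimple γ) (i : FactorIndex γ) {f : i.F}
    (hf : ∀ f', Algebra.trace K i.F (f * f') = 0) : f = 0 := by
  obtain ⟨m, hm⟩ := Ideal.exists_maximal i.A
  let := Ideal.Quotient.field m
  have := i.formallyUnramified hγ
  have hu : Algebra.FormallyUnramified K (i.A ⧸ m) :=
    Algebra.FormallyUnramified.of_surjective (Ideal.Quotient.mkₐ K m) Ideal.Quotient.mk_surjective
  have : Module.Finite K (i.A ⧸ m) :=
    Module.Finite.of_surjective (Ideal.Quotient.mkₐ K m).toLinearMap Ideal.Quotient.mk_surjective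
  have : Algebra.IsSeparable K (i.A ⧸ m) :=
    (Algebra.FormallyUnramified.iff_isSeparable K (i.A ⧸ m)).1 hu
  exact trace_nondegenerate_of_isField i.isField_F ((Ideal.Quotient.mkₐ K m).comp i.F.val) hf

/-- The functional `a ↦ Tr_{F_i/K}(a + τ a)` on `A_i`. -/
noncomputable def tr (i : FactorIndex γ) : i.A →ₗ[K] K :=
  Algebra.trace K i.F ∘ₗ i.relTrace.restrictScalars K

theorem tr_apply (i : FactorIndex γ) (a : i.A) : i.tr a = Algebra.trace K i.F (i.relTrace a) := rfl

theorem tr_tau (i : FactorIndex γ) (a : i.A) : i.tr (i.tau a) = i.tr a := by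
  rw [tr_apply, tr_apply, relTrace_tau]

theorem relTrace_coe_mul (i : FactorIndex γ) (f : i.F) (a : i.A) :
    i.relTrace (f * a) = f * i.relTrace a := i.relTrace.map_smul f a

/-- Nondegeneracy over `F_i` gives `b a + τ(b a) = 0` for all `b`. The cases `b = 1` and `b = γ_i`
combine to `δ a = 0`. -/
theorem tr_nondegenerate (hγ : AbsolutelySemisimple γ) {i : FactorIndex γ} (h : i.gen ^ 2 ≠ 1)
    {a : i.A} (ha : ∀ b, i.tr (b * a) = 0) : a = 0 := by
  have h1 : ∀ b, b * a + i.tau b * i.tau a = 0 := by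
    intro b
    have h2 : i.relTrace (b * a) = 0 := by
      refine i.trace_nondegenerate hγ fun f' => ?_
      rw [mul_comm, ← relTrace_coe_mul, ← tr_apply, ← mul_assoc]
      exact ha _
    have h3 := congrArg Subtype.val h2
    rwa [coe_relTrace, map_mul] at h3
  have h2 := h1 1
  have h3 := h1 i.gen
  rw [map_one] at h2
  have h4 : i.delta * a = 0 := by
    rw [delta]; linear_combination h3 - i.tau i.gen * h2
  exact ((isUnit_delta hγ h).mul_right_eq_zero).1 h4

theorem tr_ext (hγ : AbsolutelySemisimple γ) {i : FactorIndex γ} (h : i.gen ^ 2 ≠ 1)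
    {a a' : i.A} (ha : ∀ b, i.tr (b * a) = i.tr (b * a')) : a = a' := by
  rw [← sub_eq_zero]
  refine tr_nondegenerate hγ h fun b => ?_
  rw [mul_sub, map_sub, ha, sub_self]

theorem exists_tr_eq (hγ : AbsolutelySemisimple γ) {i : FactorIndex γ} (h : i.gen ^ 2 ≠ 1)
    (l : i.A →ₗ[K] K) : ∃ a, ∀ b, i.tr (b * a) = l b := by
  let T : i.A →ₗ[K] Module.Dual K i.A :=
    LinearMap.mk₂ K (fun a b => i.tr (b * a)) (fun a a' b => by rw [mul_add, map_add])
      (fun c a b => by rw [mul_smul_comm, map_smul]) (fun a b b' => by rw [add_mul, map_add])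
      (fun c a b => by rw [smul_mul_assoc, map_smul])
  have hT : Function.Injective T := by
    rw [injective_iff_map_eq_zero]
    intro a ha
    exact tr_nondegenerate hγ h fun b => LinearMap.congr_fun ha b
  have hT' : Function.Surjective T :=
    (LinearMap.injective_iff_surjective_of_finrank_eq_finrank
      (Subspace.dual_finrank_eq).symm).1 hT
  obtain ⟨a, ha⟩ := hT' l
  exact ⟨a, fun b => LinearMap.congr_fun ha b⟩

/-- Applied to `a = B_i(v, w)`, such an expansion writes the sesquilinear form through values of
`B_q`. In that form it can be extended to any `K`-algebra. -/
theorem exists_dual_basis (hγ : AbsolutelySemisimple γ) {i : FactorIndex γ} (h : i.gen ^ 2 ≠ 1) :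
    ∃ (ι : Type) (_ : Fintype ι) (x y : ι → i.A), ∀ a, a = ∑ k, i.tr (x k * a) • y k := by
  let b := Module.finBasis K i.A
  choose x hx using fun k => exists_tr_eq hγ h (b.coord k)
  refine ⟨_, inferInstance, x, b, fun a => ?_⟩
  conv_lhs => rw [← b.sum_repr a]
  refine Finset.sum_congr rfl fun k _ => ?_
  rw [mul_comm, hx]
  rfl

end FactorIndex

end Trace

/-! ### Existence and uniqueness of the hermitian forms -/

section Hermitian

variable {K V : Type u} [Field K] [AddCommGroup V] [Module K V] {γ : Module.End K V}
  {q : QuadraticForm K V}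

theorem HermitianForm.ext_forms {F A M : Type u} [CommRing F] [CommRing A] [Algebra F A]
    {τ : A → A} [AddCommGroup M] [Module F M] [Module A M] {h h' : HermitianForm F A τ M}
    (h1 : h.form = h'.form) (h2 : h.sesq = h'.sesq) : h = h' := by
  cases h
  cases h'
  cases h1
  cases h2
  rfl

namespace FactorIndex

theorem coe_smul (i : FactorIndex γ) (f : i.F) (v : i.space) : f • v = (f : i.A) • v := rfl

theorem tau_ne_id {i : FactorIndex γ} (hi : i.gen ^ 2 ≠ 1) : ⇑i.tau ≠ id :=
  fun h => hi (gen_sq_of_tau_eq_id h)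

theorem coe_form {i : FactorIndex γ} (hi : i.gen ^ 2 ≠ 1) (H : i.Herm) (v : i.space) :
    (H.form v : i.A) = H.sesq v v := H.hermitian (tau_ne_id hi) v

theorem coe_polar_form {i : FactorIndex γ} (hi : i.gen ^ 2 ≠ 1) (H : i.Herm) (v w : i.space) :
    QuadraticMap.polar H.form v w = i.relTrace (H.sesq v w) := by
  refine Subtype.ext ?_
  change (H.form (v + w) : i.A) - H.form v - H.form w = H.sesq v w + i.tau (H.sesq v w)
  rw [coe_form hi, coe_form hi, coe_form hi, H.symm]
  simp only [map_add, LinearMap.add_apply]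
  ring

theorem polar_eq_of_isTraceForm {i : FactorIndex γ} {H : i.Herm} (hH : i.IsTraceForm q H)
    (v w : i.space) : QuadraticMap.polar q (v : V) w =
      Algebra.trace K i.F (QuadraticMap.polar H.form v w) := by
  simp only [QuadraticMap.polar, map_sub]
  rw [← hH, ← hH, ← hH]
  rfl

theorem tr_mul_sesq {i : FactorIndex γ} (hi : i.gen ^ 2 ≠ 1) {H : i.Herm}
    (hH : i.IsTraceForm q H) (c : i.A) (v w : i.space) :
    i.tr (c * H.sesq v w) = QuadraticMap.polar q ((c • v : i.space) : V) w := by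
  rw [polar_eq_of_isTraceForm hH, coe_polar_form hi, tr_apply, H.smul_left]

theorem algebraMap_F_bijective {i : FactorIndex γ} (hi : i.IsTriv) :
    Function.Bijective (algebraMap K i.F) := by
  refine ⟨(algebraMap K i.F).injective, fun f => ?_⟩
  obtain ⟨c, hc⟩ := hi.2.2 (f : i.A)
  exact ⟨c, Subtype.ext hc⟩

theorem trace_algebraMap_of_isTriv {i : FactorIndex γ} (hi : i.IsTriv) (c : K) :
    Algebra.trace K i.F (algebraMap K i.F c) = c := by
  rw [Algebra.trace_algebraMap, ← (LinearEquiv.ofBijective (Algebra.linearMap K i.F)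
    (algebraMap_F_bijective hi)).finrank_eq, Module.finrank_self, one_smul]

theorem algebraMap_trace_of_isTriv {i : FactorIndex γ} (hi : i.IsTriv) (f : i.F) :
    algebraMap K i.F (Algebra.trace K i.F f) = f := by
  obtain ⟨c, rfl⟩ := (algebraMap_F_bijective hi).2 f
  rw [trace_algebraMap_of_isTriv hi]

/-- Here `F_i = K` and the trace is the identity, so the form can only be `q` on `V_i`, and its
sesquilinear form is the polar form. -/
theorem existsUnique_herm_of_isTriv (q : QuadraticForm K V) {i : FactorIndex γ} (hi : i.IsTriv) :
    ∃! H : i.Herm, i.IsTraceForm q H := by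
  have hτ := tau_eq_id_of_gen_sq hi.1
  refine existsUnique_of_exists_of_unique ?_ ?_
  · let B : LinearMap.BilinMap i.F i.space i.F :=
      LinearMap.mk₂ i.F (fun v w => algebraMap K i.F (QuadraticMap.polar q (v : V) w))
        (fun v v' w => by simp [QuadraticMap.polar_add_left])
        (fun f v w => by
          obtain ⟨c, rfl⟩ := (algebraMap_F_bijective hi).2 f
          simp [algebraMap_smul, QuadraticMap.polar_smul_left])
        (fun v w w' => by simp [QuadraticMap.polar_add_right])
        (fun f v w => by
          obtain ⟨c, rfl⟩ := (algebraMap_F_bijective hi).2 f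
          simp [algebraMap_smul, QuadraticMap.polar_smul_right])
    let Q : QuadraticForm i.F i.space :=
      { toFun := fun v => algebraMap K i.F (q (v : V))
        toFun_smul := fun f v => by
          obtain ⟨c, rfl⟩ := (algebraMap_F_bijective hi).2 f
          simp [algebraMap_smul, QuadraticMap.map_smul]
        exists_companion' := ⟨B, fun v w => by
          change algebraMap K i.F (q ((v : V) + w)) = _ + _ + algebraMap K i.F _
          rw [QuadraticMap.map_add q, map_add, map_add]⟩ }
    have hpol : ∀ v w, QuadraticMap.polar Q v w = B v w := fun v w => by
      simp only [QuadraticMap.polar]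
      change algebraMap K i.F (q ((v : V) + w)) - algebraMap K i.F (q v) - algebraMap K i.F (q w) =
        algebraMap K i.F (q ((v : V) + w) - q v - q w)
      rw [map_sub, map_sub]
    have hmul : ∀ (a : i.A) (v w : i.space),
        B (a • v) w = ⟨a, mem_F.2 (congrFun hτ a)⟩ * B v w := fun a v w => by
      have h1 : a • v = (⟨a, mem_F.2 (congrFun hτ a)⟩ : i.F) • v := rfl
      rw [h1, map_smul]
      rfl
    have hsymm : ∀ v w : i.space, B v w = B w v := fun v w => by
      change algebraMap K i.F _ = algebraMap K i.F _
      rw [QuadraticMap.polar_comm]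
    refine ⟨{ form := Q, sesq := B.compr₂ (Algebra.linearMap i.F i.A), smul_left := ?_,
              smul_right := ?_, symm := ?_, quadratic := ?_, hermitian := ?_ }, ?_⟩
    · intro a v w
      exact congrArg Subtype.val (hmul a v w)
    · intro a v w
      change ((B v (a • w) : i.F) : i.A) = i.tau a * (B v w : i.F)
      rw [hτ, hsymm, hsymm v w]
      exact congrArg Subtype.val (hmul a w v)
    · intro v w
      change i.tau ((B v w : i.F) : i.A) = (B w v : i.F)
      rw [hτ, hsymm]
      rfl
    · intro _ v w
      rw [hpol]
      rfl
    · intro h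
      exact absurd hτ h
    · intro v
      exact (trace_algebraMap_of_isTriv hi _).symm
  · intro H H' hH hH'
    have h1 : H.form = H'.form := by
      ext1 v
      rw [← algebraMap_trace_of_isTriv hi (H.form v), ← hH v, hH' v,
        algebraMap_trace_of_isTriv hi]
    refine HermitianForm.ext_forms h1 ?_
    ext v w
    rw [H.quadratic hτ, H'.quadratic hτ, h1]

/-- Trace duality defines `b(v, w)` by `tr(c b(v, w)) = B_q(c v, w)`. Each property of `b` is
checked under `tr(c · )`, where hermitian symmetry is the adjunction between `a` and `τ(a)`. The
same equation determines the form uniquely. -/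
theorem existsUnique_herm_of_gen_sq_ne [FiniteDimensional K V] (h : SemisimpleIsometry q γ)
    {i : FactorIndex γ} (hi : i.gen ^ 2 ≠ 1) : ∃! H : i.Herm, i.IsTraceForm q H := by
  have hγ := h.semisimple
  refine existsUnique_of_exists_of_unique ?_ ?_
  · have hB : ∀ v w : i.space, ∃ b, ∀ c : i.A,
        i.tr (c * b) = QuadraticMap.polar q ((c • v : i.space) : V) w := fun v w => by
      let l : i.A →ₗ[K] K :=
        { toFun := fun c => QuadraticMap.polar q ((c • v : i.space) : V) w
          map_add' := fun c d => by simp [add_smul, QuadraticMap.polar_add_left]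
          map_smul' := fun k c => by simp [smul_assoc, QuadraticMap.polar_smul_left] }
      exact exists_tr_eq hγ hi l
    choose b hb using hB
    have hl : ∀ (a : i.A) (v w : i.space), b (a • v) w = a * b v w := fun a v w =>
      tr_ext hγ hi fun c => by rw [hb, ← mul_assoc, hb, mul_smul]
    have hs : ∀ v w : i.space, i.tau (b v w) = b w v := fun v w =>
      tr_ext hγ hi fun c => by
        have h1 : i.tr (c * i.tau (b v w)) = i.tr (i.tau c * b v w) := by
          rw [← tr_tau, map_mul, tau_tau]
        rw [h1, hb, hb, h.polar_smul, tau_tau, QuadraticMap.polar_comm]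
    have hr : ∀ (a : i.A) (v w : i.space), b v (a • w) = i.tau a * b v w := fun a v w => by
      rw [← hs, hl, map_mul, hs]
    have hadd : ∀ v v' w : i.space, b (v + v') w = b v w + b v' w := fun v v' w =>
      tr_ext hγ hi fun c => by
        rw [mul_add, map_add, hb, hb, hb, smul_add, Submodule.coe_add,
          QuadraticMap.polar_add_left]
    have hadd' : ∀ v w w' : i.space, b v (w + w') = b v w + b v w' := fun v w w' => by
      rw [← hs, hadd, map_add, hs, hs]
    let B : LinearMap.BilinMap i.F i.space i.A := LinearMap.mk₂ i.F b hadd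
      (fun f v w => hl f v w) hadd' (fun f v w => by
        rw [coe_smul, hr, tau_coe]; rfl)
    have hBb : ∀ v w, B v w = b v w := fun v w => rfl
    -- Since `b(v, v)` is fixed by `τ`, it equals the relative trace of `α b(v, v)`. This exhibits
    -- it as a quadratic form with values in `F_i` without dividing by two.
    obtain ⟨α, hα⟩ := exists_half hγ hi
    let Q : QuadraticForm i.F i.space :=
      LinearMap.BilinMap.toQuadraticMap (B.compr₂ (i.relTrace ∘ₗ LinearMap.mulLeft i.F α))
    have hQ : ∀ v, (Q v : i.A) = b v v := fun v => by
      change α * b v v + i.tau (α * b v v) = b v v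
      rw [map_mul, hs, ← add_mul, hα, one_mul]
    let H : i.Herm :=
      { form := Q, sesq := B, smul_left := hl, smul_right := hr, symm := hs,
        quadratic := fun h1 => absurd h1 (tau_ne_id hi), hermitian := fun _ v => hQ v }
    refine ⟨H, ?_⟩
    have hpol : ∀ v w : i.space, QuadraticMap.polar q (v : V) w =
        Algebra.trace K i.F (QuadraticMap.polar Q v w) := fun v w => by
      have h1 : QuadraticMap.polar Q v w = i.relTrace (b v w) := coe_polar_form hi H v w
      rw [h1, ← tr_apply, ← one_mul (b v w), hb, one_smul]
    -- The difference `d = q - Tr ∘ Q` has zero polar form, so it is additive and `2 d = 0`. In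
    -- characteristic two this does not yet give `d = 0`.
    have hd2 : ∀ v : i.space, 2 * (q v - Algebra.trace K i.F (Q v)) = 0 := fun v => by
      have h1 := hpol v v
      rw [QuadraticMap.polar_self, QuadraticMap.polar_self, two_nsmul, two_nsmul, map_add] at h1
      linear_combination h1
    have hQg : ∀ v : i.space, Q (i.gen • v) = Q v := fun v => Subtype.ext (by
      rw [hQ, hQ, hl, hr, ← mul_assoc, i.gen_mul_tau_gen, one_mul])
    intro v
    -- As `γ_i - 1` is a unit, every vector is `γ w - w`. By additivity and invariance under `γ`,
    -- `d(γ w - w) = 2 d(w) = 0`.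
    obtain ⟨w, rfl⟩ : ∃ w, (i.gen - 1) • w = v := by
      obtain ⟨d, hd⟩ := (isUnit_gen_sub_one hγ hi).exists_right_inv
      exact ⟨d • v, by rw [← mul_smul, hd, one_smul]⟩
    have h1 : (i.gen - 1) • w = i.gen • w + -w := by rw [sub_smul, one_smul, sub_eq_add_neg]
    have h2 := QuadraticMap.map_add q ((i.gen • w : i.space) : V) ((-w : i.space) : V)
    have h3 := QuadraticMap.map_add Q (i.gen • w) (-w)
    rw [hpol, i.gen_smul, h.map_apply] at h2
    change q (((i.gen - 1) • w : i.space) : V) = Algebra.trace K i.F (Q ((i.gen - 1) • w))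
    rw [h1, h3, Submodule.coe_add, i.gen_smul, h2, hQg, QuadraticMap.map_neg, map_add, map_add,
      Submodule.coe_neg, QuadraticMap.map_neg]
    linear_combination hd2 w
  · intro H H' hH hH'
    have h1 : H.sesq = H'.sesq := by
      ext v w
      exact tr_ext hγ hi fun c => by rw [tr_mul_sesq hi hH, tr_mul_sesq hi hH']
    refine HermitianForm.ext_forms ?_ h1
    ext1 v
    exact Subtype.ext (by rw [coe_form hi, coe_form hi, h1])

theorem existsUnique_herm [FiniteDimensional K V] (h : SemisimpleIsometry q γ)
    (i : FactorIndex γ) : ∃! H : i.Herm, i.IsTraceForm q H := by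
  by_cases hi : i.gen ^ 2 = 1
  · exact existsUnique_herm_of_isTriv q (isTriv_of_gen_sq hi)
  · exact existsUnique_herm_of_gen_sq_ne h hi

end FactorIndex

end Hermitian

/-! ### The conjugacy criterion -/

theorem QuadraticMap.map_sum_of_polar_eq_zero {R M N ι : Type*} [CommRing R] [AddCommGroup M]
    [AddCommGroup N] [Module R M] [Module R N] (Q : QuadraticMap R M N) (s : Finset ι) (x : ι → M)
    (h : ∀ i ∈ s, ∀ j ∈ s, i ≠ j → QuadraticMap.polar Q (x i) (x j) = 0) :
    Q (∑ i ∈ s, x i) = ∑ i ∈ s, Q (x i) := by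
  classical
  induction s using Finset.induction_on with
  | empty => simp
  | insert a s ha ih =>
    have h0 : Q.polarBilin (x a) (∑ i ∈ s, x i) = 0 := by
      rw [map_sum]
      exact Finset.sum_eq_zero fun j hj => h a (Finset.mem_insert_self a s) j
        (Finset.mem_insert_of_mem hj) fun haj => ha (haj ▸ hj)
    rw [Finset.sum_insert ha, Finset.sum_insert ha, QuadraticMap.map_add Q, ih,
      ← polarBilin_apply_apply, h0, add_zero]
    exact fun i hi j hj => h i (Finset.mem_insert_of_mem hi) j (Finset.mem_insert_of_mem hj)

section Conjugacy

variable {K V : Type u} [Field K] [AddCommGroup V] [Module K V] {γ γ' : Module.End K V}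
  {q : QuadraticForm K V}

namespace FactorIndex

variable {i : FactorIndex γ} {j : FactorIndex γ'}

theorem algEquiv_tau {φ : i.A ≃ₐ[K] j.A} (hφ : φ i.gen = j.gen) (a : i.A) :
    φ (i.tau a) = j.tau (φ a) := by
  have h : (φ : i.A →ₐ[K] j.A).comp (i.tau : i.A →ₐ[K] i.A) =
      (j.tau : j.A →ₐ[K] j.A).comp (φ : i.A →ₐ[K] j.A) := by
    refine i.algHom_ext ?_
    change φ (i.tau i.gen) = j.tau (φ i.gen)
    rw [hφ]
    have h1 : φ (i.tau i.gen) * j.gen = 1 := by rw [← hφ, ← map_mul, i.tau_gen, map_one]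
    calc φ (i.tau i.gen) = φ (i.tau i.gen) * (j.gen * j.tau j.gen) := by
          rw [j.gen_mul_tau_gen, mul_one]
      _ = j.tau j.gen := by rw [← mul_assoc, h1, one_mul]
  exact DFunLike.congr_fun h a

theorem algEquiv_mem_F {φ : i.A ≃ₐ[K] j.A} (hφ : φ i.gen = j.gen) {a : i.A} (ha : a ∈ i.F) :
    φ a ∈ j.F := by
  rw [mem_F, ← algEquiv_tau hφ, mem_F.1 ha]

theorem algEquiv_symm_gen {φ : i.A ≃ₐ[K] j.A} (hφ : φ i.gen = j.gen) : φ.symm j.gen = i.gen := by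
  rw [← hφ, AlgEquiv.symm_apply_apply]

/-- The isomorphism of fixed fields induced by an isomorphism `(A_i, γ_i) ≃ (A'_j, γ'_j)`. -/
noncomputable def fixedEquiv (φ : i.A ≃ₐ[K] j.A) (hφ : φ i.gen = j.gen) : i.F ≃ₐ[K] j.F :=
  AlgEquiv.ofAlgHom
    (((φ : i.A →ₐ[K] j.A).comp i.F.val).codRestrict j.F fun f => algEquiv_mem_F hφ f.2)
    (((φ.symm : j.A →ₐ[K] i.A).comp j.F.val).codRestrict i.F
      fun f => algEquiv_mem_F (algEquiv_symm_gen hφ) f.2)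
    (AlgHom.ext fun f => Subtype.ext (φ.apply_symm_apply (f : j.A)))
    (AlgHom.ext fun f => Subtype.ext (φ.symm_apply_apply (f : i.A)))

theorem coe_fixedEquiv (φ : i.A ≃ₐ[K] j.A) (hφ : φ i.gen = j.gen) (f : i.F) :
    (fixedEquiv φ hφ f : j.A) = φ f := rfl

theorem trace_fixedEquiv (φ : i.A ≃ₐ[K] j.A) (hφ : φ i.gen = j.gen) (f : i.F) :
    Algebra.trace K j.F (fixedEquiv φ hφ f) = Algebra.trace K i.F f :=
  Algebra.trace_eq_of_algEquiv (fixedEquiv φ hφ) f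

theorem tr_algEquiv {φ : i.A ≃ₐ[K] j.A} (hφ : φ i.gen = j.gen) (a : i.A) :
    j.tr (φ a) = i.tr a := by
  rw [tr_apply, tr_apply, ← trace_fixedEquiv φ hφ]
  congr 1
  exact Subtype.ext (by rw [coe_fixedEquiv, coe_relTrace, coe_relTrace, map_add, algEquiv_tau hφ])

theorem apply_eq_of_form_eq {φ : i.A ≃ₐ[K] j.A} (hφ : φ i.gen = j.gen) {H : i.Herm}
    {H' : j.Herm} (hH : i.IsTraceForm q H) (hH' : j.IsTraceForm q H') {v : i.space} {w : j.space}
    (hvw : φ (H.form v) = (H'.form w : j.A)) : q (w : V) = q (v : V) := by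
  rw [hH, hH', ← trace_fixedEquiv φ hφ]
  congr 1
  exact Subtype.ext hvw.symm

/-- An isometry compatible with the algebra actions preserves `B_q(c v, v) = tr(c B_i(v, v))`, and
nondegeneracy of `tr` returns `B_i(v, v)`. If `γ_j² = 1`, both traces are identities. -/
theorem form_eq_of_apply_eq (hγ' : AbsolutelySemisimple γ') {φ : i.A ≃ₐ[K] j.A}
    (hφ : φ i.gen = j.gen) {H : i.Herm} {H' : j.Herm} (hH : i.IsTraceForm q H)
    (hH' : j.IsTraceForm q H') (f : i.space ≃+ j.space)
    (hf : ∀ (a : i.A) (v : i.space), f (a • v) = φ a • f v)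
    (hfq : ∀ v : i.space, q (f v : V) = q (v : V)) (v : i.space) :
    φ (H.form v) = (H'.form (f v) : j.A) := by
  by_cases hj : j.gen ^ 2 = 1
  · have hi : i.gen ^ 2 = 1 := φ.injective (by rw [map_pow, hφ, hj, map_one])
    rw [← algebraMap_trace_of_isTriv (isTriv_of_gen_sq hj) (H'.form (f v)), ← hH', hfq, hH,
      ← algebraMap_trace_of_isTriv (isTriv_of_gen_sq hi) (H.form v),
      trace_algebraMap_of_isTriv (isTriv_of_gen_sq hi)]
    exact φ.commutes _
  · have hi : i.gen ^ 2 ≠ 1 := fun h => hj (by rw [← hφ, ← map_pow, h, map_one])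
    have hpol : ∀ v w : i.space, QuadraticMap.polar q (f v : V) (f w) =
        QuadraticMap.polar q (v : V) w := fun v w => by
      simp only [QuadraticMap.polar]
      rw [← Submodule.coe_add, ← map_add, hfq, hfq, hfq, Submodule.coe_add]
    rw [coe_form hi, coe_form hj]
    refine tr_ext hγ' hj fun b => ?_
    obtain ⟨c, rfl⟩ := φ.surjective b
    rw [← map_mul, tr_algEquiv hφ, tr_mul_sesq hi hH, tr_mul_sesq hj hH', ← hf, hpol]

theorem minpoly_dvd_of_semiconj {g : Module.End K V} (hg : Function.Injective g)
    (h : g * γ = γ' * g) : minpoly K γ ∣ minpoly K γ' := by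
  rw [minpoly.dvd_iff]
  have h1 : ∀ p : K[X], g * aeval γ p = aeval γ' p * g := fun p => by
    have hn : ∀ n : ℕ, g * γ ^ n = γ' ^ n * g := fun n =>
      (SemiconjBy.pow_right (a := g) (x := γ) (y := γ') h n).eq
    induction p using Polynomial.induction_on' with
    | add P Q hP hQ => rw [map_add, map_add, mul_add, add_mul, hP, hQ]
    | monomial n a =>
      rw [aeval_monomial, aeval_monomial, mul_assoc, ← hn, ← mul_assoc, ← mul_assoc,
        Algebra.commutes]
  ext v
  apply hg
  have h2 := LinearMap.congr_fun (h1 (minpoly K γ')) v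
  rw [minpoly.aeval, zero_mul] at h2
  simpa using h2

/-- Indices of `γ` are indices of `γ'` if the minimal polynomials agree. -/
def indexEquiv (h : minpoly K γ = minpoly K γ') : FactorIndex γ ≃ FactorIndex γ' where
  toFun i := ⟨i.1, i.2.1, i.2.2.1.trans (dvd_of_eq h), i.2.2.2⟩
  invFun i := ⟨i.1, i.2.1, i.2.2.1.trans (dvd_of_eq h.symm), i.2.2.2⟩
  left_inv _ := rfl
  right_inv _ := rfl

theorem mem_space_of_semiconj {g : Module.End K V} (h : g * γ = γ' * g)
    (hij : i.poly = j.poly) {v : V} (hv : v ∈ i.space) : g v ∈ j.space := by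
  have h1 : ∀ p : K[X], g (aeval γ p v) = aeval γ' p (g v) := fun p => by
    have hn : ∀ n : ℕ, g ((γ ^ n) v) = (γ' ^ n) (g v) := fun n =>
      LinearMap.congr_fun (SemiconjBy.pow_right (a := g) (x := γ) (y := γ') h n).eq v
    induction p using Polynomial.induction_on' with
    | add P Q hP hQ => simp only [map_add, LinearMap.add_apply, hP, hQ]
    | monomial n a => simp [aeval_monomial, hn, Module.algebraMap_end_apply]
  change aeval γ' j.poly (g v) = 0
  have hv' : aeval γ i.poly v = 0 := hv
  rw [← h1, ← hij, hv', map_zero]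

end FactorIndex

open FactorIndex

/-- Conjugate elements have the same minimal polynomial, hence the same indices and algebras. The
semilinear maps are the restrictions of a conjugating isometry. -/
theorem exists_data_of_isConj (γ γ' : orthogonalGroup q)
    (hγ' : AbsolutelySemisimple (toEnd γ'))
    (h : ∀ i : FactorIndex (toEnd γ), i.Herm) (h' : ∀ i : FactorIndex (toEnd γ'), i.Herm)
    (hh : ∀ i : FactorIndex (toEnd γ), i.IsTraceForm q (h i))
    (hh' : ∀ i : FactorIndex (toEnd γ'), i.IsTraceForm q (h' i)) (hconj : IsConj γ γ') :
    ∃ σ : FactorIndex (toEnd γ) ≃ FactorIndex (toEnd γ'), ∀ i,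
      ∃ (φ : i.A ≃ₐ[K] (σ i).A) (f : i.space ≃+ (σ i).space),
        φ i.gen = (σ i).gen ∧
        (∀ (a : i.A) (v : i.space), f (a • v) = φ a • f v) ∧
        ∀ v : i.space,
          φ (((h i).form v : i.F) : i.A) =
            (((h' (σ i)).form (f v) : (σ i).F) : (σ i).A) := by
  obtain ⟨c, hc⟩ := isConj_iff.1 hconj
  rw [mul_inv_eq_iff_eq_mul] at hc
  have h1 : toEnd c * toEnd γ = toEnd γ' * toEnd c :=
    congrArg (fun x : orthogonalGroup q => (x.1.val : Module.End K V)) hc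
  have hcc : toEnd c * toEnd c⁻¹ = 1 :=
    congrArg (fun x : orthogonalGroup q => (x.1.val : Module.End K V)) (mul_inv_cancel c)
  have hcc' : toEnd c⁻¹ * toEnd c = 1 :=
    congrArg (fun x : orthogonalGroup q => (x.1.val : Module.End K V)) (inv_mul_cancel c)
  have h2 : toEnd c⁻¹ * toEnd γ' = toEnd γ * toEnd c⁻¹ := by
    calc toEnd c⁻¹ * toEnd γ' = toEnd c⁻¹ * (toEnd γ' * toEnd c) * toEnd c⁻¹ := by
          rw [mul_assoc, mul_assoc, hcc, mul_one]
      _ = toEnd γ * toEnd c⁻¹ := by rw [← h1, ← mul_assoc, hcc', one_mul]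
  have hleft : ∀ x, toEnd c⁻¹ (toEnd c x) = x := LinearMap.congr_fun hcc'
  have hright : ∀ x, toEnd c (toEnd c⁻¹ x) = x := LinearMap.congr_fun hcc
  -- Finite dimension is not assumed here: for a non-integral element the minimal polynomial has the
  -- default value `0`, and divisibility still gives equality.
  have hmin : minpoly K (toEnd γ) = minpoly K (toEnd γ') := by
    by_cases hi : IsIntegral K (toEnd γ)
    · have hd := minpoly_dvd_of_semiconj (Function.LeftInverse.injective hleft) h1
      have hd' := minpoly_dvd_of_semiconj (Function.LeftInverse.injective hright) h2
      have hne : minpoly K (toEnd γ') ≠ 0 := fun h0 =>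
        minpoly.ne_zero hi (zero_dvd_iff.1 (h0 ▸ hd'))
      have hi' : IsIntegral K (toEnd γ') := by
        by_contra hcon
        exact hne (minpoly.eq_zero hcon)
      exact eq_of_monic_of_associated (minpoly.monic hi) (minpoly.monic hi')
        (associated_of_dvd_dvd hd hd')
    · have hd' := minpoly_dvd_of_semiconj (Function.LeftInverse.injective hleft) h1
      rw [minpoly.eq_zero hi] at hd' ⊢
      exact (zero_dvd_iff.1 hd').symm
  refine ⟨indexEquiv hmin, fun i => ?_⟩
  let φ : i.A ≃ₐ[K] (indexEquiv hmin i).A := (AlgEquiv.refl : i.A ≃ₐ[K] i.A)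
  let f : i.space ≃+ (indexEquiv hmin i).space :=
    { toFun := fun v => ⟨toEnd c v, mem_space_of_semiconj (j := indexEquiv hmin i) h1 rfl v.2⟩
      invFun := fun v => ⟨toEnd c⁻¹ v,
        mem_space_of_semiconj (i := indexEquiv hmin i) (j := i) h2 rfl v.2⟩
      left_inv := fun v => Subtype.ext (hleft v)
      right_inv := fun v => Subtype.ext (hright v)
      map_add' := fun v w => Subtype.ext (map_add (toEnd c) (v : V) (w : V)) }
  have hφ : φ i.gen = (indexEquiv hmin i).gen := rfl
  have hf : ∀ (a : i.A) (v : i.space), f (a • v) = φ a • f v := by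
    intro a v
    obtain ⟨p, rfl⟩ := i.exists_aeval a
    have h3 : φ (aeval i.gen p) = aeval (indexEquiv hmin i).gen p := rfl
    rw [h3]
    clear h3
    induction p using Polynomial.induction_on generalizing v with
    | C k =>
      rw [aeval_C, aeval_C, algebraMap_smul, algebraMap_smul]
      exact Subtype.ext (map_smul (toEnd c) k (v : V))
    | add P Q hP hQ =>
      rw [map_add, map_add, add_smul, add_smul, map_add, hP, hQ]
    | monomial n k ih =>
      rw [pow_succ, ← mul_assoc, map_mul (aeval i.gen) (C k * X ^ n),
        map_mul (aeval (indexEquiv hmin i).gen) (C k * X ^ n), aeval_X, aeval_X, mul_smul, mul_smul,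
        ih]
      congr 1
      refine Subtype.ext ?_
      rw [gen_smul]
      change toEnd c ((i.gen • v : i.space) : V) = _
      rw [gen_smul]
      exact LinearMap.congr_fun h1 v
  exact ⟨φ, f, hφ, hf, form_eq_of_apply_eq hγ' hφ (hh i) (hh' _) f hf fun v => c.2 v⟩

/-- The conjugating isometry is the orthogonal sum of the `f_i`. Taking traces of the hermitian
forms shows that each `f_i` preserves `q`; commutation with the generators gives the intertwining of
`γ` and `γ'`. -/
theorem isConj_of_data [FiniteDimensional K V] (hq : q.Nondegenerate) (γ γ' : orthogonalGroup q)
    (hγ : AbsolutelySemisimple (toEnd γ)) (hγ' : AbsolutelySemisimple (toEnd γ'))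
    (h : ∀ i : FactorIndex (toEnd γ), i.Herm) (h' : ∀ i : FactorIndex (toEnd γ'), i.Herm)
    (hh : ∀ i : FactorIndex (toEnd γ), i.IsTraceForm q (h i))
    (hh' : ∀ i : FactorIndex (toEnd γ'), i.IsTraceForm q (h' i))
    (σ : FactorIndex (toEnd γ) ≃ FactorIndex (toEnd γ'))
    (hσ : ∀ i, ∃ (φ : i.A ≃ₐ[K] (σ i).A) (f : i.space ≃+ (σ i).space),
        φ i.gen = (σ i).gen ∧
        (∀ (a : i.A) (v : i.space), f (a • v) = φ a • f v) ∧
        ∀ v : i.space,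
          φ (((h i).form v : i.F) : i.A) =
            (((h' (σ i)).form (f v) : (σ i).F) : (σ i).A)) : IsConj γ γ' := by
  let := Fintype.ofFinite (FactorIndex (toEnd γ))
  have s := semisimpleIsometry_toEnd hq γ hγ
  have s' := semisimpleIsometry_toEnd hq γ' hγ'
  choose φ f hφ hf hform using hσ
  have hfq : ∀ i (v : i.space), q (f i v : V) = q (v : V) := fun i v =>
    apply_eq_of_form_eq (hφ i) (hh i) (hh' (σ i)) (hform i v)
  let π : ∀ i : FactorIndex (toEnd γ), V →ₗ[K] i.space := fun i =>
    (s.component i 1).codRestrict i.space (s.component_apply_mem i 1)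
  have hπ : ∀ i v, (π i v : V) = s.component i 1 v := fun i v => rfl
  let fK : ∀ i : FactorIndex (toEnd γ), i.space →ₗ[K] (σ i).space := fun i =>
    { toFun := f i
      map_add' := map_add (f i)
      map_smul' := fun k v => by
        rw [← algebraMap_smul i.A k v, hf, AlgEquiv.commutes, algebraMap_smul]; rfl }
  let g : Module.End K V := ∑ i, (σ i).space.subtype ∘ₗ fK i ∘ₗ π i
  have hg : ∀ v, g v = ∑ i, (f i (π i v) : V) := fun v => by
    rw [LinearMap.sum_apply]; rfl
  have hsum : ∀ v, ∑ i, (π i v : V) = v := fun v => by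
    have := LinearMap.congr_fun s.sum_component_one v
    rwa [LinearMap.sum_apply] at this
  have hgq : ∀ v, q (g v) = q v := fun v => by
    rw [hg, QuadraticMap.map_sum_of_polar_eq_zero]
    · conv_rhs => rw [← hsum v]
      rw [QuadraticMap.map_sum_of_polar_eq_zero]
      · exact Finset.sum_congr rfl fun i _ => hfq i _
      · exact fun i _ j _ hij => s.polar_eq_zero hij (π i v).2 (π j v).2
    · exact fun i _ j _ hij => s'.polar_eq_zero (fun h => hij (σ.injective h))
        (f i (π i v)).2 (f j (π j v)).2
  have hginj : Function.Injective g := by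
    rw [injective_iff_map_eq_zero]
    intro v hv
    rw [← hsum v]
    refine Finset.sum_eq_zero fun i _ => ?_
    have h1 : s'.component (σ i) 1 (g v) = f i (π i v) := by
      rw [hg, map_sum, Finset.sum_eq_single i]
      · exact s'.component_one_apply (f i (π i v)).2
      · intro j _ hj
        exact s'.component_eq_zero_of_mem (fun h => hj (σ.injective h)) 1 (f j (π j v)).2
      · simp
    rw [hv, map_zero] at h1
    have h2 : f i (π i v) = 0 := Subtype.ext h1.symm
    have h3 : π i v = 0 := by simpa using h2
    rw [h3]
    rfl
  have hcomm : ∀ v, g (toEnd γ v) = toEnd γ' (g v) := fun v => by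
    rw [hg, hg, map_sum]
    refine Finset.sum_congr rfl fun i _ => ?_
    have h1 : π i (toEnd γ v) = i.gen • π i v := by
      refine Subtype.ext ?_
      rw [gen_smul, hπ, hπ, ← Module.End.mul_apply, ← Module.End.mul_apply, ← s.component_gen]
      obtain ⟨p, hp⟩ := aevalAdjoin_surjective ⟨_, s.component_mem i 1⟩
      have h3 : s.component i 1 = aeval (toEnd γ) p := by rw [← coe_aevalAdjoin, hp]
      rw [s.component_gen, h3]
      have h4 : aeval (toEnd γ) (p * X) = aeval (toEnd γ) (X * p) := by rw [mul_comm]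
      rw [map_mul, map_mul, aeval_X] at h4
      rw [h4]
    rw [h1, hf, hφ, gen_smul]
  let u : LinearMap.GeneralLinearGroup K V :=
    LinearMap.GeneralLinearGroup.ofLinearEquiv (LinearEquiv.ofInjectiveEndo g hginj)
  refine isConj_iff.2 ⟨⟨u, hgq⟩, ?_⟩
  rw [mul_inv_eq_iff_eq_mul]
  exact Subtype.ext (Units.ext (LinearMap.ext hcomm))

end Conjugacy

/-! ### Weil restriction: modules over `F ⊗ R` seen over `R` -/

section ScalarEquiv

variable (K F R N : Type u) [CommRing K] [CommRing F] [Algebra K F] [CommRing R] [Algebra K R]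
  [AddCommGroup N] [Module K N] [Module F N] [IsScalarTower K F N]

/-- The isomorphism `(F ⊗[K] R) ⊗[F] N ≃ R ⊗[K] N`. -/
noncomputable def scalarEquiv : (F ⊗[K] R) ⊗[F] N ≃+ R ⊗[K] N :=
  (TensorProduct.comm F (F ⊗[K] R) N).toAddEquiv.trans
    ((AlgebraTensorModule.cancelBaseChange K F F N R).toAddEquiv.trans
      (TensorProduct.comm K N R).toAddEquiv)

variable {K F R N}

theorem scalarEquiv_tmul (f : F) (r : R) (n : N) :
    scalarEquiv K F R N ((f ⊗ₜ r) ⊗ₜ n) = r ⊗ₜ (f • n) := by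
  simp [scalarEquiv]

theorem scalarEquiv_symm_tmul (r : R) (n : N) :
    (scalarEquiv K F R N).symm (r ⊗ₜ n) = (1 ⊗ₜ r) ⊗ₜ n := by
  rw [AddEquiv.symm_apply_eq, scalarEquiv_tmul, one_smul]

-- In `(f ⊗ r) ⊗ n` the scalar `f` can be moved onto `n`, so the tensors with `f = 1` generate
-- additively.
@[elab_as_elim]
theorem scalarEquiv_induction {P : (F ⊗[K] R) ⊗[F] N → Prop} (x : (F ⊗[K] R) ⊗[F] N)
    (zero : P 0) (tmul : ∀ (r : R) (n : N), P ((1 ⊗ₜ r) ⊗ₜ n))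
    (add : ∀ x y, P x → P y → P (x + y)) : P x := by
  obtain ⟨y, rfl⟩ := (scalarEquiv K F R N).symm.surjective x
  induction y with
  | zero => rwa [map_zero]
  | tmul r n => rw [scalarEquiv_symm_tmul]; exact tmul r n
  | add x y hx hy => rw [map_add]; exact add _ _ hx hy

theorem scalarEquiv_smul (f : F) (r : R) (x : (F ⊗[K] R) ⊗[F] N) :
    scalarEquiv K F R N ((f ⊗ₜ r : F ⊗[K] R) • x) =
      r • (Algebra.lsmul K K N f).baseChange R (scalarEquiv K F R N x) := by
  induction x using scalarEquiv_induction with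
  | zero => simp
  | tmul s n =>
    rw [TensorProduct.smul_tmul', smul_eq_mul, Algebra.TensorProduct.tmul_mul_tmul, mul_one,
      scalarEquiv_tmul, scalarEquiv_tmul, one_smul, LinearMap.baseChange_tmul,
      TensorProduct.smul_tmul']
    rfl
  | add x y hx hy => simp only [smul_add, map_add, hx, hy]

theorem scalarEquiv_one_smul (r : R) (x : (F ⊗[K] R) ⊗[F] N) :
    scalarEquiv K F R N ((1 ⊗ₜ r : F ⊗[K] R) • x) = r • scalarEquiv K F R N x := by
  rw [scalarEquiv_smul, map_one]
  congr 1
  induction scalarEquiv K F R N x with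
  | zero => simp
  | tmul s n => simp
  | add x y hx hy => rw [map_add, hx, hy]

theorem scalarEquiv_symm_smul (r : R) (y : R ⊗[K] N) :
    (scalarEquiv K F R N).symm (r • y) = (1 ⊗ₜ r : F ⊗[K] R) • (scalarEquiv K F R N).symm y := by
  rw [AddEquiv.symm_apply_eq, scalarEquiv_one_smul, AddEquiv.apply_symm_apply]

/-- Transport of endomorphisms along `scalarEquiv`. -/
noncomputable def descend :
    Module.End (F ⊗[K] R) ((F ⊗[K] R) ⊗[F] N) →* Module.End R (R ⊗[K] N) where
  toFun p :=
    { toFun := fun y => scalarEquiv K F R N (p ((scalarEquiv K F R N).symm y))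
      map_add' := fun x y => by simp only [map_add]
      map_smul' := fun r y => by
        rw [scalarEquiv_symm_smul, map_smul, scalarEquiv_one_smul, RingHom.id_apply] }
  map_one' := LinearMap.ext fun y => (scalarEquiv K F R N).apply_symm_apply y
  map_mul' p p' := LinearMap.ext fun y => by
    simp only [LinearMap.coe_mk, AddHom.coe_mk, Module.End.mul_apply, AddEquiv.symm_apply_apply]

theorem descend_apply (p : Module.End (F ⊗[K] R) ((F ⊗[K] R) ⊗[F] N))
    (x : (F ⊗[K] R) ⊗[F] N) :
    descend p (scalarEquiv K F R N x) = scalarEquiv K F R N (p x) := by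
  simp [descend]

theorem descend_injective :
    Function.Injective (descend : Module.End (F ⊗[K] R) ((F ⊗[K] R) ⊗[F] N) → _) := by
  intro p p' h
  refine end_ext fun n => ?_
  apply (scalarEquiv K F R N).injective
  change scalarEquiv K F R N (p _) = scalarEquiv K F R N (p' _)
  rw [← descend_apply, h, descend_apply]

theorem descend_commute (p : Module.End (F ⊗[K] R) ((F ⊗[K] R) ⊗[F] N)) (f : F) :
    Commute (descend p) ((Algebra.lsmul K K N f).baseChange R) := by
  refine LinearMap.ext fun y => ?_
  obtain ⟨x, rfl⟩ := (scalarEquiv K F R N).surjective y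
  rw [Module.End.mul_apply, Module.End.mul_apply, descend_apply]
  have h : ∀ x, (Algebra.lsmul K K N f).baseChange R (scalarEquiv K F R N x) =
      scalarEquiv K F R N ((f ⊗ₜ 1 : F ⊗[K] R) • x) := fun x => by
    rw [scalarEquiv_smul, one_smul]
  rw [h, h, descend_apply, map_smul]

/-- With `descend_injective` and `descend_commute`, this identifies the `F ⊗ R`-linear endomorphisms
with the `R`-linear ones commuting with `F`. -/
theorem exists_descend_eq {u : Module.End R (R ⊗[K] N)}
    (hu : ∀ f : F, Commute u ((Algebra.lsmul K K N f).baseChange R)) :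
    ∃ p : Module.End (F ⊗[K] R) ((F ⊗[K] R) ⊗[F] N), descend p = u := by
  refine ⟨
    { toFun := fun x => (scalarEquiv K F R N).symm (u (scalarEquiv K F R N x))
      map_add' := fun x y => by simp only [map_add]
      map_smul' := fun s x => ?_ }, ?_⟩
  · rw [AddEquiv.symm_apply_eq]
    induction s with
    | zero => simp
    | tmul f r =>
      rw [scalarEquiv_smul, map_smul, RingHom.id_apply, scalarEquiv_smul,
        AddEquiv.apply_symm_apply]
      congr 1
      exact LinearMap.congr_fun (hu f).eq _
    | add s t hs ht => simp only [add_smul, map_add, hs, ht, RingHom.id_apply]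
  · refine LinearMap.ext fun y => ?_
    simp [descend]

theorem exists_unit_descend_eq {u : LinearMap.GeneralLinearGroup R (R ⊗[K] N)}
    (hu : ∀ f : F, Commute u.val ((Algebra.lsmul K K N f).baseChange R)) :
    ∃ p : LinearMap.GeneralLinearGroup (F ⊗[K] R) ((F ⊗[K] R) ⊗[F] N),
      descend p.val = u.val := by
  obtain ⟨p, hp⟩ := exists_descend_eq hu
  obtain ⟨p', hp'⟩ := exists_descend_eq fun f => (hu f).units_inv_left
  refine ⟨⟨p, p', descend_injective ?_, descend_injective ?_⟩, hp⟩
  · rw [map_mul, map_one, hp, hp', Units.mul_inv]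
  · rw [map_mul, map_one, hp, hp', Units.inv_mul]

variable {V : Type u} [AddCommGroup V] [Module K V]

/-- The map `(F ⊗[K] R) ⊗[F] N → R ⊗[K] V` obtained from `j : N → V`. -/
noncomputable def scalarMap (j : N →ₗ[K] V) (R : Type u) [CommRing R] [Algebra K R] :
    (F ⊗[K] R) ⊗[F] N →+ R ⊗[K] V :=
  (j.baseChange R).toAddMonoidHom.comp (scalarEquiv K F R N).toAddMonoidHom

theorem scalarMap_apply (j : N →ₗ[K] V) (x : (F ⊗[K] R) ⊗[F] N) :
    scalarMap j R x = j.baseChange R (scalarEquiv K F R N x) := rfl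

/-- The map `F ⊗[K] R → F ⊗[K] T` induced by `R → T`. -/
noncomputable abbrev scalarAlgHom (F : Type u) [CommRing F] [Algebra K F] {T : Type u} [CommRing T]
    [Algebra K T] (f : R →ₐ[K] T) : F ⊗[K] R →ₐ[F] F ⊗[K] T :=
  Algebra.TensorProduct.map (AlgHom.id F F) f

theorem scalarMap_rTensor (j : N →ₗ[K] V) {T : Type u} [CommRing T] [Algebra K T]
    (f : R →ₐ[K] T) (x : (F ⊗[K] R) ⊗[F] N) :
    scalarMap j T ((scalarAlgHom F f).toLinearMap.rTensor N x) =
      f.toLinearMap.rTensor V (scalarMap j R x) := by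
  induction x using scalarEquiv_induction with
  | zero => simp
  | tmul r n => simp [scalarMap_apply, scalarEquiv_tmul]
  | add x y hx hy => simp only [map_add, hx, hy]

/-- This is the naturality of restriction in `R`. Both sides are compatible with scalars from `T`,
so it is enough to compare them on elements `1 ⊗ n` coming from `R`. -/
theorem scalarMap_extendEnd (j : N →ₗ[K] V) {T : Type u} [CommRing T] [Algebra K T]
    (f : R →ₐ[K] T) {p : Module.End (F ⊗[K] R) ((F ⊗[K] R) ⊗[F] N)}
    {g : Module.End R (R ⊗[K] V)} (h : ∀ x, scalarMap j R (p x) = g (scalarMap j R x))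
    (x : (F ⊗[K] T) ⊗[F] N) :
    scalarMap j T (extendEnd (scalarAlgHom F f) p x) = extendEnd f g (scalarMap j T x) := by
  induction x using scalarEquiv_induction with
  | zero => simp
  | tmul t n =>
    have h1 : ((1 ⊗ₜ t : F ⊗[K] T) ⊗ₜ[F] n) = (1 ⊗ₜ t : F ⊗[K] T) • (1 ⊗ₜ[F] n) := by
      rw [TensorProduct.smul_tmul', smul_eq_mul, mul_one]
    have h2 : ∀ y : (F ⊗[K] T) ⊗[F] N,
        scalarMap j T ((1 ⊗ₜ t : F ⊗[K] T) • y) = t • scalarMap j T y := fun y => by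
      rw [scalarMap_apply, scalarEquiv_one_smul, map_smul, scalarMap_apply]
    have h3 : ∀ (U : Type u) [CommRing U] [Algebra K U],
        scalarMap j U ((1 : F ⊗[K] U) ⊗ₜ[F] n) = 1 ⊗ₜ j n := fun U _ _ => by
      rw [Algebra.TensorProduct.one_def, scalarMap_apply, scalarEquiv_tmul, one_smul,
        LinearMap.baseChange_tmul]
    rw [h1, map_smul, h2, h2, map_smul, extendEnd_one_tmul, scalarMap_rTensor, h, h3, h3,
      extendEnd_one_tmul]
  | add x y hx hy => simp only [map_add, hx, hy]

end ScalarEquiv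

/-! ### Extension of quadratic forms to an algebra -/

section QuadraticBaseChange

variable {K V R : Type u} [CommRing K] [AddCommGroup V] [Module K V] [Module.Free K V]
  [CommRing R] [Algebra K R]

theorem quadraticBaseChange_tmul (q : QuadraticForm K V) (r : R) (v : V) :
    quadraticBaseChange q R (r ⊗ₜ v) = r * r * algebraMap K R (q v) := by
  have h : (r ⊗ₜ v : R ⊗[K] V) = r • (1 ⊗ₜ v) := by simp [TensorProduct.smul_tmul']
  rw [h, QuadraticMap.map_smul, quadraticBaseChange_one_tmul, smul_eq_mul]

theorem polar_quadraticBaseChange_tmul (q : QuadraticForm K V) (r s : R) (v w : V) :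
    QuadraticMap.polar (quadraticBaseChange q R) (r ⊗ₜ v) (s ⊗ₜ w) =
      r * s * algebraMap K R (QuadraticMap.polar q v w) := by
  have h : ∀ (r : R) (v : V), (r ⊗ₜ v : R ⊗[K] V) = r • (1 ⊗ₜ v) := fun r v => by
    simp [TensorProduct.smul_tmul']
  rw [h, h s, QuadraticMap.polar_smul_left, QuadraticMap.polar_smul_right, smul_eq_mul,
    smul_eq_mul, mul_assoc]
  congr 2
  simp only [QuadraticMap.polar, ← TensorProduct.tmul_add, quadraticBaseChange_one_tmul, map_sub]

theorem polar_baseChange_apply {q : QuadraticForm K V} {φ ψ : Module.End K V}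
    (h : ∀ x y, QuadraticMap.polar q (φ x) y = QuadraticMap.polar q x (ψ y)) (x y : R ⊗[K] V) :
    QuadraticMap.polar (quadraticBaseChange q R) (φ.baseChange R x) y =
      QuadraticMap.polar (quadraticBaseChange q R) x (ψ.baseChange R y) := by
  induction x with
  | zero => simp
  | tmul r v =>
    induction y with
    | zero => simp
    | tmul s w =>
      rw [LinearMap.baseChange_tmul, LinearMap.baseChange_tmul, polar_quadraticBaseChange_tmul,
        polar_quadraticBaseChange_tmul, h]
    | add x y hx hy => simp only [map_add, QuadraticMap.polar_add_right, hx, hy]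
  | add x y hx hy => simp only [map_add, QuadraticMap.polar_add_left, hx, hy]

end QuadraticBaseChange

/-! ### The centraliser as a product over the summands `V_i` -/

section Components

variable {K V : Type u} [Field K] [AddCommGroup V] [Module K V] {γ : Module.End K V}

namespace FactorIndex

theorem incl_eq_scalarMap (i : FactorIndex γ) (R : Type u) [CommRing R] [Algebra K R]
    (x : (i.F ⊗[K] R) ⊗[i.F] i.space) : i.incl R x = scalarMap i.space.subtype R x := rfl

/-- The inclusion of `W_i` in `V_i`, as a `K`-linear map. -/
noncomputable def WInclusion (i : FactorIndex γ) (φ : i.Splitting) : i.W φ →ₗ[K] i.space :=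
  (i.W φ).subtype.restrictScalars K

theorem incl_lTensor_eq_scalarMap (i : FactorIndex γ) (φ : i.Splitting) (R : Type u) [CommRing R]
    [Algebra K R] (x : (i.F ⊗[K] R) ⊗[i.F] i.W φ) :
    i.incl R ((i.W φ).subtype.lTensor (i.F ⊗[K] R) x) =
      scalarMap (i.space.subtype ∘ₗ i.WInclusion φ) R x := by
  rw [incl_eq_scalarMap]
  induction x using scalarEquiv_induction with
  | zero => simp
  | tmul r n =>
    rw [LinearMap.lTensor_tmul, scalarMap_apply, scalarMap_apply, scalarEquiv_tmul,
      scalarEquiv_tmul, one_smul, one_smul]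
    rfl
  | add x y hx hy => simp only [map_add, hx, hy]

/-- The inclusion of `R ⊗ V_i` in `R ⊗ V`. -/
noncomputable abbrev extIncl (i : FactorIndex γ) (R : Type u) [CommRing R] [Algebra K R] :
    R ⊗[K] i.space →ₗ[R] R ⊗[K] V :=
  i.space.subtype.baseChange R

/-- The restriction to `R ⊗ V_i` of the extension of `q` to `R`. -/
noncomputable def baseForm (q : QuadraticForm K V) (i : FactorIndex γ) (R : Type u) [CommRing R]
    [Algebra K R] : QuadraticForm R (R ⊗[K] i.space) :=
  (quadraticBaseChange q R).comp (i.extIncl R)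

theorem baseForm_apply (q : QuadraticForm K V) (i : FactorIndex γ) (R : Type u) [CommRing R]
    [Algebra K R] (x : R ⊗[K] i.space) :
    baseForm q i R x = quadraticBaseChange q R (i.extIncl R x) := rfl

theorem polar_baseForm (q : QuadraticForm K V) (i : FactorIndex γ) (R : Type u) [CommRing R]
    [Algebra K R] (x y : R ⊗[K] i.space) :
    QuadraticMap.polar (baseForm q i R) x y = QuadraticMap.polar (quadraticBaseChange q R)
      (i.extIncl R x) (i.extIncl R y) := by
  simp only [QuadraticMap.polar, baseForm_apply, map_add]

/-- Multiplication by `a ∈ A_i` on `R ⊗ V_i`. -/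
noncomputable def act (i : FactorIndex γ) (R : Type u) [CommRing R] [Algebra K R] (a : i.A) :
    Module.End R (R ⊗[K] i.space) :=
  (Algebra.lsmul K K i.space a).baseChange R

/-- The automorphisms of the `R ⊗ A_i`-module `R ⊗ V_i` which preserve `q`. -/
noncomputable def isometries (q : QuadraticForm K V) (i : FactorIndex γ) (R : Type u) [CommRing R]
    [Algebra K R] : Subgroup (LinearMap.GeneralLinearGroup R (R ⊗[K] i.space)) :=
  (⨅ a : i.A, commutingGroup (i.act R a)) ⊓ orthogonalGroup (baseForm q i R)

section act

variable (i : FactorIndex γ) (R : Type u) [CommRing R] [Algebra K R]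

theorem act_tmul (a : i.A) (r : R) (v : i.space) : i.act R a (r ⊗ₜ v) = r ⊗ₜ (a • v) := rfl

theorem act_mul (a b : i.A) : i.act R (a * b) = i.act R a * i.act R b :=
  end_ext fun v => by
    rw [Module.End.mul_apply, act_tmul, act_tmul, act_tmul, mul_smul]

theorem act_add (a b : i.A) : i.act R (a + b) = i.act R a + i.act R b :=
  end_ext fun v => by
    rw [LinearMap.add_apply, act_tmul, act_tmul, act_tmul, add_smul, TensorProduct.tmul_add]

theorem act_one : i.act R 1 = 1 :=
  end_ext fun v => by rw [act_tmul, one_smul]; rfl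

theorem act_zero : i.act R 0 = 0 :=
  end_ext fun v => by rw [act_tmul, zero_smul, TensorProduct.tmul_zero]; rfl

theorem act_commute (a b : i.A) : Commute (i.act R a) (i.act R b) := by
  change _ * _ = _ * _
  rw [← act_mul, ← act_mul, mul_comm]

end act

theorem gamma_subtype_baseChange (i : FactorIndex γ) (R : Type u) [CommRing R] [Algebra K R]
    (x : R ⊗[K] i.space) :
    γ.baseChange R (i.extIncl R x) = i.extIncl R (i.act R i.gen x) := by
  induction x with
  | zero => simp
  | tmul r v => simp [act_tmul, gen_smul]
  | add x y hx hy => simp only [map_add] at *; rw [hx, hy]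

theorem mem_isometries {q : QuadraticForm K V} {i : FactorIndex γ} {R : Type u} [CommRing R]
    [Algebra K R] {u : LinearMap.GeneralLinearGroup R (R ⊗[K] i.space)} :
    u ∈ isometries q i R ↔ (∀ a, Commute u.val (i.act R a)) ∧
      ∀ x, baseForm q i R (u.val x) = baseForm q i R x := by
  rw [isometries, Subgroup.mem_inf, Subgroup.mem_iInf]
  rfl

theorem polar_of_mem_isometries {q : QuadraticForm K V} {i : FactorIndex γ} {R : Type u}
    [CommRing R] [Algebra K R] {u : LinearMap.GeneralLinearGroup R (R ⊗[K] i.space)}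
    (hu : u ∈ isometries q i R) (x y : R ⊗[K] i.space) :
    QuadraticMap.polar (baseForm q i R) (u.val x) (u.val y) =
      QuadraticMap.polar (baseForm q i R) x y := by
  simp only [QuadraticMap.polar, ← map_add, (mem_isometries.1 hu).2]

end FactorIndex

open FactorIndex

namespace SemisimpleIsometry

variable [FiniteDimensional K V] {q : QuadraticForm K V} (s : SemisimpleIsometry q γ)
  (i : FactorIndex γ) (R : Type u) [CommRing R] [Algebra K R]

/-- The projection of `V` to `V_i`. -/
noncomputable def proj : V →ₗ[K] i.space :=
  (s.component i 1).codRestrict i.space (s.component_apply_mem i 1)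

theorem coe_proj (v : V) : (s.proj i v : V) = s.component i 1 v := rfl

theorem proj_coe (v : i.space) : s.proj i v = v :=
  Subtype.ext (s.component_one_apply v.2)

/-- The projection of `R ⊗ V` to `R ⊗ V_i`. -/
noncomputable abbrev extProj : R ⊗[K] V →ₗ[R] R ⊗[K] i.space := (s.proj i).baseChange R

theorem proj_subtype_baseChange (x : R ⊗[K] i.space) : s.extProj i R (i.extIncl R x) = x := by
  induction x with
  | zero => simp
  | tmul r v => simp [proj_coe]
  | add x y hx hy => simp only [map_add] at *; rw [hx, hy]

theorem subtype_baseChange_injective (s : SemisimpleIsometry q γ) (i : FactorIndex γ)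
    (R : Type u) [CommRing R] [Algebra K R] : Function.Injective (i.extIncl R) :=
  Function.LeftInverse.injective (s.proj_subtype_baseChange i R)

theorem subtype_proj_baseChange (x : R ⊗[K] V) :
    i.extIncl R (s.extProj i R x) = (s.component i 1).baseChange R x := by
  induction x with
  | zero => simp
  | tmul r v => simp [coe_proj]
  | add x y hx hy => simp only [map_add] at *; rw [hx, hy]

theorem proj_subtype_baseChange_of_ne {i j : FactorIndex γ} (hij : i ≠ j) (x : R ⊗[K] i.space) :
    s.extProj j R (i.extIncl R x) = 0 := by
  induction x with
  | zero => simp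
  | tmul r v =>
    have : s.proj j v = 0 := Subtype.ext (s.component_eq_zero_of_mem hij 1 v.2)
    simp [this]
  | add x y hx hy => simp only [map_add] at *; rw [hx, hy, add_zero]

theorem subtype_act (a : i.A) (x : R ⊗[K] i.space) :
    i.extIncl R (i.act R a x) = (s.component i a).baseChange R (i.extIncl R x) := by
  induction x with
  | zero => simp
  | tmul r v => simp [act_tmul, component_coe]
  | add x y hx hy => simp only [map_add] at *; rw [hx, hy]

theorem sum_subtype_proj_baseChange [Fintype (FactorIndex γ)] (x : R ⊗[K] V) :
    ∑ i : FactorIndex γ, i.extIncl R (s.extProj i R x) = x := by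
  induction x with
  | zero => simp
  | tmul r v =>
    have h := LinearMap.congr_fun s.sum_component_one v
    rw [LinearMap.sum_apply] at h
    simp [coe_proj, ← TensorProduct.tmul_sum, h]
  | add x y hx hy =>
    simp only [map_add, Finset.sum_add_distrib] at *
    rw [hx, hy]

theorem polar_subtype_eq_zero (s : SemisimpleIsometry q γ) (R : Type u) [CommRing R]
    [Algebra K R] {i j : FactorIndex γ} (hij : i ≠ j) (x : R ⊗[K] i.space)
    (y : R ⊗[K] j.space) :
    QuadraticMap.polar (quadraticBaseChange q R) (i.extIncl R x) (j.extIncl R y) = 0 := by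
  induction x with
  | zero => simp
  | tmul r v =>
    induction y with
    | zero => simp
    | tmul r' w =>
      simp [polar_quadraticBaseChange_tmul, s.polar_eq_zero hij v.2 w.2]
    | add x y hx hy =>
      simp only [map_add, QuadraticMap.polar_add_right] at *
      rw [hx, hy, add_zero]
  | add x y hx hy =>
    simp only [map_add, QuadraticMap.polar_add_left] at *
    rw [hx, hy, add_zero]

variable {R}

/-- The components lie in `K[γ]`, so commuting with `γ` suffices. -/
theorem commute_component {g : Module.End R (R ⊗[K] V)} (hg : Commute g (γ.baseChange R))
    (a : i.A) : Commute g ((s.component i a).baseChange R) := by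
  refine Algebra.adjoin_induction (p := fun φ _ => Commute g (φ.baseChange R)) ?_ ?_ ?_ ?_
    (s.component_mem i a)
  · rintro φ rfl
    exact hg
  · intro k
    have h : (algebraMap K (Module.End K V) k).baseChange R =
        algebraMap R (Module.End R (R ⊗[K] V)) (algebraMap K R k) := end_ext fun v => by
      simp [Module.algebraMap_end_apply, TensorProduct.smul_tmul', Algebra.smul_def]
    rw [h]
    exact (Algebra.commutes _ g).symm
  · intro φ ψ _ _ h1 h2
    rw [LinearMap.baseChange_add]
    exact h1.add_right h2
  · intro φ ψ _ _ h1 h2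
    rw [LinearMap.baseChange_mul]
    exact h1.mul_right h2

theorem exists_restriction (s : SemisimpleIsometry q γ) (i : FactorIndex γ)
    {g : LinearMap.GeneralLinearGroup R (R ⊗[K] V)}
    (hg : g ∈ orthogonalGroup (quadraticBaseChange q R))
    (hg' : g ∈ commutingGroup (γ.baseChange R)) :
    ∃ u ∈ isometries q i R, ∀ x, i.extIncl R (u.val x) = g.val (i.extIncl R x) := by
  -- An endomorphism commuting with the projector onto `R ⊗ V_i` maps this submodule to itself, so
  -- projecting afterwards changes nothing.
  have key : ∀ g : Module.End R (R ⊗[K] V), Commute g (γ.baseChange R) →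
      ∀ x, i.extIncl R (s.extProj i R (g (i.extIncl R x))) = g (i.extIncl R x) := fun g hg x => by
    rw [subtype_proj_baseChange]
    have h1 := LinearMap.congr_fun (s.commute_component i hg 1).eq (i.extIncl R x)
    rw [Module.End.mul_apply, Module.End.mul_apply] at h1
    rw [← h1, ← subtype_proj_baseChange, proj_subtype_baseChange]
  have hgc : Commute g.val (γ.baseChange R) := hg'
  let r : Module.End R (R ⊗[K] V) → Module.End R (R ⊗[K] i.space) := fun g =>
    s.extProj i R ∘ₗ g ∘ₗ i.extIncl R
  have hr : ∀ g x, r g x = s.extProj i R (g (i.extIncl R x)) := fun g x => rfl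
  have hmul : ∀ g g' : Module.End R (R ⊗[K] V), Commute g' (γ.baseChange R) → g * g' = 1 →
      r g * r g' = 1 := fun g g' hg' h => LinearMap.ext fun x => by
    rw [Module.End.mul_apply, hr, hr, key g' hg', ← Module.End.mul_apply, h, Module.End.one_apply,
      proj_subtype_baseChange, Module.End.one_apply]
  have hgi : Commute g⁻¹.val (γ.baseChange R) := hgc.units_inv_left
  let u : LinearMap.GeneralLinearGroup R (R ⊗[K] i.space) :=
    ⟨r g.val, r g⁻¹.val, hmul _ _ hgi g.mul_inv, hmul _ _ hgc g.inv_mul⟩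
  have hu : ∀ x, i.extIncl R (u.val x) = g.val (i.extIncl R x) := fun x => key _ hgc x
  refine ⟨u, mem_isometries.2 ⟨fun a => LinearMap.ext fun x => ?_, fun x => ?_⟩, hu⟩
  · apply s.subtype_baseChange_injective i R
    rw [Module.End.mul_apply, Module.End.mul_apply, hu, subtype_act, subtype_act, hu]
    exact LinearMap.congr_fun (s.commute_component i hgc a).eq (i.extIncl R x)
  · rw [baseForm_apply, hu, hg, baseForm_apply]

/-- The block sum of the `u i` is invertible blockwise. It preserves `q` because the summands stay
orthogonal over `R`, and commutes with `γ` because each block commutes with `γ_i`. -/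
theorem exists_glue (s : SemisimpleIsometry q γ)
    (u : ∀ i : FactorIndex γ, LinearMap.GeneralLinearGroup R (R ⊗[K] i.space))
    (hu : ∀ i, u i ∈ isometries q i R) :
    ∃ g : LinearMap.GeneralLinearGroup R (R ⊗[K] V),
      g ∈ orthogonalGroup (quadraticBaseChange q R) ∧ g ∈ commutingGroup (γ.baseChange R) ∧
      ∀ (i : FactorIndex γ) x, i.extIncl R ((u i).val x) = g.val (i.extIncl R x) := by
  let := Fintype.ofFinite (FactorIndex γ)
  let G : (∀ i : FactorIndex γ, Module.End R (R ⊗[K] i.space)) → Module.End R (R ⊗[K] V) :=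
    fun u => ∑ i, i.extIncl R ∘ₗ u i ∘ₗ s.extProj i R
  have hG : ∀ u x, G u x = ∑ i : FactorIndex γ, i.extIncl R (u i (s.extProj i R x)) := fun u x => by
    rw [LinearMap.sum_apply]; rfl
  have hGι : ∀ u (i : FactorIndex γ) x, G u (i.extIncl R x) = i.extIncl R (u i x) := fun u i x => by
    rw [hG, Finset.sum_eq_single i]
    · rw [proj_subtype_baseChange]
    · intro j _ hj
      rw [s.proj_subtype_baseChange_of_ne R hj.symm, map_zero, map_zero]
    · simp
  have hext : ∀ f g : Module.End R (R ⊗[K] V),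
      (∀ (i : FactorIndex γ) x, f (i.extIncl R x) = g (i.extIncl R x)) → f = g :=
    fun f g h => LinearMap.ext fun x => by
      rw [← s.sum_subtype_proj_baseChange R x, map_sum, map_sum]
      exact Finset.sum_congr rfl fun i _ => h i _
  have hmul : ∀ u u' : ∀ i : FactorIndex γ, Module.End R (R ⊗[K] i.space),
      (∀ i, u i * u' i = 1) → G u * G u' = 1 := fun u u' h => hext _ _ fun i x => by
    rw [Module.End.mul_apply, hGι, hGι, ← Module.End.mul_apply, h]
    rfl
  let g : LinearMap.GeneralLinearGroup R (R ⊗[K] V) :=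
    ⟨G fun i => (u i).val, G fun i => (u i)⁻¹.val, hmul _ _ fun i => (u i).mul_inv,
      hmul _ _ fun i => (u i).inv_mul⟩
  refine ⟨g, fun x => ?_, ?_, fun i x => (hGι (fun i => (u i).val) i x).symm⟩
  · change quadraticBaseChange q R (G _ x) = _
    rw [hG, QuadraticMap.map_sum_of_polar_eq_zero]
    · conv_rhs => rw [← s.sum_subtype_proj_baseChange R x]
      rw [QuadraticMap.map_sum_of_polar_eq_zero]
      · exact Finset.sum_congr rfl fun i _ => (mem_isometries.1 (hu i)).2 _
      · exact fun i _ j _ hij => s.polar_subtype_eq_zero R hij _ _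
    · exact fun i _ j _ hij => s.polar_subtype_eq_zero R hij _ _
  · refine hext _ _ fun i x => ?_
    rw [Module.End.mul_apply, Module.End.mul_apply, gamma_subtype_baseChange]
    change G _ _ = γ.baseChange R (G _ _)
    rw [hGι, hGι, gamma_subtype_baseChange]
    exact congrArg _ (LinearMap.congr_fun ((mem_isometries.1 (hu i)).1 i.gen).eq x)

end SemisimpleIsometry

end Components

/-! ### Preserving `q` over `R` versus preserving a form over `F ⊗ R` -/

section ScalarComparison

theorem bilinBaseChange_tmul {K F A R N : Type u} [CommRing K] [CommRing F] [Algebra K F]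
    [CommRing R] [Algebra K R] [CommRing A] [Algebra F A] [AddCommGroup N] [Module F N]
    (B : LinearMap.BilinMap F N A) (r r' : R) (v w : N) :
    B.baseChange (F ⊗[K] R) ((1 ⊗ₜ r) ⊗ₜ v) ((1 ⊗ₜ r') ⊗ₜ w) =
      (1 ⊗ₜ (r * r') : F ⊗[K] R) ⊗ₜ B v w := by
  simp

variable {K F A R N : Type u} [CommRing K] [CommRing F] [Algebra K F] [CommRing R] [Algebra K R]
  [CommRing A] [Algebra K A] [Algebra F A]
  [AddCommGroup N] [Module K N] [Module F N] [Module A N] [IsScalarTower K F N]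
  [IsScalarTower F A N] [IsScalarTower K A N]

theorem scalarEquiv_lsmul (a : A) (x : (F ⊗[K] R) ⊗[F] N) :
    scalarEquiv K F R N ((Algebra.lsmul F F N a).baseChange (F ⊗[K] R) x) =
      (Algebra.lsmul K K N a).baseChange R (scalarEquiv K F R N x) := by
  induction x using scalarEquiv_induction with
  | zero => simp
  | tmul r v =>
    rw [LinearMap.baseChange_tmul, scalarEquiv_tmul, scalarEquiv_tmul, one_smul, one_smul]
    rfl
  | add x y hx hy => simp only [map_add, hx, hy]

theorem commute_lsmul_iff (p : Module.End (F ⊗[K] R) ((F ⊗[K] R) ⊗[F] N))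
    (a : A) : Commute p ((Algebra.lsmul F F N a).baseChange (F ⊗[K] R)) ↔
      Commute (descend p) ((Algebra.lsmul K K N a).baseChange R) := by
  have h : descend ((Algebra.lsmul F F N a).baseChange (F ⊗[K] R)) =
      (Algebra.lsmul K K N a).baseChange R := by
    refine LinearMap.ext fun y => ?_
    obtain ⟨x, rfl⟩ := (scalarEquiv K F R N).surjective y
    rw [descend_apply, scalarEquiv_lsmul]
  rw [← h]
  refine ⟨fun hc => hc.map descend, fun hc => descend_injective ?_⟩
  rw [map_mul, map_mul]
  exact hc

/-- The extension to `R` of a functional `F → K`. -/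
noncomputable def functionalExt (l : F →ₗ[K] K) (R : Type u) [CommRing R] [Algebra K R] :
    F ⊗[K] R →ₗ[K] R :=
  (TensorProduct.lid K R).toLinearMap ∘ₗ l.rTensor R

theorem functionalExt_tmul (l : F →ₗ[K] K) (f : F) (r : R) :
    functionalExt l R (f ⊗ₜ r) = l f • r := by
  simp [functionalExt]

theorem functionalExt_injective [Module.Flat K R] {l : F →ₗ[K] K} (hl : Function.Injective l) :
    Function.Injective (functionalExt l R) :=
  (TensorProduct.lid K R).injective.comp
    (Module.Flat.rTensor_preserves_injective_linearMap _ hl)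

theorem polar_scalarEquiv [Module.Free F N] {Q : QuadraticForm R (R ⊗[K] N)} {b : N → N → K}
    {H : QuadraticForm F N} {l : F →ₗ[K] K}
    (hQ : ∀ (r r' : R) (v w : N),
      QuadraticMap.polar Q (r ⊗ₜ v) (r' ⊗ₜ w) = r * r' * algebraMap K R (b v w))
    (hl : ∀ v w, b v w = l (QuadraticMap.polar H v w))
    (x y : (F ⊗[K] R) ⊗[F] N) :
    QuadraticMap.polar Q (scalarEquiv K F R N x) (scalarEquiv K F R N y) =
      functionalExt l R (QuadraticMap.polar (quadraticBaseChange H (F ⊗[K] R)) x y) := by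
  induction x using scalarEquiv_induction with
  | zero => simp
  | tmul r v =>
    induction y using scalarEquiv_induction with
    | zero => simp
    | tmul r' w =>
      rw [scalarEquiv_tmul, scalarEquiv_tmul, one_smul, one_smul, hQ,
        polar_quadraticBaseChange_tmul, Algebra.TensorProduct.algebraMap_apply,
        Algebra.TensorProduct.tmul_mul_tmul, Algebra.TensorProduct.tmul_mul_tmul,
        functionalExt_tmul, hl, Algebra.smul_def, one_mul, one_mul, mul_one, mul_comm]
      rfl
    | add x y hx hy => simp only [map_add, QuadraticMap.polar_add_right, hx, hy]
  | add x y hx hy => simp only [map_add, QuadraticMap.polar_add_left, hx, hy]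

theorem apply_scalarEquiv [Module.Free F N] {Q : QuadraticForm R (R ⊗[K] N)} {c : N → K}
    {b : N → N → K} {H : QuadraticForm F N} {l : F →ₗ[K] K}
    (hQ : ∀ (r r' : R) (v w : N),
      QuadraticMap.polar Q (r ⊗ₜ v) (r' ⊗ₜ w) = r * r' * algebraMap K R (b v w))
    (hQ' : ∀ (r : R) (v : N), Q (r ⊗ₜ v) = r * r * algebraMap K R (c v))
    (hl : ∀ v w, b v w = l (QuadraticMap.polar H v w)) (hl' : ∀ v, c v = l (H v))
    (x : (F ⊗[K] R) ⊗[F] N) :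
    Q (scalarEquiv K F R N x) =
      functionalExt l R (quadraticBaseChange H (F ⊗[K] R) x) := by
  induction x using scalarEquiv_induction with
  | zero => simp
  | tmul r v =>
    rw [scalarEquiv_tmul, one_smul, hQ', quadraticBaseChange_tmul,
      Algebra.TensorProduct.algebraMap_apply, Algebra.TensorProduct.tmul_mul_tmul,
      Algebra.TensorProduct.tmul_mul_tmul, functionalExt_tmul, hl', Algebra.smul_def, one_mul,
      one_mul, mul_one, mul_comm]
    rfl
  | add x y hx hy =>
    rw [map_add, QuadraticMap.map_add Q, QuadraticMap.map_add (quadraticBaseChange H (F ⊗[K] R)),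
      hx, hy, polar_scalarEquiv hQ hl,
      map_add, map_add]

/-- The group of automorphisms of `R ⊗ N` which commute with `A` and preserve `Q`. -/
def linearIsometries (A : Type u) [CommRing A] [Algebra K A] [Module A N] [IsScalarTower K A N]
    (Q : QuadraticForm R (R ⊗[K] N)) : Subgroup (LinearMap.GeneralLinearGroup R (R ⊗[K] N)) :=
  (⨅ a : A, commutingGroup ((Algebra.lsmul K K N a).baseChange R)) ⊓ orthogonalGroup Q

theorem mem_linearIsometries {Q : QuadraticForm R (R ⊗[K] N)}
    {u : LinearMap.GeneralLinearGroup R (R ⊗[K] N)} :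
    u ∈ linearIsometries A Q ↔
      (∀ a : A, Commute u.val ((Algebra.lsmul K K N a).baseChange R)) ∧
      ∀ x, Q (u.val x) = Q x := by
  rw [linearIsometries, Subgroup.mem_inf, Subgroup.mem_iInf]
  rfl

theorem polar_of_mem_linearIsometries {Q : QuadraticForm R (R ⊗[K] N)}
    {u : LinearMap.GeneralLinearGroup R (R ⊗[K] N)}
    (hu : u ∈ linearIsometries A Q) (x y : R ⊗[K] N) :
    QuadraticMap.polar Q (u.val x) (u.val y) = QuadraticMap.polar Q x y := by
  simp only [QuadraticMap.polar, ← map_add, (mem_linearIsometries.1 hu).2]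

/-- The group of `F ⊗ R`-linear automorphisms of `(F ⊗ R) ⊗ N` preserving `H`. -/
noncomputable abbrev orthogonalPoints [Module.Free F N] (H : QuadraticForm F N) (S : Type u)
    [CommRing S] [Algebra F S] : Subgroup (LinearMap.GeneralLinearGroup S (S ⊗[F] N)) :=
  orthogonalGroup (quadraticBaseChange H S)

/-- The group of `S ⊗ A`-linear automorphisms of `S ⊗ N` preserving `B`. -/
noncomputable abbrev unitaryPoints (B : LinearMap.BilinMap F N A) (S : Type u)
    [CommRing S] [Algebra F S] : Subgroup (LinearMap.GeneralLinearGroup S (S ⊗[F] N)) :=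
  (⨅ a : A, commutingGroup ((Algebra.lsmul F F N a).baseChange S)) ⊓
      isometryGroup (B.baseChange S)

/-- `Q` is the image of `H` under the extension of `l`, which stays injective by flatness. Since `F`
surjects onto `A`, commuting with `A` is automatic for `F`-linear maps. -/
theorem descend_mem_iff_orthogonal [Module.Flat K R] [Module.Free F N]
    {Q : QuadraticForm R (R ⊗[K] N)} {c : N → K} {b : N → N → K} {H : QuadraticForm F N}
    {l : F →ₗ[K] K} (hA : Function.Surjective (algebraMap F A))
    (hQ : ∀ (r r' : R) (v w : N),
      QuadraticMap.polar Q (r ⊗ₜ v) (r' ⊗ₜ w) = r * r' * algebraMap K R (b v w))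
    (hQ' : ∀ (r : R) (v : N), Q (r ⊗ₜ v) = r * r * algebraMap K R (c v))
    (hl : ∀ v w, b v w = l (QuadraticMap.polar H v w)) (hl' : ∀ v, c v = l (H v))
    (hinj : Function.Injective l)
    (p : LinearMap.GeneralLinearGroup (F ⊗[K] R) ((F ⊗[K] R) ⊗[F] N)) :
    Units.map descend p ∈ linearIsometries A Q ↔ p ∈ orthogonalPoints H (F ⊗[K] R) := by
  rw [mem_linearIsometries]
  constructor
  · rintro ⟨-, h⟩ x
    have h1 := h (scalarEquiv K F R N x)
    rw [Units.coe_map] at h1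
    change Q (descend p.val _) = _ at h1
    rw [descend_apply, apply_scalarEquiv hQ hQ' hl hl', apply_scalarEquiv hQ hQ' hl hl'] at h1
    exact functionalExt_injective hinj h1
  · refine fun h => ⟨fun a => ?_, fun y => ?_⟩
    · obtain ⟨f, rfl⟩ := hA a
      have h1 : (Algebra.lsmul K K N (algebraMap F A f)).baseChange R =
          (Algebra.lsmul K K N f).baseChange R := by
        congr 1
        exact LinearMap.ext fun v => algebraMap_smul A f v
      rw [h1]
      exact descend_commute p.val f
    · obtain ⟨x, rfl⟩ := (scalarEquiv K F R N).surjective y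
      change Q (descend p.val _) = _
      rw [descend_apply, apply_scalarEquiv hQ hQ' hl hl', apply_scalarEquiv hQ hQ' hl hl']
      exact congrArg _ (h x)

variable [IsScalarTower K F A]

/-- The expansion of `B` in values of the polar form persists after extension to `R`. Hence
`A`-linear isometries of `Q` preserve `B`. -/
theorem scalarEquiv_bilinBaseChange {κ : Type} [Fintype κ] {a b : κ → A}
    {B : LinearMap.BilinMap F N A} {Q : QuadraticForm R (R ⊗[K] N)} {β : N → N → K}
    (hQ : ∀ (r r' : R) (v w : N),
      QuadraticMap.polar Q (r ⊗ₜ v) (r' ⊗ₜ w) = r * r' * algebraMap K R (β v w))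
    (hB : ∀ v w, B v w = ∑ k, β (a k • v) w • b k) (x y : (F ⊗[K] R) ⊗[F] N) :
    scalarEquiv K F R A (B.baseChange (F ⊗[K] R) x y) =
      ∑ k, QuadraticMap.polar Q
        ((Algebra.lsmul K K N (a k)).baseChange R (scalarEquiv K F R N x))
        (scalarEquiv K F R N y) ⊗ₜ b k := by
  induction x using scalarEquiv_induction with
  | zero => simp
  | tmul r v =>
    induction y using scalarEquiv_induction with
    | zero => simp
    | tmul r' w =>
      rw [bilinBaseChange_tmul, scalarEquiv_tmul, one_smul, scalarEquiv_tmul, scalarEquiv_tmul,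
        one_smul, one_smul, hB, TensorProduct.tmul_sum]
      refine Finset.sum_congr rfl fun k _ => ?_
      rw [LinearMap.baseChange_tmul, hQ, TensorProduct.tmul_smul, TensorProduct.smul_tmul',
        Algebra.smul_def, mul_comm]
      rfl
    | add x y hx hy =>
      simp only [map_add, QuadraticMap.polar_add_right, hx, hy, TensorProduct.add_tmul,
        Finset.sum_add_distrib]
  | add x y hx hy =>
    simp only [map_add, QuadraticMap.polar_add_left, hx, hy, TensorProduct.add_tmul,
      Finset.sum_add_distrib, LinearMap.add_apply]

/-- The extension to `R` of a functional `A → K`. -/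
noncomputable def functionalExt' (l : A →ₗ[K] K) (R : Type u) [CommRing R] [Algebra K R] :
    R ⊗[K] A →ₗ[K] R :=
  (TensorProduct.rid K R).toLinearMap ∘ₗ l.lTensor R

theorem functionalExt'_tmul (l : A →ₗ[K] K) (a : A) (r : R) :
    functionalExt' l R (r ⊗ₜ a) = l a • r := by
  simp [functionalExt']

/-- With the next lemma, this recovers `Q` from `B` through a functional `l` for which `Q(v) =
l(B(v, v))`, so that no division by two is needed. -/
theorem polar_eq_bilinBaseChange {B : LinearMap.BilinMap F N A} {Q : QuadraticForm R (R ⊗[K] N)}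
    {β : N → N → K} {l : A →ₗ[K] K}
    (hQ : ∀ (r r' : R) (v w : N),
      QuadraticMap.polar Q (r ⊗ₜ v) (r' ⊗ₜ w) = r * r' * algebraMap K R (β v w))
    (hB : ∀ v w, β v w = l (B v w) + l (B w v)) (x y : (F ⊗[K] R) ⊗[F] N) :
    QuadraticMap.polar Q (scalarEquiv K F R N x) (scalarEquiv K F R N y) =
      functionalExt' l R (scalarEquiv K F R A (B.baseChange (F ⊗[K] R) x y)) +
        functionalExt' l R (scalarEquiv K F R A (B.baseChange (F ⊗[K] R) y x)) := by
  induction x using scalarEquiv_induction with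
  | zero => simp
  | tmul r v =>
    induction y using scalarEquiv_induction with
    | zero => simp
    | tmul r' w =>
      rw [bilinBaseChange_tmul, bilinBaseChange_tmul, scalarEquiv_tmul, scalarEquiv_tmul,
        scalarEquiv_tmul, scalarEquiv_tmul, one_smul, one_smul, one_smul, one_smul,
        functionalExt'_tmul, functionalExt'_tmul, mul_comm r' r, ← add_smul, ← hB, hQ,
        Algebra.smul_def, mul_comm]
    | add x y hx hy =>
      simp only [map_add, QuadraticMap.polar_add_right, hx, hy, LinearMap.add_apply]
      abel
  | add x y hx hy =>
    simp only [map_add, QuadraticMap.polar_add_left, hx, hy, LinearMap.add_apply]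
    abel

theorem apply_eq_bilinBaseChange {B : LinearMap.BilinMap F N A} {Q : QuadraticForm R (R ⊗[K] N)}
    {c : N → K} {β : N → N → K} {l : A →ₗ[K] K}
    (hQ : ∀ (r r' : R) (v w : N),
      QuadraticMap.polar Q (r ⊗ₜ v) (r' ⊗ₜ w) = r * r' * algebraMap K R (β v w))
    (hQ' : ∀ (r : R) (v : N), Q (r ⊗ₜ v) = r * r * algebraMap K R (c v))
    (hB : ∀ v w, β v w = l (B v w) + l (B w v)) (hB' : ∀ v, c v = l (B v v))
    (x : (F ⊗[K] R) ⊗[F] N) :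
    Q (scalarEquiv K F R N x) =
      functionalExt' l R (scalarEquiv K F R A (B.baseChange (F ⊗[K] R) x x)) := by
  induction x using scalarEquiv_induction with
  | zero => simp
  | tmul r v =>
    rw [bilinBaseChange_tmul, scalarEquiv_tmul, scalarEquiv_tmul, one_smul, one_smul,
      functionalExt'_tmul, ← hB', hQ', Algebra.smul_def, mul_comm]
  | add x y hx hy =>
    rw [map_add, QuadraticMap.map_add Q, hx, hy, polar_eq_bilinBaseChange hQ hB]
    simp only [map_add, LinearMap.add_apply]
    abel

/-- `hab` expresses `B` through the polar form of `Q`, giving one direction. `hB` and `hB'` express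
`Q` through `B`, giving the other. -/
theorem descend_mem_iff_unitary {κ : Type} [Fintype κ] {a b : κ → A}
    {B : LinearMap.BilinMap F N A} {Q : QuadraticForm R (R ⊗[K] N)} {c : N → K}
    {β : N → N → K} {l : A →ₗ[K] K}
    (hQ : ∀ (r r' : R) (v w : N),
      QuadraticMap.polar Q (r ⊗ₜ v) (r' ⊗ₜ w) = r * r' * algebraMap K R (β v w))
    (hQ' : ∀ (r : R) (v : N), Q (r ⊗ₜ v) = r * r * algebraMap K R (c v))
    (hab : ∀ v w, B v w = ∑ k, β (a k • v) w • b k)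
    (hB : ∀ v w, β v w = l (B v w) + l (B w v)) (hB' : ∀ v, c v = l (B v v))
    (p : LinearMap.GeneralLinearGroup (F ⊗[K] R) ((F ⊗[K] R) ⊗[F] N)) :
    Units.map descend p ∈ linearIsometries A Q ↔ p ∈ unitaryPoints B (F ⊗[K] R) := by
  rw [Subgroup.mem_inf, Subgroup.mem_iInf]
  have hcomm : (∀ a : A, Commute (Units.map descend p).val
      ((Algebra.lsmul K K N a).baseChange R)) ↔
      ∀ a : A, p ∈ commutingGroup ((Algebra.lsmul F F N a).baseChange (F ⊗[K] R)) :=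
    forall_congr' fun a => (commute_lsmul_iff p.val a).symm
  constructor
  · refine fun hu => ⟨hcomm.1 (mem_linearIsometries.1 hu).1, fun x y => ?_⟩
    apply (scalarEquiv K F R A).injective
    rw [scalarEquiv_bilinBaseChange hQ hab, scalarEquiv_bilinBaseChange hQ hab]
    refine Finset.sum_congr rfl fun k _ => ?_
    congr 1
    have h3 : descend p.val ((Algebra.lsmul K K N (a k)).baseChange R (scalarEquiv K F R N x)) =
        (Algebra.lsmul K K N (a k)).baseChange R (descend p.val (scalarEquiv K F R N x)) :=
      LinearMap.congr_fun ((mem_linearIsometries.1 hu).1 (a k)).eq _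
    rw [← descend_apply, ← descend_apply, ← h3]
    exact polar_of_mem_linearIsometries hu _ _
  · rintro ⟨h1, h2⟩
    refine mem_linearIsometries.2 ⟨hcomm.2 h1, fun y => ?_⟩
    obtain ⟨x, rfl⟩ := (scalarEquiv K F R N).surjective y
    change Q (descend p.val _) = _
    rw [descend_apply, apply_eq_bilinBaseChange hQ hQ' hB hB',
      apply_eq_bilinBaseChange hQ hQ' hB hB', h2]

end ScalarComparison

/-! ### Isometries of a sum of two isotropic submodules in duality -/

section IsotropicSplitting

variable {R X : Type*} [CommRing R] [AddCommGroup X] [Module R X]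

/-- Complementary projectors `ε`, `ε'` onto totally isotropic submodules in perfect duality. -/
structure IsotropicSplitting (Q : QuadraticForm R X) (ε ε' : Module.End R X) : Prop where
  add_eq : ε + ε' = 1
  mul_eq : ε * ε' = 0
  mul_eq' : ε' * ε = 0
  left : ∀ x, Q (ε x) = 0
  right : ∀ x, Q (ε' x) = 0
  adj : ∀ x y, QuadraticMap.polar Q (ε x) y = QuadraticMap.polar Q x (ε' y)
  dual : ∃ (κ : Type) (_ : Fintype κ) (w w' : κ → X),
    (∀ x, ε x = ∑ k, QuadraticMap.polar Q x (w' k) • w k) ∧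
    (∀ x, ε' x = ∑ k, QuadraticMap.polar Q (w k) x • w' k) ∧ ∀ k, ε' (w' k) = w' k

namespace IsotropicSplitting

variable {Q : QuadraticForm R X} {ε ε' : Module.End R X}

/-- The dual families show that an element of the image of `ε'` is determined by its pairings. -/
theorem ext_right (h : IsotropicSplitting Q ε ε') {S S' : Module.End R X} (hS : ε' * S = S)
    (hS' : ε' * S' = S') (H : ∀ x y, QuadraticMap.polar Q x (S y) = QuadraticMap.polar Q x (S' y)) :
    S = S' := by
  obtain ⟨κ, _, w, w', -, h2, -⟩ := h.dual
  rw [← hS, ← hS']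
  refine LinearMap.ext fun y => ?_
  rw [Module.End.mul_apply, Module.End.mul_apply, h2, h2]
  exact Finset.sum_congr rfl fun k _ => by rw [H]

theorem mul_self (h : IsotropicSplitting Q ε ε') : ε * ε = ε := by
  have h1 : ε * (ε + ε') = ε := by rw [h.add_eq, mul_one]
  rwa [mul_add, h.mul_eq, add_zero] at h1

theorem mul_self' (h : IsotropicSplitting Q ε ε') : ε' * ε' = ε' := by
  have h1 : ε' * (ε + ε') = ε' := by rw [h.add_eq, mul_one]
  rwa [mul_add, h.mul_eq', zero_add] at h1

/-- The dual families give the adjoint explicitly as `y ↦ ∑ k, B_Q(T w_k, y) w'_k`, over any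
commutative ring. -/
theorem exists_adjoint (h : IsotropicSplitting Q ε ε') {T : Module.End R X} (hT : T * ε = T)
    (hT' : ε * T = T) : ∃ S : Module.End R X, ε' * S = S ∧ S * ε' = S ∧
      ∀ x y, QuadraticMap.polar Q (T x) y = QuadraticMap.polar Q x (S y) := by
  obtain ⟨κ, _, w, w', h1, -, h3⟩ := h.dual
  let S : Module.End R X :=
    ∑ k, (LinearMap.toSpanSingleton R X (w' k)) ∘ₗ Q.polarBilin (T (w k))
  have hS : ∀ y, S y = ∑ k, QuadraticMap.polar Q (T (w k)) y • w' k := fun y => by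
    rw [LinearMap.sum_apply]; rfl
  have hεT : ∀ x, ε (T x) = T x := LinearMap.congr_fun hT'
  refine ⟨S, LinearMap.ext fun y => ?_, LinearMap.ext fun y => ?_, fun x y => ?_⟩
  · rw [Module.End.mul_apply, hS, map_sum]
    exact Finset.sum_congr rfl fun k _ => by rw [map_smul, h3]
  · rw [Module.End.mul_apply, hS, hS]
    exact Finset.sum_congr rfl fun k _ => by rw [← h.adj, hεT]
  · have h4 : T x = ∑ k, QuadraticMap.polar Q x (w' k) • T (w k) := by
      conv_lhs => rw [← hT, Module.End.mul_apply, h1, map_sum]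
      exact Finset.sum_congr rfl fun k _ => by rw [map_smul]
    rw [h4, hS, ← QuadraticMap.polarBilin_apply_apply, ← QuadraticMap.polarBilin_apply_apply,
      map_sum, map_sum, LinearMap.sum_apply]
    refine Finset.sum_congr rfl fun k _ => ?_
    rw [map_smul, map_smul, LinearMap.smul_apply, smul_eq_mul, smul_eq_mul, mul_comm]
    rfl

/-- The extension is `U = T + S'`, where `S'` is the adjoint of the inverse `T'` of `T`: the
contragredient action on the image of `ε'`. Commutation of `T'` with `c'`, the adjoint of `c`,
passes to commutation of `S'` with `c`. -/
theorem exists_extension (h : IsotropicSplitting Q ε ε') {T T' : Module.End R X}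
    (h1 : T * ε = T) (h2 : ε * T = T) (h1' : T' * ε = T') (h2' : ε * T' = T') (h3 : T * T' = ε)
    (h3' : T' * T = ε) : ∃ U : LinearMap.GeneralLinearGroup R X, U.val * ε = T ∧
      (∀ x, Q (U.val x) = Q x) ∧
      ∀ c c' : Module.End R X,
        (∀ x y, QuadraticMap.polar Q (c' x) y = QuadraticMap.polar Q x (c y)) →
        Commute ε' c → Commute T c → Commute T' c' → Commute U.val c := by
  obtain ⟨S, hS1, hS2, hS⟩ := h.exists_adjoint h1 h2
  obtain ⟨S', hS1', hS2', hS'⟩ := h.exists_adjoint h1' h2'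
  have hzero : ∀ {A B : Module.End R X}, A * ε = A → ε' * B = B → A * B = 0 := fun hA hB => by
    rw [← hA, ← hB, mul_assoc, ← mul_assoc ε, h.mul_eq, zero_mul, mul_zero]
  have hzero' : ∀ {A B : Module.End R X}, A * ε' = A → ε * B = B → A * B = 0 := fun hA hB => by
    rw [← hA, ← hB, mul_assoc, ← mul_assoc ε', h.mul_eq', zero_mul, mul_zero]
  have key : ∀ {A A' B B' : Module.End R X}, ε' * B = B → ε' * B' = B' → A * A' = ε →
      (∀ x y, QuadraticMap.polar Q (A x) y = QuadraticMap.polar Q x (B y)) →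
      (∀ x y, QuadraticMap.polar Q (A' x) y = QuadraticMap.polar Q x (B' y)) →
      B' * B = ε' := fun {A A' B B'} hB hB' hA h4 h5 => by
    refine h.ext_right (by rw [← mul_assoc, hB']) h.mul_self' fun x y => ?_
    rw [Module.End.mul_apply, ← h5, ← h4, ← Module.End.mul_apply, hA, h.adj]
  let U : LinearMap.GeneralLinearGroup R X := ⟨T + S', T' + S, by
      rw [mul_add, add_mul, add_mul, h3, hzero h1 hS1, hzero' hS2' h2',
        key hS1 hS1' h3 hS hS', add_zero, zero_add, h.add_eq], by
      rw [mul_add, add_mul, add_mul, h3', hzero h1' hS1', hzero' hS2 h2,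
        key hS1' hS1 h3' hS' hS, add_zero, zero_add, h.add_eq]⟩
  have hU : U.val = T + S' := rfl
  refine ⟨U, ?_, fun x => ?_, fun c c' hc h5 h6 h7 => ?_⟩
  · rw [hU, add_mul, h1, hzero' hS2' h.mul_self, add_zero]
  · have hTx : T x = ε (T x) := (LinearMap.congr_fun h2 x).symm
    have hSx : S' x = ε' (S' x) := (LinearMap.congr_fun hS1' x).symm
    have hx : x = ε x + ε' x := by
      rw [← LinearMap.add_apply, h.add_eq]; rfl
    -- As both summands are isotropic, only the cross term survives, and `T' * T = ε` reduces it to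
    -- that of `x`.
    have e1 : Q (U.val x) = QuadraticMap.polar Q (ε x) x := by
      rw [hU, LinearMap.add_apply, QuadraticMap.map_add Q, ← hS', ← Module.End.mul_apply, h3', hTx,
        hSx, h.left, h.right, zero_add, zero_add]
    have e2 : Q x = QuadraticMap.polar Q (ε x) x := by
      conv_lhs => rw [hx]
      rw [QuadraticMap.map_add Q, h.left, h.right, zero_add, zero_add, ← h.adj,
        ← Module.End.mul_apply, h.mul_self]
    rw [e1, e2]
  · rw [hU]
    refine h6.add_left (h.ext_right ?_ ?_ fun x y => ?_)
    · rw [← mul_assoc, hS1']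
    · rw [← mul_assoc, h5.eq, mul_assoc, hS1']
    · rw [Module.End.mul_apply, Module.End.mul_apply, ← hS', ← hc, ← Module.End.mul_apply, ← h7.eq,
        Module.End.mul_apply, hS', hc]

/-- If `U` fixes the image of `ε` and preserves the pairing, its action on the image of `ε'` is
forced by duality. -/
theorem eq_one_of_mul_eq (h : IsotropicSplitting Q ε ε') {U : Module.End R X}
    (hU : ∀ x y, QuadraticMap.polar Q (U x) (U y) = QuadraticMap.polar Q x y)
    (hε' : Commute U ε') (h1 : U * ε = ε) : U = 1 := by
  have h2 : U * ε' = ε' := by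
    refine h.ext_right (by rw [hε'.eq, ← mul_assoc, h.mul_self']) h.mul_self' fun x y => ?_
    have h3 : (U * ε') y = ε' (U (ε' y)) := by
      rw [← Module.End.mul_apply, ← Module.End.mul_apply, ← hε'.eq, mul_assoc,
        h.mul_self']
    rw [h3, ← h.adj, ← LinearMap.congr_fun h1 x, Module.End.mul_apply, hU, h.adj,
      ← Module.End.mul_apply, h.mul_self']
  rw [← mul_one U, ← h.add_eq, mul_add, h1, h2]

end IsotropicSplitting

end IsotropicSplitting

/-! ### The isometry group of a single summand -/

section Indices

variable {K V : Type u} [Field K] [AddCommGroup V] [Module K V] {γ : Module.End K V}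
  {q : QuadraticForm K V}

namespace FactorIndex

variable {i : FactorIndex γ} {R : Type u} [CommRing R] [Algebra K R]

theorem baseForm_tmul (r : R) (v : i.space) :
    baseForm q i R (r ⊗ₜ v) = r * r * algebraMap K R (q (v : V)) :=
  quadraticBaseChange_tmul q r (v : V)

theorem polar_baseForm_tmul (r r' : R) (v w : i.space) :
    QuadraticMap.polar (baseForm q i R) (r ⊗ₜ v) (r' ⊗ₜ w) =
      r * r' * algebraMap K R (QuadraticMap.polar q (v : V) w) := by
  rw [polar_baseForm]
  exact polar_quadraticBaseChange_tmul q r r' (v : V) w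

theorem descend_mem_isometries_iff_of_isTriv (hi : i.IsTriv) {H : i.Herm}
    (hH : i.IsTraceForm q H)
    (p : LinearMap.GeneralLinearGroup (i.F ⊗[K] R) ((i.F ⊗[K] R) ⊗[i.F] i.space)) :
    Units.map descend p ∈ isometries q i R ↔ p ∈ orthogonalPoints H.form (i.F ⊗[K] R) := by
  refine descend_mem_iff_orthogonal (K := K) (F := i.F) (A := i.A) (R := R) (N := i.space)
    (Q := baseForm q i R) (c := fun v : i.space => q (v : V))
    (b := fun v w : i.space => QuadraticMap.polar q (v : V) w) (H := H.form)
    (l := Algebra.trace K i.F)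
    (fun a => ⟨⟨a, congrFun (tau_eq_id_of_gen_sq hi.1) a⟩, rfl⟩)
    polar_baseForm_tmul baseForm_tmul (fun v w => polar_eq_of_isTraceForm hH v w) hH
    (fun f f' h => ?_) p
  rw [← algebraMap_trace_of_isTriv hi f, h, algebraMap_trace_of_isTriv hi]

/-- The functional used is `l(a) = tr(α a)`. As `α + τ(α) = 1`, it sends `B_i(v, v)` to `Tr(h_i(v))
= q(v)`, and its values at `B_i(v, w)` and `B_i(w, v)` add up to `B_q(v, w)`. -/
theorem descend_mem_isometries_iff (hγ : AbsolutelySemisimple γ) (hi : i.gen ^ 2 ≠ 1)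
    {H : i.Herm} (hH : i.IsTraceForm q H)
    (p : LinearMap.GeneralLinearGroup (i.F ⊗[K] R) ((i.F ⊗[K] R) ⊗[i.F] i.space)) :
    Units.map descend p ∈ isometries q i R ↔ p ∈ unitaryPoints H.sesq (i.F ⊗[K] R) := by
  obtain ⟨κ, _, a, b, hab⟩ := exists_dual_basis hγ hi
  obtain ⟨α, hα⟩ := exists_half hγ hi
  refine descend_mem_iff_unitary (K := K) (F := i.F) (A := i.A) (R := R) (N := i.space)
    (a := a) (b := b) (B := H.sesq) (Q := baseForm q i R) (c := fun v : i.space => q (v : V))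
    (β := fun v w : i.space => QuadraticMap.polar q (v : V) w)
    (l := i.tr ∘ₗ LinearMap.mulLeft K α)
    polar_baseForm_tmul baseForm_tmul (fun v w => ?_) (fun v w => ?_) (fun v => ?_) p
  · rw [hab (H.sesq v w)]
    exact Finset.sum_congr rfl fun k _ => by rw [tr_mul_sesq hi hH]
  · change _ = i.tr (α * H.sesq v w) + i.tr (α * H.sesq w v)
    have h1 : i.tr (α * H.sesq w v) = i.tr (i.tau α * H.sesq v w) := by
      rw [← tr_tau, map_mul, H.symm]
    rw [h1, ← map_add, ← add_mul, hα, tr_mul_sesq hi hH, one_smul]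
  · change _ = i.tr (α * H.sesq v v)
    rw [hH, tr_apply]
    congr 1
    refine Subtype.ext ?_
    rw [coe_relTrace, map_mul, H.symm, ← add_mul, hα, one_mul, coe_form hi]

end FactorIndex

end Indices

section Indices

variable {K V : Type u} [Field K] [AddCommGroup V] [Module K V] {γ : Module.End K V}
  {q : QuadraticForm K V}

namespace FactorIndex

variable {i : FactorIndex γ} {R : Type u} [CommRing R] [Algebra K R]

theorem polar_act [FiniteDimensional K V] (s : SemisimpleIsometry q γ) (a : i.A)
    (x y : R ⊗[K] i.space) :
    QuadraticMap.polar (baseForm q i R) (i.act R a x) y =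
      QuadraticMap.polar (baseForm q i R) x (i.act R (i.tau a) y) := by
  rw [polar_baseForm, polar_baseForm, s.subtype_act, s.subtype_act]
  exact polar_baseChange_apply (s.polar_component i a) _ _

/-- The idempotent `(1, 0)` of `A_i`, for a split index `i`. -/
noncomputable def idem (φ : i.Splitting) : i.A := φ.1.symm (1, 0)

/-- The idempotent `(0, 1)` of `A_i`, for a split index `i`. -/
noncomputable def idem' (φ : i.Splitting) : i.A := φ.1.symm (0, 1)

theorem tau_idem (φ : i.Splitting) : i.tau (idem φ) = idem' φ := by
  apply φ.1.injective
  rw [φ.2, idem, idem', AlgEquiv.apply_symm_apply, AlgEquiv.apply_symm_apply]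
  rfl

theorem tau_idem' (φ : i.Splitting) : i.tau (idem' φ) = idem φ := by
  rw [← tau_idem, tau_tau]

theorem idem_add (φ : i.Splitting) : idem φ + idem' φ = 1 := by
  rw [idem, idem', ← map_add]
  simp [← Prod.one_eq_mk]

theorem idem_mul (φ : i.Splitting) : idem φ * idem' φ = 0 := by
  rw [idem, idem', ← map_mul]
  simp

theorem idem_mul_self (φ : i.Splitting) : idem φ * idem φ = idem φ := by
  rw [idem, ← map_mul]
  simp

theorem idem_mul_eq_smul (φ : i.Splitting) (a : i.A) : idem φ * a = (φ.1 a).1 • idem φ := by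
  apply φ.1.injective
  rw [map_mul, map_smul, idem, AlgEquiv.apply_symm_apply]
  ext <;> simp

theorem idem_smul_of_mem_W (φ : i.Splitting) (w : i.W φ) : idem φ • (w : i.space) = w := by
  have h : idem' φ • (w : i.space) = 0 := w.2
  rw [← one_smul i.A (w : i.space), ← idem_add φ, add_smul, h, add_zero, ← mul_smul, idem_mul_self]

theorem idem_smul_mem_W (φ : i.Splitting) (v : i.space) : idem φ • v ∈ i.W φ := by
  change idem' φ • idem φ • v = 0
  rw [← mul_smul, mul_comm, idem_mul, zero_smul]

/-- The projection of `V_i` to `W_i`. -/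
noncomputable def WProj (φ : i.Splitting) : i.space →ₗ[K] i.W φ where
  toFun v := ⟨idem φ • v, idem_smul_mem_W φ v⟩
  map_add' _ _ := Subtype.ext (smul_add _ _ _)
  map_smul' _ _ := Subtype.ext (smul_comm _ _ _)

theorem WProj_baseChange_WInclusion (φ : i.Splitting) (y : R ⊗[K] i.W φ) :
    (WProj φ).baseChange R ((i.WInclusion φ).baseChange R y) = y := by
  induction y with
  | zero => simp
  | tmul r w =>
    have h : WProj φ (i.WInclusion φ w) = w := Subtype.ext (idem_smul_of_mem_W φ w)
    rw [LinearMap.baseChange_tmul, LinearMap.baseChange_tmul, h]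
  | add x y hx hy => simp only [map_add, hx, hy]

theorem WInclusion_baseChange_WProj (φ : i.Splitting) (x : R ⊗[K] i.space) :
    (i.WInclusion φ).baseChange R ((WProj φ).baseChange R x) = i.act R (idem φ) x := by
  induction x with
  | zero => simp
  | tmul r v => rfl
  | add x y hx hy => simp only [map_add, hx, hy]

theorem act_WInclusion (φ : i.Splitting) (a : i.A) (y : R ⊗[K] i.W φ) :
    i.act R a ((i.WInclusion φ).baseChange R y) = (i.WInclusion φ).baseChange R
      ((Algebra.lsmul K K (i.W φ) (φ.1 a).1).baseChange R y) := by
  induction y with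
  | zero => simp
  | tmul r w =>
    have h : a • i.WInclusion φ w = i.WInclusion φ (Algebra.lsmul K K (i.W φ) (φ.1 a).1 w) := by
      change a • (w : i.space) = (φ.1 a).1 • (w : i.space)
      conv_lhs => rw [← idem_smul_of_mem_W φ w, ← mul_smul, mul_comm, idem_mul_eq_smul]
      rw [smul_assoc, idem_smul_of_mem_W]
    rw [LinearMap.baseChange_tmul, act_tmul, h]
    rfl
  | add x y hx hy => simp only [map_add, hx, hy]

theorem WProj_act (φ : i.Splitting) (a : i.A) (x : R ⊗[K] i.space) :
    (WProj φ).baseChange R (i.act R a x) =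
      (Algebra.lsmul K K (i.W φ) (φ.1 a).1).baseChange R ((WProj φ).baseChange R x) := by
  induction x with
  | zero => simp
  | tmul r v =>
    have h : WProj φ (a • v) = Algebra.lsmul K K (i.W φ) (φ.1 a).1 (WProj φ v) := Subtype.ext (by
      change idem φ • a • v = (φ.1 a).1 • idem φ • v
      rw [← mul_smul, idem_mul_eq_smul, smul_assoc])
    rw [act_tmul, LinearMap.baseChange_tmul, h]
    rfl
  | add x y hx hy => simp only [map_add, hx, hy]

/-- By orthogonality such a `v` lies in the radical of the polar form on all of `V`, so `γ v = v`.
But `γ_i - 1` is a unit. -/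
theorem eq_zero_of_polar_eq_zero [FiniteDimensional K V] (s : SemisimpleIsometry q γ)
    (hi : i.gen ^ 2 ≠ 1) {v : i.space}
    (hv : ∀ w : i.space, QuadraticMap.polar q (v : V) w = 0) : v = 0 := by
  have h1 : γ (v : V) = v := s.apply_eq_self_of_polar_eq_zero fun w => by
    rw [← s.component_one_apply v.2, s.polar_component, map_one]
    exact hv ⟨_, s.component_apply_mem i 1 w⟩
  have h2 : (i.gen - 1) • v = 0 := by
    rw [sub_smul, one_smul, sub_eq_zero]
    exact Subtype.ext (by rw [gen_smul, h1])
  obtain ⟨d, hd⟩ := (isUnit_gen_sub_one s.semisimple hi).exists_left_inv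
  rw [← one_smul i.A v, ← hd, mul_smul, h2, smul_zero]

theorem exists_dual_families [FiniteDimensional K V] (s : SemisimpleIsometry q γ)
    (hi : i.gen ^ 2 ≠ 1) : ∃ (κ : Type) (_ : Fintype κ) (w w' : κ → i.space),
      (∀ v : i.space, v = ∑ k, QuadraticMap.polar q (v : V) (w' k) • w k) ∧
      ∀ v : i.space, v = ∑ k, QuadraticMap.polar q (w k : V) v • w' k := by
  let B : LinearMap.BilinForm K i.space := q.polarBilin.domRestrict₁₂ i.space i.space
  have hB : ∀ v w, B v w = QuadraticMap.polar q (v : V) w := fun v w => rfl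
  have hBn : B.Nondegenerate := by
    refine ⟨fun v hv => eq_zero_of_polar_eq_zero s hi hv, fun v hv =>
      eq_zero_of_polar_eq_zero s hi fun w => ?_⟩
    rw [QuadraticMap.polar_comm]
    exact hv w
  have hBs : B.IsSymm := ⟨fun v w => QuadraticMap.polar_comm q (v : V) w⟩
  let b := Module.finBasis K i.space
  refine ⟨_, inferInstance, B.dualBasis hBn b, b, fun v => ?_, fun v => ?_⟩
  · conv_lhs => rw [← (B.dualBasis hBn b).sum_repr v]
    exact Finset.sum_congr rfl fun k _ => by
      rw [LinearMap.BilinForm.dualBasis_repr_apply, hB]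
  · conv_lhs => rw [← b.sum_repr v]
    refine Finset.sum_congr rfl fun k _ => ?_
    rw [← hB, ← hBs.eq, ← LinearMap.BilinForm.dualBasis_repr_apply hBn,
      LinearMap.BilinForm.dualBasis_dualBasis hBn hBs]

/-- `h_i(e v) = e τ(e) B_i(v, v) = 0`. Working with `h_i` gives isotropy for `q` and not merely for
its polar form. -/
theorem apply_idem_smul [FiniteDimensional K V] (s : SemisimpleIsometry q γ)
    (hi : i.gen ^ 2 ≠ 1) {e : i.A} (he : e * i.tau e = 0) (v : i.space) :
    q ((e • v : i.space) : V) = 0 := by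
  obtain ⟨H, hH, -⟩ := existsUnique_herm s i
  have h1 : H.form (e • v) = 0 := Subtype.ext (by
    rw [coe_form hi, H.smul_left, H.smul_right, ← mul_assoc, he, zero_mul]; rfl)
  rw [hH, h1, map_zero]

theorem baseForm_act_eq_zero [FiniteDimensional K V] (s : SemisimpleIsometry q γ)
    (hi : i.gen ^ 2 ≠ 1) {e : i.A} (he : e * i.tau e = 0) (x : R ⊗[K] i.space) :
    baseForm q i R (i.act R e x) = 0 := by
  induction x with
  | zero => simp
  | tmul r v => rw [act_tmul, baseForm_tmul, apply_idem_smul s hi he, map_zero, mul_zero]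
  | add x y hx hy =>
    rw [map_add, QuadraticMap.map_add (baseForm q i R), hx, hy, polar_act s,
      ← Module.End.mul_apply, ← act_mul, mul_comm, he, act_zero]
    simp

/-- The idempotents `(1, 0)` and `(0, 1)` are exchanged by `τ`, hence adjoint to each other. Dual
families are obtained by cutting dual bases of `V_i` with them and extending to `R`. -/
theorem isotropicSplitting [FiniteDimensional K V] (s : SemisimpleIsometry q γ)
    (hi : i.gen ^ 2 ≠ 1) (φ : i.Splitting) :
    IsotropicSplitting (baseForm q i R) (i.act R (idem φ)) (i.act R (idem' φ)) where
  add_eq := by rw [← act_add, idem_add, act_one]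
  mul_eq := by rw [← act_mul, idem_mul, act_zero]
  mul_eq' := by rw [← act_mul, mul_comm, idem_mul, act_zero]
  left := baseForm_act_eq_zero s hi (by rw [tau_idem, idem_mul])
  right := baseForm_act_eq_zero s hi (by rw [tau_idem', mul_comm, idem_mul])
  adj x y := by rw [polar_act s, tau_idem]
  dual := by
    obtain ⟨κ, _, w, w', h1, h2⟩ := exists_dual_families s hi
    refine ⟨κ, inferInstance, fun k => 1 ⊗ₜ (idem φ • w k), fun k => 1 ⊗ₜ (idem' φ • w' k),
      fun x => ?_, fun x => ?_, fun k => ?_⟩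
    · induction x with
      | zero => simp
      | tmul r v =>
        rw [act_tmul, ← idem_mul_self, mul_smul, h1 (idem φ • v), Finset.smul_sum,
          TensorProduct.tmul_sum, idem_mul_self]
        refine Finset.sum_congr rfl fun k _ => ?_
        rw [s.polar_smul, tau_idem, polar_baseForm_tmul, TensorProduct.smul_tmul', smul_comm,
          TensorProduct.tmul_smul, TensorProduct.smul_tmul', Algebra.smul_def, mul_one, smul_eq_mul,
          mul_one, mul_comm]
      | add x y hx hy =>
        simp only [map_add, QuadraticMap.polar_add_left, add_smul, Finset.sum_add_distrib, hx, hy]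
    · induction x with
      | zero => simp
      | tmul r v =>
        have h3 : idem' φ * idem' φ = idem' φ := by
          rw [← tau_idem, ← map_mul, idem_mul_self]
        rw [act_tmul, ← h3, mul_smul, h2 (idem' φ • v), Finset.smul_sum,
          TensorProduct.tmul_sum, h3]
        refine Finset.sum_congr rfl fun k _ => ?_
        rw [← tau_idem, ← s.polar_smul, tau_idem, polar_baseForm_tmul,
          TensorProduct.smul_tmul', smul_comm, TensorProduct.tmul_smul,
          TensorProduct.smul_tmul', Algebra.smul_def, one_mul, smul_eq_mul,
          mul_one, mul_comm]
      | add x y hx hy =>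
        simp only [map_add, QuadraticMap.polar_add_right, add_smul, Finset.sum_add_distrib, hx, hy]
    · rw [act_tmul, ← mul_smul, ← tau_idem, ← map_mul, idem_mul_self]

/-- The automorphism `a` is extended by zero to `t a` on `R ⊗ V_i`, then completed by its
contragredient on the other isotropic summand. -/
theorem exists_isometry_of_W [FiniteDimensional K V] (s : SemisimpleIsometry q γ)
    (hi : i.gen ^ 2 ≠ 1) (φ : i.Splitting)
    (a : LinearMap.GeneralLinearGroup R (R ⊗[K] i.W φ))
    (ha : ∀ f : i.F, Commute a.val ((Algebra.lsmul K K (i.W φ) f).baseChange R)) :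
    ∃ u ∈ isometries q i R, ∀ y, u.val ((i.WInclusion φ).baseChange R y) =
      (i.WInclusion φ).baseChange R (a.val y) := by
  let t : Module.End R (R ⊗[K] i.W φ) → Module.End R (R ⊗[K] i.space) := fun a =>
    (i.WInclusion φ).baseChange R ∘ₗ a ∘ₗ (WProj φ).baseChange R
  have ht : ∀ a x, t a x =
    (i.WInclusion φ).baseChange R (a ((WProj φ).baseChange R x)) := fun a x => rfl
  have hmul : ∀ a b, t a * t b = t (a * b) := fun a b => LinearMap.ext fun x => by
    rw [Module.End.mul_apply, ht, ht, WProj_baseChange_WInclusion]; rfl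
  have hone : t 1 = i.act R (idem φ) := LinearMap.ext fun x => WInclusion_baseChange_WProj φ x
  have hcomm : ∀ a : Module.End R (R ⊗[K] i.W φ),
      (∀ f : i.F, Commute a ((Algebra.lsmul K K (i.W φ) f).baseChange R)) →
      ∀ b, Commute (t a) (i.act R b) := fun a ha b => LinearMap.ext fun x => by
    rw [Module.End.mul_apply, Module.End.mul_apply, ht, ht, WProj_act, act_WInclusion]
    exact congrArg _ (LinearMap.congr_fun (ha _).eq _)
  obtain ⟨u, hu, huq, huc⟩ := (isotropicSplitting (R := R) s hi φ).exists_extension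
    (T := t a.val) (T' := t a⁻¹.val) (by rw [← hone, hmul, mul_one]) (by rw [← hone, hmul, one_mul])
    (by rw [← hone, hmul, mul_one]) (by rw [← hone, hmul, one_mul])
    (by rw [hmul, a.mul_inv, hone]) (by rw [hmul, a.inv_mul, hone])
  refine ⟨u, mem_isometries.2 ⟨fun b => ?_, huq⟩, fun y => ?_⟩
  -- The adjoint of multiplication by `b` is multiplication by `τ(b)`, and `t` of each automorphism
  -- commutes with all of `A_i`.
  · refine huc (i.act R b) (i.act R (i.tau b)) (fun x y => ?_) (act_commute _ _ _ _)
      (hcomm _ ha b) (hcomm _ (fun f => (ha f).units_inv_left) _)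
    rw [polar_act s, tau_tau]
  · have h1 := LinearMap.congr_fun hu ((i.WInclusion φ).baseChange R y)
    rw [Module.End.mul_apply, ht, WProj_baseChange_WInclusion, ← WInclusion_baseChange_WProj,
      WProj_baseChange_WInclusion] at h1
    exact h1

theorem exists_W_of_isometry (φ : i.Splitting)
    {u : LinearMap.GeneralLinearGroup R (R ⊗[K] i.space)} (hu : u ∈ isometries q i R) :
    ∃ a : LinearMap.GeneralLinearGroup R (R ⊗[K] i.W φ),
      (∀ f : i.F, Commute a.val ((Algebra.lsmul K K (i.W φ) f).baseChange R)) ∧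
      ∀ y, u.val ((i.WInclusion φ).baseChange R y) =
        (i.WInclusion φ).baseChange R (a.val y) := by
  let t : Module.End R (R ⊗[K] i.space) → Module.End R (R ⊗[K] i.W φ) := fun u =>
    (WProj φ).baseChange R ∘ₗ u ∘ₗ (i.WInclusion φ).baseChange R
  have ht : ∀ u y, t u y =
    (WProj φ).baseChange R (u ((i.WInclusion φ).baseChange R y)) := fun a x => rfl
  have key : ∀ u : Module.End R (R ⊗[K] i.space), (∀ a, Commute u (i.act R a)) →
      ∀ y, (i.WInclusion φ).baseChange R (t u y) = u ((i.WInclusion φ).baseChange R y) :=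
    fun u hu y => by
      rw [ht, WInclusion_baseChange_WProj, ← Module.End.mul_apply, ← (hu _).eq,
        Module.End.mul_apply, ← WInclusion_baseChange_WProj, WProj_baseChange_WInclusion]
  have hmul : ∀ u u' : Module.End R (R ⊗[K] i.space), (∀ a, Commute u' (i.act R a)) →
      u * u' = 1 → t u * t u' = 1 := fun u u' hu' h => LinearMap.ext fun y => by
    rw [Module.End.mul_apply, ht u, key u' hu', ← Module.End.mul_apply, h, Module.End.one_apply,
      WProj_baseChange_WInclusion, Module.End.one_apply]
  have hc := (mem_isometries.1 hu).1
  have hc' : ∀ a, Commute u⁻¹.val (i.act R a) := fun a => (hc a).units_inv_left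
  refine ⟨⟨t u.val, t u⁻¹.val, hmul _ _ hc' u.mul_inv, hmul _ _ hc u.inv_mul⟩, fun f => ?_,
    fun y => (key _ hc y).symm⟩
  refine LinearMap.ext fun y => ?_
  have hf : (φ.1 (f : i.A)).1 = f := by
    have h1 : φ.1 (algebraMap i.F i.A f) = algebraMap i.F (i.F × i.F) f := φ.1.commutes f
    exact congrArg Prod.fst h1
  rw [Module.End.mul_apply, Module.End.mul_apply]
  change t u.val _ = _
  rw [ht]
  nth_rw 1 [← hf]
  rw [← act_WInclusion, ← Module.End.mul_apply, (hc _).eq, Module.End.mul_apply, WProj_act, hf]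
  rfl

/-- The quotient of the two isometries is the identity on `R ⊗ W_i`, hence everywhere by duality. -/
theorem isometry_eq_of_W [FiniteDimensional K V] (s : SemisimpleIsometry q γ)
    (hi : i.gen ^ 2 ≠ 1) (φ : i.Splitting)
    {u u' : LinearMap.GeneralLinearGroup R (R ⊗[K] i.space)} (hu : u ∈ isometries q i R)
    (hu' : u' ∈ isometries q i R)
    (h : ∀ y, u.val ((i.WInclusion φ).baseChange R y) =
      u'.val ((i.WInclusion φ).baseChange R y)) : u = u' := by
  have hw : u'⁻¹ * u ∈ isometries q i R := mul_mem (inv_mem hu') hu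
  have h1 : (u'⁻¹ * u).val = 1 := by
    refine (isotropicSplitting (R := R) s hi φ).eq_one_of_mul_eq
      (polar_of_mem_isometries hw) ((mem_isometries.1 hw).1 _) ?_
    refine LinearMap.ext fun x => ?_
    rw [Module.End.mul_apply, ← WInclusion_baseChange_WProj, Units.val_mul, Module.End.mul_apply, h,
      ← Module.End.mul_apply, Units.inv_mul]
    rfl
  have h2 : u'⁻¹ * u = 1 := Units.ext h1
  rw [inv_mul_eq_one] at h2
  exact h2.symm

end FactorIndex

end Indices

/-! ### The restriction correspondence on `R`-points -/

section Restriction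

theorem forall_scalarMap_iff {K F R N V : Type u} [CommRing K] [CommRing F] [Algebra K F]
    [CommRing R] [Algebra K R] [AddCommGroup N] [Module K N] [Module F N] [IsScalarTower K F N]
    [AddCommGroup V] [Module K V] (j : N →ₗ[K] V)
    (p : Module.End (F ⊗[K] R) ((F ⊗[K] R) ⊗[F] N)) (g : Module.End R (R ⊗[K] V)) :
    (∀ x, scalarMap j R (p x) = g (scalarMap j R x)) ↔
      ∀ y, j.baseChange R (descend p y) = g (j.baseChange R y) := by
  rw [(scalarEquiv K F R N).surjective.forall]
  simp only [descend_apply, scalarMap_apply]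

variable {K V : Type u} [Field K] [AddCommGroup V] [Module K V] {γ : Module.End K V}
  {q : QuadraticForm K V}

/-- The complementary idempotents are zero divisors. Thus field and split types exclude each other,
which makes the clauses of `IsComponent` compatible. -/
theorem FactorIndex.IsSplit.not_isField {i : FactorIndex γ} (hi : i.IsSplit) : ¬ IsField i.A := by
  obtain ⟨-, ⟨φ⟩⟩ := hi
  intro hA
  let := hA.toField
  have := i.isField_F.nontrivial
  rcases mul_eq_zero.1 (idem_mul φ) with h | h
  · exact one_ne_zero (congrArg Prod.fst ((map_eq_zero_iff _ φ.1.symm.injective).1 h))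
  · exact one_ne_zero (congrArg Prod.snd ((map_eq_zero_iff _ φ.1.symm.injective).1 h))

section Points

variable {h : ∀ i : FactorIndex γ, i.Herm}
  {φ : ∀ i : {i : FactorIndex γ // i.IsSplit}, i.1.Splitting} {R : CommAlgCat.{u} K}

/-- The component at `i ∈ I_triv` of a point of the product. -/
noncomputable def trivPart (p : (productFunctor h φ).obj R)
    (i : {i : FactorIndex γ // i.IsTriv}) :
    orthogonalPoints (h i.1).form (i.1.F ⊗[K] R) := p.1 i

/-- The component at `i ∈ I_field` of a point of the product. -/
noncomputable def fieldPart (p : (productFunctor h φ).obj R)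
    (i : {i : FactorIndex γ // i.IsFieldType}) :
    unitaryPoints (h i.1).sesq (i.1.F ⊗[K] R) := p.2.1 i

/-- The component at `i ∈ I_split` of a point of the product. -/
noncomputable def splitPart (p : (productFunctor h φ).obj R)
    (i : {i : FactorIndex γ // i.IsSplit}) :
    LinearMap.GeneralLinearGroup (i.1.F ⊗[K] R) ((i.1.F ⊗[K] R) ⊗[i.1.F] i.1.W (φ i)) := p.2.2 i

/-- A point of `Res O(V_i, h_i)`. -/
noncomputable def orthogonalPoint {i : FactorIndex γ} {H : i.Herm}
    (p : orthogonalPoints H.form (i.F ⊗[K] R)) :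
    (GroupFunctor.weilRes K (orthogonalFunctor H.form)).obj R := p

/-- A point of `Res U(V_i, h_i)`. -/
noncomputable def unitaryPoint {i : FactorIndex γ} {H : i.Herm}
    (p : unitaryPoints H.sesq (i.F ⊗[K] R)) :
    (GroupFunctor.weilRes K (unitaryFunctor H.sesq)).obj R := p

/-- A point of `Res GL(W_i)`. -/
noncomputable def linearPoint {i : FactorIndex γ} {φ : i.Splitting}
    (p : LinearMap.GeneralLinearGroup (i.F ⊗[K] R) ((i.F ⊗[K] R) ⊗[i.F] i.W φ)) :
    (GroupFunctor.weilRes K (glFunctor i.F (i.W φ))).obj R := p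

/-- The point of the product with given components. -/
noncomputable def productPoint
    (p : ∀ i : {i : FactorIndex γ // i.IsTriv}, orthogonalPoints (h i.1).form (i.1.F ⊗[K] R))
    (p' : ∀ i : {i : FactorIndex γ // i.IsFieldType}, unitaryPoints (h i.1).sesq (i.1.F ⊗[K] R))
    (p'' : ∀ i : {i : FactorIndex γ // i.IsSplit},
      LinearMap.GeneralLinearGroup (i.1.F ⊗[K] R) ((i.1.F ⊗[K] R) ⊗[i.1.F] i.1.W (φ i))) :
    (productFunctor h φ).obj R :=
  ⟨fun i => orthogonalPoint (p i), fun i => unitaryPoint (p' i), fun i => linearPoint (p'' i)⟩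

end Points

end Restriction

section Restriction

variable {K V : Type u} [Field K] [AddCommGroup V] [Module K V] {γ : Module.End K V}
  {q : QuadraticForm K V}

section Points

variable {h : ∀ i : FactorIndex γ, i.Herm}
  {φ : ∀ i : {i : FactorIndex γ // i.IsSplit}, i.1.Splitting} {R : CommAlgCat.{u} K}

/-- The automorphism of `R ⊗ V` underlying a point of the centraliser. -/
noncomputable def centralizerPoint (g : (centralizerFunctor q γ).obj R) :
    LinearMap.GeneralLinearGroup R (R ⊗[K] V) := g.1.1

theorem apply_eq_of_trivPart_eq {p p' : (productFunctor h φ).obj R}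
    (i : {i : FactorIndex γ // i.IsTriv}) (h1 : trivPart p i = trivPart p' i) : p.1 i = p'.1 i :=
  congrArg orthogonalPoint h1

theorem apply_eq_of_fieldPart_eq {p p' : (productFunctor h φ).obj R}
    (i : {i : FactorIndex γ // i.IsFieldType}) (h1 : fieldPart p i = fieldPart p' i) :
    p.2.1 i = p'.2.1 i :=
  congrArg unitaryPoint h1

theorem apply_eq_of_splitPart_eq {p p' : (productFunctor h φ).obj R}
    (i : {i : FactorIndex γ // i.IsSplit}) (h1 : splitPart p i = splitPart p' i) :
    p.2.2 i = p'.2.2 i :=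
  congrArg linearPoint h1

theorem productFunctor_ext {p p' : (productFunctor h φ).obj R} (h1 : ∀ i, p.1 i = p'.1 i)
    (h2 : ∀ i, p.2.1 i = p'.2.1 i) (h3 : ∀ i, p.2.2 i = p'.2.2 i) : p = p' :=
  Prod.ext (funext h1) (Prod.ext (funext h2) (funext h3))

theorem productPoint_ext {p p' : (productFunctor h φ).obj R}
    (h1 : ∀ i, trivPart p i = trivPart p' i) (h2 : ∀ i, fieldPart p i = fieldPart p' i)
    (h3 : ∀ i, splitPart p i = splitPart p' i) : p = p' :=
  productFunctor_ext (fun i => apply_eq_of_trivPart_eq i (h1 i))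
    (fun i => apply_eq_of_fieldPart_eq i (h2 i)) (fun i => apply_eq_of_splitPart_eq i (h3 i))

/-- The point of the centraliser given by an automorphism of `R ⊗ V`. -/
noncomputable def mkCentralizerPoint (g : LinearMap.GeneralLinearGroup R (R ⊗[K] V))
    (hg : g ∈ orthogonalGroup (quadraticBaseChange q R))
    (hg' : g ∈ commutingGroup (γ.baseChange R)) : (centralizerFunctor q γ).obj R :=
  ⟨⟨g, hg⟩, hg'⟩

theorem centralizerPoint_injective :
    Function.Injective (centralizerPoint : (centralizerFunctor q γ).obj R → _) :=
  fun _ _ h => Subtype.ext (Subtype.ext h)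

theorem centralizerPoint_mem_orthogonal (g : (centralizerFunctor q γ).obj R) :
    centralizerPoint g ∈ orthogonalGroup (quadraticBaseChange q R) := g.1.2

theorem centralizerPoint_mem_commuting (g : (centralizerFunctor q γ).obj R) :
    centralizerPoint g ∈ commutingGroup (γ.baseChange R) := g.2

/-- All conditions are moved to `R ⊗ V_i` along `descend`, where the results on isometries of single
summands apply. -/
theorem isRestriction_iff (g : (centralizerFunctor q γ).obj R) (p : (productFunctor h φ).obj R) :
    IsRestriction h φ R g p ↔
      (∀ (i : {i : FactorIndex γ // i.IsTriv}) y, i.1.extIncl R (descend (trivPart p i).1.val y) =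
        (centralizerPoint g).val (i.1.extIncl R y)) ∧
      (∀ (i : {i : FactorIndex γ // i.IsFieldType}) y,
        i.1.extIncl R (descend (fieldPart p i).1.val y) =
        (centralizerPoint g).val (i.1.extIncl R y)) ∧
      (∀ (i : {i : FactorIndex γ // i.IsSplit}) y,
        i.1.extIncl R ((i.1.WInclusion (φ i)).baseChange R (descend (splitPart p i).val y)) =
        (centralizerPoint g).val (i.1.extIncl R ((i.1.WInclusion (φ i)).baseChange R y))) := by
  refine and_congr (forall_congr' fun i => ?_) (and_congr (forall_congr' fun i => ?_)
    (forall_congr' fun i => ?_))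
  · exact forall_scalarMap_iff i.1.space.subtype (trivPart p i).1.val (centralizerPoint g).val
  · exact forall_scalarMap_iff i.1.space.subtype (fieldPart p i).1.val (centralizerPoint g).val
  · have h1 := forall_scalarMap_iff (i.1.space.subtype ∘ₗ i.1.WInclusion (φ i))
      (splitPart p i).val (centralizerPoint g).val
    simp only [LinearMap.baseChange_comp, LinearMap.comp_apply] at h1
    rw [← h1]
    simp only [← FactorIndex.incl_lTensor_eq_scalarMap]
    rfl

theorem isRestriction_productPoint (g : (centralizerFunctor q γ).obj R)
    (p : ∀ i : {i : FactorIndex γ // i.IsTriv}, orthogonalPoints (h i.1).form (i.1.F ⊗[K] R))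
    (p' : ∀ i : {i : FactorIndex γ // i.IsFieldType}, unitaryPoints (h i.1).sesq (i.1.F ⊗[K] R))
    (p'' : ∀ i : {i : FactorIndex γ // i.IsSplit},
      LinearMap.GeneralLinearGroup (i.1.F ⊗[K] R) ((i.1.F ⊗[K] R) ⊗[i.1.F] i.1.W (φ i)))
    (h1 : ∀ (i : {i : FactorIndex γ // i.IsTriv}) y, i.1.extIncl R (descend (p i).1.val y) =
      (centralizerPoint g).val (i.1.extIncl R y))
    (h2 : ∀ (i : {i : FactorIndex γ // i.IsFieldType}) y, i.1.extIncl R (descend (p' i).1.val y) =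
      (centralizerPoint g).val (i.1.extIncl R y))
    (h3 : ∀ (i : {i : FactorIndex γ // i.IsSplit}) y,
      i.1.extIncl R ((i.1.WInclusion (φ i)).baseChange R (descend (p'' i).val y)) =
      (centralizerPoint g).val (i.1.extIncl R ((i.1.WInclusion (φ i)).baseChange R y))) :
    IsRestriction h φ R g (productPoint p p' p'') :=
  (isRestriction_iff g _).2 ⟨h1, h2, h3⟩

variable (q) in
/-- `u` is an isometry of `R ⊗ V_i` which restricts to the component at `i` of `p`. -/
structure IsComponent (p : (productFunctor h φ).obj R) (i : FactorIndex γ)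
    (u : LinearMap.GeneralLinearGroup R (R ⊗[K] i.space)) : Prop where
  mem : u ∈ FactorIndex.isometries q i R
  triv : ∀ hi : i.IsTriv, ∀ y, u.val y = descend (trivPart p ⟨i, hi⟩).1.val y
  field : ∀ hi : i.IsFieldType, ∀ y, u.val y = descend (fieldPart p ⟨i, hi⟩).1.val y
  split : ∀ hi : i.IsSplit, ∀ y, u.val ((i.WInclusion (φ ⟨i, hi⟩)).baseChange R y) =
    (i.WInclusion (φ ⟨i, hi⟩)).baseChange R (descend (splitPart p ⟨i, hi⟩).val y)

theorem exists_isComponent_of_isTriv (p : (productFunctor h φ).obj R) {i : FactorIndex γ}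
    (hi : i.IsTriv) (hh : i.IsTraceForm q (h i)) : ∃ u, IsComponent q p i u := by
  have hp := (trivPart p ⟨i, hi⟩).2
  have hu := (FactorIndex.descend_mem_isometries_iff_of_isTriv hi hh (trivPart p ⟨i, hi⟩).1).2 hp
  exact ⟨_, hu, fun _ y => LinearMap.congr_fun (Units.coe_map _ _) y,
    fun hi' => absurd hi.1 hi'.1, fun hi' => absurd hi.1 hi'.1⟩

theorem exists_isComponent_of_isFieldType (hγ : AbsolutelySemisimple γ)
    (p : (productFunctor h φ).obj R) {i : FactorIndex γ}
    (hi : i.IsFieldType) (hh : i.IsTraceForm q (h i)) : ∃ u, IsComponent q p i u := by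
  have hp := (fieldPart p ⟨i, hi⟩).2
  have hu := (FactorIndex.descend_mem_isometries_iff hγ hi.1 hh (fieldPart p ⟨i, hi⟩).1).2 hp
  exact ⟨_, hu, fun hi' => absurd hi'.1 hi.1,
    fun _ y => LinearMap.congr_fun (Units.coe_map _ _) y,
    fun hi' => absurd hi.2.1 hi'.not_isField⟩

theorem exists_isComponent_of_isSplit [FiniteDimensional K V] (s : SemisimpleIsometry q γ)
    (p : (productFunctor h φ).obj R) {i : FactorIndex γ} (hi : i.IsSplit) :
    ∃ u, IsComponent q p i u := by
  obtain ⟨u, hu, hu'⟩ := FactorIndex.exists_isometry_of_W s hi.1 (φ ⟨i, hi⟩)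
    (Units.map descend (splitPart p ⟨i, hi⟩)) fun f => descend_commute _ f
  exact ⟨u, hu, fun hi' => absurd hi'.1 hi.1, fun hi' => absurd hi'.2.1 hi.not_isField,
    fun _ y => hu' y⟩

end Points

end Restriction

section Restriction

variable {K V : Type u} [Field K] [AddCommGroup V] [Module K V] [FiniteDimensional K V]
  {γ : Module.End K V} {q : QuadraticForm K V}

section Points

variable {h : ∀ i : FactorIndex γ, i.Herm}
  {φ : ∀ i : {i : FactorIndex γ // i.IsSplit}, i.1.Splitting} {R : CommAlgCat.{u} K}

/-- The restriction of `g` to `R ⊗ V_i` commutes with `A_i`, in particular with `F_i`, so it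
descends from an `F_i ⊗ R`-linear automorphism. For split `i` it also preserves `R ⊗ W_i`. -/
theorem exists_isRestriction (s : SemisimpleIsometry q γ)
    (hh : ∀ i : FactorIndex γ, i.IsTraceForm q (h i)) (g : (centralizerFunctor q γ).obj R) :
    ∃ p : (productFunctor h φ).obj R, IsRestriction h φ R g p := by
  choose u hu hug using fun i : FactorIndex γ => s.exists_restriction i
    (centralizerPoint_mem_orthogonal g) (centralizerPoint_mem_commuting g)
  have hdesc : ∀ i : FactorIndex γ, ∃ p : LinearMap.GeneralLinearGroup (i.F ⊗[K] R)
      ((i.F ⊗[K] R) ⊗[i.F] i.space), descend p.val = (u i).val := fun i =>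
    exists_unit_descend_eq fun f => (FactorIndex.mem_isometries.1 (hu i)).1 f
  choose p hp using hdesc
  have hp' : ∀ i, Units.map descend (p i) ∈ FactorIndex.isometries q i R := fun i => by
    rw [show Units.map descend (p i) = u i from Units.ext (hp i)]
    exact hu i
  have hsplit : ∀ i : {i : FactorIndex γ // i.IsSplit},
      ∃ p : LinearMap.GeneralLinearGroup (i.1.F ⊗[K] R) ((i.1.F ⊗[K] R) ⊗[i.1.F] i.1.W (φ i)),
        ∀ y, (u i.1).val ((i.1.WInclusion (φ i)).baseChange R y) =
          (i.1.WInclusion (φ i)).baseChange R (descend p.val y) := fun i => by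
    obtain ⟨a, ha, ha'⟩ := FactorIndex.exists_W_of_isometry (φ i) (hu i.1)
    obtain ⟨p, hp⟩ := exists_unit_descend_eq ha
    exact ⟨p, fun y => by rw [hp, ha']⟩
  choose p'' hp'' using hsplit
  refine ⟨productPoint
    (fun i => ⟨p i.1, (FactorIndex.descend_mem_isometries_iff_of_isTriv i.2 (hh i.1) _).1
      (hp' i.1)⟩)
    (fun i => ⟨p i.1, (FactorIndex.descend_mem_isometries_iff s.semisimple i.2.1 (hh i.1) _).1
      (hp' i.1)⟩) p'',
    isRestriction_productPoint g _ _ _ (fun i y => ?_) (fun i y => ?_) fun i y => ?_⟩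
  · rw [hp, hug]
  · rw [hp, hug]
  · rw [← hp'', hug]

theorem baseChange_injective {N P : Type u} [AddCommGroup N] [Module K N] [AddCommGroup P]
    [Module K P] {j : N →ₗ[K] P} (hj : Function.Injective j) :
    Function.Injective (j.baseChange R) :=
  Module.Flat.lTensor_preserves_injective_linearMap (M := R) j hj

/-- Over a field the inclusions of `V_i` and `W_i` stay injective after tensoring with `R`. -/
theorem IsRestriction.right_unique {g : (centralizerFunctor q γ).obj R}
    {p p' : (productFunctor h φ).obj R} (hp : IsRestriction h φ R g p)
    (hp' : IsRestriction h φ R g p') : p = p' := by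
  obtain ⟨h1, h2, h3⟩ := (isRestriction_iff g p).1 hp
  obtain ⟨h1', h2', h3'⟩ := (isRestriction_iff g p').1 hp'
  have hinj : ∀ i : FactorIndex γ, Function.Injective (i.extIncl R) := fun i =>
    baseChange_injective i.space.injective_subtype
  refine productPoint_ext (fun i => Subtype.ext (Units.ext (descend_injective ?_)))
    (fun i => Subtype.ext (Units.ext (descend_injective ?_)))
    (fun i => Units.ext (descend_injective ?_))
  · exact LinearMap.ext fun y => hinj _ ((h1 i y).trans (h1' i y).symm)
  · exact LinearMap.ext fun y => hinj _ ((h2 i y).trans (h2' i y).symm)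
  · have hinj' : Function.Injective ((i.1.WInclusion (φ i)).baseChange R) :=
      baseChange_injective (i.1.W (φ i)).injective_subtype
    exact LinearMap.ext fun y => hinj' (hinj _ ((h3 i y).trans (h3' i y).symm))

theorem exists_isRestriction_left (s : SemisimpleIsometry q γ)
    (hh : ∀ i : FactorIndex γ, i.IsTraceForm q (h i)) (p : (productFunctor h φ).obj R) :
    ∃ g : (centralizerFunctor q γ).obj R, IsRestriction h φ R g p := by
  have key : ∀ i : FactorIndex γ, ∃ u, IsComponent q p i u := fun i => by
    rcases FactorIndex.type_trichotomy s.semisimple i with hi | hi | hi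
    · exact exists_isComponent_of_isTriv p hi (hh i)
    · exact exists_isComponent_of_isFieldType s.semisimple p hi (hh i)
    · exact exists_isComponent_of_isSplit s p hi
  choose u hu using key
  obtain ⟨g, hg, hg', hgu⟩ := s.exists_glue u fun i => (hu i).mem
  refine ⟨mkCentralizerPoint g hg hg', (isRestriction_iff _ _).2
    ⟨fun i y => ?_, fun i y => ?_, fun i y => ?_⟩⟩
  · rw [← (hu i.1).triv i.2, hgu]; rfl
  · rw [← (hu i.1).field i.2, hgu]; rfl
  · rw [← (hu i.1).split i.2, hgu]; rfl

/-- The `R ⊗ V_i` span `R ⊗ V`. On a split summand the values on `R ⊗ W_i` suffice by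
`isometry_eq_of_W`. -/
theorem IsRestriction.left_unique (s : SemisimpleIsometry q γ)
    {g g' : (centralizerFunctor q γ).obj R}
    {p : (productFunctor h φ).obj R} (hp : IsRestriction h φ R g p)
    (hp' : IsRestriction h φ R g' p) : g = g' := by
  let := Fintype.ofFinite (FactorIndex γ)
  obtain ⟨h1, h2, h3⟩ := (isRestriction_iff g p).1 hp
  obtain ⟨h1', h2', h3'⟩ := (isRestriction_iff g' p).1 hp'
  refine centralizerPoint_injective (Units.ext (LinearMap.ext fun x => ?_))
  rw [← s.sum_subtype_proj_baseChange R x, map_sum, map_sum]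
  refine Finset.sum_congr rfl fun i _ => ?_
  rcases FactorIndex.type_trichotomy s.semisimple i with hi | hi | hi
  · rw [← h1 ⟨i, hi⟩, h1' ⟨i, hi⟩]
  · rw [← h2 ⟨i, hi⟩, h2' ⟨i, hi⟩]
  · obtain ⟨u, hu, hug⟩ := s.exists_restriction i
      (centralizerPoint_mem_orthogonal g) (centralizerPoint_mem_commuting g)
    obtain ⟨u', hu', hug'⟩ := s.exists_restriction i
      (centralizerPoint_mem_orthogonal g') (centralizerPoint_mem_commuting g')
    have hw : u = u' := FactorIndex.isometry_eq_of_W s hi.1 (φ ⟨i, hi⟩) hu hu' fun y =>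
      s.subtype_baseChange_injective i R (by
        rw [hug, hug', ← h3 ⟨i, hi⟩, h3' ⟨i, hi⟩])
    rw [← hug, ← hug', hw]

theorem IsRestriction.mul {g g' : (centralizerFunctor q γ).obj R}
    {p p' : (productFunctor h φ).obj R} (hp : IsRestriction h φ R g p)
    (hp' : IsRestriction h φ R g' p') : IsRestriction h φ R (g * g') (p * p') :=
  ⟨fun i x => (hp.1 i _).trans (congrArg g.1.1.val (hp'.1 i x)),
    fun i x => (hp.2.1 i _).trans (congrArg g.1.1.val (hp'.2.1 i x)),
    fun i x => (hp.2.2 i _).trans (congrArg g.1.1.val (hp'.2.2 i x))⟩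

end Points

end Restriction

/-! ### The isomorphism of group functors -/

section Isomorphism

variable {K V : Type u} [Field K] [AddCommGroup V] [Module K V]
  {γ : Module.End K V} {q : QuadraticForm K V}
  {h : ∀ i : FactorIndex γ, i.Herm}
  {φ : ∀ i : {i : FactorIndex γ // i.IsSplit}, i.1.Splitting}

theorem IsRestriction.map {R T : CommAlgCat.{u} K} (f : R ⟶ T)
    {g : (centralizerFunctor q γ).obj R} {p : (productFunctor h φ).obj R}
    (hp : IsRestriction h φ R g p) :
    IsRestriction h φ T (((centralizerFunctor q γ).map f).hom g)
      (((productFunctor h φ).map f).hom p) := by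
  refine ⟨fun i x => ?_, fun i x => ?_, fun i x => ?_⟩
  · exact scalarMap_extendEnd i.1.space.subtype f.hom (p := (trivPart p i).1.val)
      (g := (centralizerPoint g).val) (hp.1 i) x
  · exact scalarMap_extendEnd i.1.space.subtype f.hom (p := (fieldPart p i).1.val)
      (g := (centralizerPoint g).val) (hp.2.1 i) x
  · have h1 : ∀ x, scalarMap (i.1.space.subtype ∘ₗ i.1.WInclusion (φ i)) R
        ((splitPart p i).val x) = (centralizerPoint g).val
          (scalarMap (i.1.space.subtype ∘ₗ i.1.WInclusion (φ i)) R x) := fun x => by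
      rw [← FactorIndex.incl_lTensor_eq_scalarMap, ← FactorIndex.incl_lTensor_eq_scalarMap]
      exact hp.2.2 i x
    have h2 := scalarMap_extendEnd (i.1.space.subtype ∘ₗ i.1.WInclusion (φ i)) f.hom h1 x
    rw [← FactorIndex.incl_lTensor_eq_scalarMap, ← FactorIndex.incl_lTensor_eq_scalarMap] at h2
    exact h2

variable [FiniteDimensional K V]

/-- Restriction to the `V_i` and `W_i` on `R`-points. -/
noncomputable def restrictionEquiv (s : SemisimpleIsometry q γ)
    (hh : ∀ i : FactorIndex γ, i.IsTraceForm q (h i)) (R : CommAlgCat.{u} K) :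
    (centralizerFunctor q γ).obj R ≃* (productFunctor h φ).obj R where
  -- The relation `IsRestriction` is the graph of a bijection. The choices are forced, so the
  -- inverse laws, multiplicativity and, below, naturality all follow from uniqueness.
  toFun g := (exists_isRestriction s hh g).choose
  invFun p := (exists_isRestriction_left s hh p).choose
  left_inv g := IsRestriction.left_unique s (exists_isRestriction_left s hh _).choose_spec
    (exists_isRestriction s hh g).choose_spec
  right_inv p := IsRestriction.right_unique (exists_isRestriction s hh _).choose_spec
    (exists_isRestriction_left s hh p).choose_spec
  map_mul' g g' := IsRestriction.right_unique (exists_isRestriction s hh _).choose_spec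
    ((exists_isRestriction s hh g).choose_spec.mul (exists_isRestriction s hh g').choose_spec)

theorem isRestriction_restrictionEquiv (s : SemisimpleIsometry q γ)
    (hh : ∀ i : FactorIndex γ, i.IsTraceForm q (h i)) (R : CommAlgCat.{u} K)
    (g : (centralizerFunctor q γ).obj R) :
    IsRestriction h φ R g (restrictionEquiv s hh R g) :=
  (exists_isRestriction s hh g).choose_spec

/-- Restriction to the `V_i` and `W_i` as an isomorphism of group functors. -/
noncomputable def restrictionIso (s : SemisimpleIsometry q γ)
    (hh : ∀ i : FactorIndex γ, i.IsTraceForm q (h i)) :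
    centralizerFunctor q γ ≅ productFunctor h φ :=
  NatIso.ofComponents (fun R => (restrictionEquiv s hh R).toGrpIso) fun {R T} f =>
    GrpCat.hom_ext (MonoidHom.ext fun g => IsRestriction.right_unique
      (isRestriction_restrictionEquiv s hh T _)
      ((isRestriction_restrictionEquiv s hh R g).map f))

end Isomorphism

theorem mainTheorem7 {K V : Type u} [Field K] [AddCommGroup V] [Module K V]
    [FiniteDimensional K V] (q : QuadraticForm K V) (hq : q.Nondegenerate) :
    (∀ γ : orthogonalGroup q, AbsolutelySemisimple (toEnd γ) →
      (∃ e : Algebra.adjoin K {toEnd γ} ≃ₐ[K] ∀ i : FactorIndex (toEnd γ), i.A,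
        e ⟨toEnd γ, Algebra.self_mem_adjoin_singleton K (toEnd γ)⟩ = fun i => i.gen) ∧
      (iSupIndep fun i : FactorIndex (toEnd γ) => i.space) ∧
      (⨆ i : FactorIndex (toEnd γ), i.space) = ⊤ ∧
      (∀ i j : FactorIndex (toEnd γ), i ≠ j → ∀ v ∈ i.space, ∀ w ∈ j.space,
        QuadraticMap.polar q v w = 0) ∧
      (∀ i : FactorIndex (toEnd γ), i.IsTriv ∨ i.IsFieldType ∨ i.IsSplit) ∧
      (∀ i : FactorIndex (toEnd γ), ∃! h : i.Herm, i.IsTraceForm q h)) ∧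
    (∀ γ γ' : orthogonalGroup q,
      AbsolutelySemisimple (toEnd γ) → AbsolutelySemisimple (toEnd γ') →
      ∀ (h : ∀ i : FactorIndex (toEnd γ), i.Herm) (h' : ∀ i : FactorIndex (toEnd γ'), i.Herm),
      (∀ i : FactorIndex (toEnd γ), i.IsTraceForm q (h i)) →
      (∀ i : FactorIndex (toEnd γ'), i.IsTraceForm q (h' i)) →
      (IsConj γ γ' ↔
        ∃ σ : FactorIndex (toEnd γ) ≃ FactorIndex (toEnd γ'), ∀ i,
          ∃ (φ : i.A ≃ₐ[K] (σ i).A) (f : i.space ≃+ (σ i).space),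
            φ i.gen = (σ i).gen ∧
            (∀ (a : i.A) (v : i.space), f (a • v) = φ a • f v) ∧
            ∀ v : i.space,
              φ (((h i).form v : i.F) : i.A) =
                (((h' (σ i)).form (f v) : (σ i).F) : (σ i).A))) ∧
    (∀ γ : orthogonalGroup q, AbsolutelySemisimple (toEnd γ) →
      ∀ h : ∀ i : FactorIndex (toEnd γ), i.Herm, 
      (∀ i : FactorIndex (toEnd γ), i.IsTraceForm q (h i)) →
      ∀ φ : ∀ i : {i : FactorIndex (toEnd γ) // i.IsSplit}, i.1.Splitting,
      ∃ Θ : centralizerFunctor q (toEnd γ) ≅ productFunctor h φ,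
        ∀ (R : CommAlgCat.{u} K) (g : (centralizerFunctor q (toEnd γ)).obj R),
          IsRestriction h φ R g ((Θ.hom.app R).hom g)) := by
  refine ⟨fun γ hγ => ?_, fun γ γ' hγ hγ' h h' hh hh' => ⟨?_, ?_⟩, fun γ hγ h hh φ => ?_⟩
  · have s := semisimpleIsometry_toEnd hq γ hγ
    refine ⟨⟨s.decomp, ?_⟩, s.iSupIndep_space, s.iSup_space,
      fun i j hij v hv w hw => s.polar_eq_zero hij hv hw,
      FactorIndex.type_trichotomy hγ, FactorIndex.existsUnique_herm s⟩
    have h1 : (⟨toEnd γ, Algebra.self_mem_adjoin_singleton K (toEnd γ)⟩ :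
        Algebra.adjoin K {toEnd γ}) = aevalAdjoin (toEnd γ) X := Subtype.ext (by
      rw [coe_aevalAdjoin, aeval_X])
    rw [h1, s.decomp_aeval]
    exact funext fun i => aeval_X _
  · exact exists_data_of_isConj γ γ' hγ' h h' hh hh'
  · rintro ⟨σ, hσ⟩
    exact isConj_of_data hq γ γ' hγ hγ' h h' hh hh' σ hσ
  · exact ⟨restrictionIso (semisimpleIsometry_toEnd hq γ hγ) hh, fun R g =>
      isRestriction_restrictionEquiv (semisimpleIsometry_toEnd hq γ hγ) hh R g⟩
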